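/- Let $\rho,\sigma>0$. Consider infinitely many Brownian point particles on $\mathbb R$ with hard-core repulsion (a single file): the positions $X_j(t)$, $j\in\mathbb Z$, are continuous in $t$, keep their order $X_j(t)\le X_{j+1}(t)$ for all times, and at each time the set of positions, with multiplicity, is that of independent Brownian particles (independent of the initial configuration) started from the same points, a free particle having displacement density $(\pi\sigma^2t)^{-1/2}e^{-z^2/(\sigma^2t)}$; that is, colliding particles only exchange their labels. The initial state is quenched and uniform: the initial positions $y_j=X_j(0)$ are strictly increasing in $j$, $y_0=0$, and on the macroscopic scale only configurations with flat profile $\rho$ occur, i.e. for every $\varepsilon>0$ there is a constant $K$ with $|y_j-j/\rho|\le\varepsilon|j|+K$ for all $j$, almost surely (for a deterministic configuration: $y_j/j\to1/\rho$ as $j\to\pm\infty$; for example $y_j=j/\rho$). Let $x(t)=X_0(t)$ be the tracer, let $\langle\cdot\rangle_{\rm evolution}$ be the average given the initial configuration, $\langle\cdot\rangle_{\rm initial}$ the average over the initial configuration, and $$M_q(\lambda,t)=\Big\langle\ln\big\langle e^{\lambda x(t)}\big\rangle_{\rm evolution}\Big\rangle_{\rm initial},\qquad \mu(\lambda)=\sigma\rho\int_0^\infty\ln\Big[1+\sinh^2\Big(\frac{\lambda}{2\rho}\Big)\operatorname{erfc}(\eta)\operatorname{erfc}(-\eta)\Big]d\eta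 ,$$ $$I(B)=\int_0^\infty\ln\big[1+\sinh^2(B/2)\operatorname{erfc}(\eta)\operatorname{erfc}(-\eta)\big]d\eta .$$ Then all these quantities are finite and the following holds. 1. For every $\lambda\in\mathbb R$, $M_q(\lambda,t)\simeq\sqrt t\,\mu(\lambda)$ at large times: $\lim_{t\to\infty}M_q(\lambda,t)/\sqrt t=\mu(\lambda)$. 2. The tracer has a continuous quenched large deviation function $\phi_q\ge0$: for every nonempty open $G\subseteq\mathbb R$, $\lim_{t\to\infty}t^{-1/2}\big\langle\ln P\big(x(t)/\sqrt t\in G\,\big|\,\text{initial configuration}\big)\big\rangle_{\rm initial}=-\inf_G\phi_q$. It is given parametrically: $I$ is differentiable, for every $\xi\in\mathbb R$ there is exactly one $B\in\mathbb R$ with $\xi=\sigma I'(B)$, and then $\phi_q(\xi)=\rho B\xi-\rho\sigma I(B)$. Moreover $\mu(\lambda)=\max_\xi\{\lambda\xi-\phi_q(\xi)\}$ for every $\lambda$, and $\phi_q(\xi)\simeq\frac{\rho}{3\sigma^2}|\xi|^3$ as $|\xi|\to\infty$ (the ratio of the two sides tends to $1$). 3. $\mu$ is smooth, and the cumulants $\langle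 x(t)^n\rangle_q=\sqrt t\,\mu^{(n)}(0)$ obtained by expanding the large-time generating function $\sqrt t\,\mu(\lambda)$ in $\lambda$ satisfy: all odd ones vanish, and with $q(\eta)=\operatorname{erfc}(\eta)\operatorname{erfc}(-\eta)$ $$\langle x(t)^2\rangle_q=\frac{\sigma\sqrt t}{2\rho}\int_0^\infty q\,d\eta=\frac{\sigma\sqrt t}{\rho\sqrt{2\pi}},\qquad \langle x(t)^4\rangle_q=\frac{\sigma\sqrt t}{2\rho^3}\int_0^\infty\Big[1-\frac32q\Big]q\,d\eta,$$ $$\langle x(t)^6\rangle_q=\frac{\sigma\sqrt t}{2\rho^5}\int_0^\infty\Big\{1-\frac{15}{2}[1-q]\,q\Big\}q\,d\eta .$$ For equally spaced particles, $y_j=j/\rho$, the function $\lambda\mapsto M_q(\lambda,t)$ is smooth for each $t$, and $t^{-1/2}\,\partial_\lambda^nM_q(\lambda,t)|_{\lambda=0}\to\mu^{(n)}(0)$ as $t\to\infty$ for every $n$. -/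

import Mathlib

open MeasureTheory ProbabilityTheory Filter Topology Set
open scoped NNReal

noncomputable section

namespace SingleFile

/-- The complementary error function. -/
def erfc (x : ℝ) : ℝ := 2 / √Real.pi * ∫ u in Ioi x, Real.exp (-u ^ 2)

/-- The integrand `ln [1 + sinh² (B / 2) erfc η erfc (-η)]`. -/
def logIntegrand (B η : ℝ) : ℝ :=
  Real.log (1 + Real.sinh (B / 2) ^ 2 * (erfc η * erfc (-η)))

/-- `∫₀^∞ ln [1 + sinh² (B / 2) erfc η erfc (-η)] dη`. -/
def logIntegral (B : ℝ) : ℝ := ∫ η in Ioi (0 : ℝ), logIntegrand B η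

/-- The time-independent function
`σ ρ ∫₀^∞ ln [1 + sinh² (l / (2 ρ)) erfc η erfc (-η)] dη`. -/
def limitCGF (ρ σ l : ℝ) : ℝ :=
  σ * ρ * ∫ η in Ioi (0 : ℝ),
    Real.log (1 + Real.sinh (l / (2 * ρ)) ^ 2 * (erfc η * erfc (-η)))

variable {Ω : Type*} [MeasurableSpace Ω]

/-- `y ω j` is the initial position of particle `j`, the tracer being particle `0`, which starts at
the origin. On the macroscopic scale every configuration that is considered has the flat profile of
density `ρ`: the `j`-th particle is at `j / ρ + o(|j|)`, the error being uniform over the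
configurations that are considered. A deterministic configuration is the case of a constant `y`,
and then the last condition says `y j / j → 1 / ρ` as `j → ±∞`. -/
structure IsQuenchedUniform (P : Measure Ω) (ρ : ℝ) (y : Ω → ℤ → ℝ) : Prop where
  measurable : Measurable y
  strictMono : ∀ᵐ ω ∂P, StrictMono (y ω)
  origin : ∀ᵐ ω ∂P, y ω 0 = 0
  density : ∀ ε : ℝ, 0 < ε → ∃ K : ℝ, ∀ᵐ ω ∂P, ∀ j : ℤ, |y ω j - j / ρ| ≤ ε * |(j : ℝ)| + K

/-- `W` is a family of independent standard Brownian motions, independent of the initial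
configuration `y`. -/
structure IsDrivingNoise (P : Measure Ω) (y : Ω → ℤ → ℝ) (W : ℤ → ℝ≥0 → Ω → ℝ) : Prop where
  measurable : ∀ j s, Measurable (W j s)
  brownian : ∀ j, IsBrownianReal (W j) P
  indep : iIndepFun (fun (j : ℤ) (ω : Ω) (s : ℝ≥0) => W j s ω) P
  indep_initial : IndepFun y (fun (ω : Ω) (j : ℤ) (s : ℝ≥0) => W j s ω) P

/-- Brownian point particles on the line with hard-core repulsion (Harris' system of colliding
Brownian particles). `X j s ω` is the position of particle `j` at time `s`. The trajectories are
continuous, start from `y` and keep their order for all times. When two point particles meet they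
collide elastically, that is, the set of all trajectories is that of independent Brownian particles
and only the labels are exchanged: at every time the configuration, counted with multiplicity, is
that of the particles `y j + (σ / √2) W j`. The normalisation is such that the displacement of
a free particle in time `s` has density `exp (-z² / (σ² s)) / √(π σ² s)`, of variance
`σ² s / 2`. -/
structure IsSingleFile (P : Measure Ω) (σ : ℝ) (y : Ω → ℤ → ℝ) (X : ℤ → ℝ≥0 → Ω → ℝ) :
    Prop where
  measurable : ∀ j s, Measurable (X j s)
  start : ∀ᵐ ω ∂P, ∀ j, X j 0 ω = y ω j
  continuous : ∀ᵐ ω ∂P, ∀ j, Continuous fun s => X j s ω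
  ordered : ∀ᵐ ω ∂P, ∀ s, Monotone fun j => X j s ω
  collisions : ∃ W : ℤ → ℝ≥0 → Ω → ℝ, IsDrivingNoise P y W ∧
    ∀ᵐ ω ∂P, ∀ s, ∃ π : Equiv.Perm ℤ, ∀ j, X j s ω = y ω (π j) + σ / √2 * W (π j) s ω

/-- `⟨f⟩_evolution`: the average over the evolution, the initial configuration `y` being kept
fixed. -/
def evolutionAvg (P : Measure Ω) (y : Ω → ℤ → ℝ) (f : Ω → ℝ) : Ω → ℝ :=
  P[f | MeasurableSpace.comap y inferInstance]

/-- The quenched cumulant generating function `⟨ln ⟨exp (l x)⟩_evolution⟩_initial` of a random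
position `x`. -/
def quenchedCGF (P : Measure Ω) (y : Ω → ℤ → ℝ) (x : Ω → ℝ) (l : ℝ) : ℝ :=
  ∫ ω, Real.log (evolutionAvg P y (fun ω' => Real.exp (l * x ω')) ω) ∂P

/-- The probability that `x` lies in `A`, given the initial configuration `y`. -/
def quenchedProb (P : Measure Ω) (y : Ω → ℤ → ℝ) (x : Ω → ℝ) (A : Set ℝ) : Ω → ℝ :=
  evolutionAvg P y (fun ω => A.indicator (fun _ => (1 : ℝ)) (x ω))

/-- `φ` is the quenched large deviation function of the process `x` on the scale `√t` with speed
`√t`: `⟨ln P(x(t) / √t ∈ G)⟩_initial ≃ -√t inf_G φ` for every nonempty open set `G` (the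
probability, which depends on the initial configuration, is positive and its logarithm is
integrable). For continuous `φ` this is the full large deviation principle, as the infima over
`G` and over its closure agree. -/
def IsQuenchedLDF (P : Measure Ω) (y : Ω → ℤ → ℝ) (x : ℝ≥0 → Ω → ℝ) (φ : ℝ → ℝ) : Prop :=
  Continuous φ ∧ (∀ ξ, 0 ≤ φ ξ) ∧
  ∀ G : Set ℝ, IsOpen G → G.Nonempty →
    (∀ t : ℝ≥0, 0 < t →
      (∀ᵐ ω ∂P, 0 < quenchedProb P y (fun ω' => x t ω' / √(t : ℝ)) G ω) ∧
      Integrable (fun ω => Real.log (quenchedProb P y (fun ω' => x t ω' / √(t : ℝ)) G ω)) P) ∧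
    Tendsto
      (fun t : ℝ≥0 =>
        (∫ ω, Real.log (quenchedProb P y (fun ω' => x t ω' / √(t : ℝ)) G ω) ∂P) / √(t : ℝ))
      atTop (𝓝 (-sInf (φ '' G)))

end SingleFile

end

noncomputable section

namespace SingleFile

/-! ### The complementary error function -/

/-! Since collisions only exchange labels, the order-preserving system and the free particles occupy
the same points. Hence the tracer is to the left of `x` exactly when the particles with labels `k ≥
1` found to the left of `x` are at least as many as those with labels `k ≤ 0` found to the right of
it, that is, when the net flow of free particles through `x` is nonnegative (`tracer_le_iff`). The
delicate point is that no label leaks in from infinity. The discrepancy between the two systems is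
an integer (`IsSpread.exists_charge`), depends continuously on time and vanishes at time `0`
(`tsum_stepCharge_eq`); that the sums are locally finite uniformly in time rests on a maximal
inequality for Brownian paths (`ae_exists_abs_le_of_brownian`).

Given the initial configuration, the flow is a sum of independent Bernoulli variables with signs, so
its cumulant generating function is an explicit series. On the scale `√t` the series is a Riemann
sum and, for a flat profile, its limit is `ρ B ξ + ρ σ I(B)`
(`HasFlatProfile.tendsto_tsum_crossingCGF`). The product `q = erfc η erfc (-η)` comes from pairing
mirror-image crossings: if `p = erfc η / 2`, then `(1 + p (e^B - 1)) (1 + p (e^(-B) - 1)) = 1 + q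
sinh² (B / 2)`. Chernoff's bound and the tilting argument `tilting_lower_bound` then give both tails
of the tracer, with a rate `φ` that is the Legendre transform of this limit at flow zero. As `φ` is
even, continuous and strictly increasing on the positive half-line, the tails determine the
probabilities of open sets (`HasTailRates.logAsymp_open`) and, with exponential tightness, the
exponential integrals (`HasTailRates.logAsymp_integral`).

These limits hold for almost every initial configuration along each sequence of times. They are
averaged by dominated convergence; the dominating constants come from estimates that are uniform
over the configurations (`exists_uniform_tail_bound`, `exists_uniform_lower_bound`).

The analytic facts about `I` follow from a holomorphic extension to a strip (smoothness), from
strict convexity of the integrand (one `B` for each `ξ`), and from comparison of the integrand with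
the positive part of `B - η²` (growth `2/3 B^(3/2)`, hence the cubic law for `φ`).

For equally spaced particles, convergence of the generating functions on the real line does not by
itself give convergence of derivatives. Translation invariance of the lattice expresses the moment
generating function of the tracer through those of the flow, with an error factor near `1` on a
complex disc that does not shrink with time (`exists_complexCGF`). Cauchy's estimates then bound all
derivatives and `tendsto_jet` applies. -/

lemma integrable_exp_neg_sq : Integrable fun u : ℝ => Real.exp (-u ^ 2) := by
  simpa using integrable_exp_neg_mul_sq (b := 1) one_pos

lemma integral_Ioi_exp_neg_sq : ∫ u in Ioi (0 : ℝ), Real.exp (-u ^ 2) = √Real.pi / 2 := by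
  simpa using integral_gaussian_Ioi 1

lemma sqrt_pi_pos : 0 < √Real.pi := Real.sqrt_pos.mpr Real.pi_pos

lemma sqrt_pi_le_two : √Real.pi ≤ 2 := by
  rw [Real.sqrt_le_left (by norm_num)]
  linarith [Real.pi_le_four]

lemma erfc_eq_one_sub (x : ℝ) :
    erfc x = 1 - 2 / √Real.pi * ∫ u in (0 : ℝ)..x, Real.exp (-u ^ 2) := by
  have h := intervalIntegral.integral_Ioi_sub_Ioi' (μ := volume) (a := 0) (b := x)
    integrable_exp_neg_sq.integrableOn integrable_exp_neg_sq.integrableOn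
  rw [← h, integral_Ioi_exp_neg_sq, erfc]
  have := sqrt_pi_pos
  field_simp
  ring

lemma hasDerivAt_erfc (x : ℝ) :
    HasDerivAt erfc (-(2 / √Real.pi * Real.exp (-x ^ 2))) x := by
  have hc : Continuous fun u : ℝ => Real.exp (-u ^ 2) := by fun_prop
  have h := (intervalIntegral.integral_hasDerivAt_right (hc.intervalIntegrable 0 x)
    (hc.stronglyMeasurableAtFilter _ _) hc.continuousAt).const_mul (2 / √Real.pi)
  rw [show erfc = fun x => 1 - 2 / √Real.pi * ∫ u in (0 : ℝ)..x, Real.exp (-u ^ 2) from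
    funext erfc_eq_one_sub]
  simpa using h.const_sub 1

lemma continuous_erfc : Continuous erfc :=
  continuous_iff_continuousAt.mpr fun x => (hasDerivAt_erfc x).continuousAt

lemma strictAnti_erfc : StrictAnti erfc := by
  refine strictAnti_of_deriv_neg fun x => ?_
  rw [(hasDerivAt_erfc x).deriv]
  have := sqrt_pi_pos
  have := Real.exp_pos (-x ^ 2)
  rw [neg_lt_zero]
  positivity

lemma erfc_neg (x : ℝ) : erfc (-x) = 2 - erfc x := by
  have h : ∫ u in (0 : ℝ)..(-x), Real.exp (-u ^ 2) = -∫ u in (0 : ℝ)..x, Real.exp (-u ^ 2) := by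
    have := intervalIntegral.integral_comp_neg (a := 0) (b := x)
      (fun u : ℝ => Real.exp (-u ^ 2))
    simp only [neg_sq, neg_zero] at this
    rw [this, intervalIntegral.integral_symm]
  rw [erfc_eq_one_sub, erfc_eq_one_sub, h]
  ring

lemma erfc_zero : erfc 0 = 1 := by simp [erfc_eq_one_sub]

lemma erfc_pos (x : ℝ) : 0 < erfc x := by
  have h : 0 ≤ erfc (x + 1) := by
    have := sqrt_pi_pos
    exact mul_nonneg (by positivity) (integral_nonneg fun u => (Real.exp_pos _).le)
  exact h.trans_lt (strictAnti_erfc (by linarith))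

lemma erfc_lt_two (x : ℝ) : erfc x < 2 := by
  have := erfc_pos (-x)
  rw [erfc_neg] at this
  linarith

lemma erfc_le_exp_neg_sq {x : ℝ} (hx : 0 ≤ x) : erfc x ≤ Real.exp (-x ^ 2) := by
  have h1 : ∫ u in Ioi x, Real.exp (-u ^ 2) = ∫ u in Ioi (0 : ℝ), Real.exp (-(u + x) ^ 2) := by
    have := (measurePreserving_add_right volume x).setIntegral_preimage_emb
      (measurableEmbedding_addRight x) (fun u : ℝ => Real.exp (-u ^ 2)) (Ioi x)
    rw [← this]
    simp
  have h2 : ∫ u in Ioi (0 : ℝ), Real.exp (-(u + x) ^ 2) ≤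
      ∫ u in Ioi (0 : ℝ), Real.exp (-x ^ 2) * Real.exp (-u ^ 2) := by
    refine setIntegral_mono_on (integrable_exp_neg_sq.comp_add_right x).integrableOn
      (integrable_exp_neg_sq.const_mul _).integrableOn measurableSet_Ioi fun u hu => ?_
    rw [← Real.exp_add, Real.exp_le_exp]
    nlinarith [mul_nonneg hx (mem_Ioi.mp hu).le]
  rw [integral_const_mul, integral_Ioi_exp_neg_sq, ← h1] at h2
  have hp := sqrt_pi_pos
  calc erfc x ≤ 2 / √Real.pi * (Real.exp (-x ^ 2) * (√Real.pi / 2)) :=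
        mul_le_mul_of_nonneg_left h2 (by positivity)
    _ = Real.exp (-x ^ 2) := by field_simp

/-- Keep only the integral over `(x, x + 1]`; the prefactor `2 / √π` is at least `1`. The shift by
`1` is harmless, since only the leading term of the exponent matters for the growth of `I`. -/
lemma exp_neg_sq_le_erfc {x : ℝ} (hx : 0 ≤ x) : Real.exp (-(x + 1) ^ 2) ≤ erfc x := by
  have h1 : ∫ u in Ioc x (x + 1), Real.exp (-(x + 1) ^ 2) ≤ ∫ u in Ioi x, Real.exp (-u ^ 2) := by
    refine (setIntegral_mono_on (by simp) integrable_exp_neg_sq.integrableOn measurableSet_Ioc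
      fun u hu => ?_).trans (setIntegral_mono_set integrable_exp_neg_sq.integrableOn
        (ae_of_all _ fun u => (Real.exp_pos _).le) (ae_of_all _ Ioc_subset_Ioi_self))
    rw [Real.exp_le_exp]
    nlinarith [hu.1, hu.2]
  simp only [integral_const, measureReal_restrict_apply MeasurableSet.univ, univ_inter,
    Real.volume_real_Ioc, smul_eq_mul] at h1
  rw [show max (x + 1 - x) 0 = 1 by simp, one_mul] at h1
  have h2 : 1 ≤ 2 / √Real.pi := by
    rw [one_le_div sqrt_pi_pos]
    exact sqrt_pi_le_two
  exact h1.trans (le_mul_of_one_le_left (h1.trans' (Real.exp_pos _).le) h2)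

lemma erfc_le_mul_exp_neg_abs (x : ℝ) (hx : 0 ≤ x) : erfc x ≤ 3 * Real.exp (-x) := by
  refine (erfc_le_exp_neg_sq hx).trans ?_
  have h3 : Real.exp 1 ≤ 3 := (Real.exp_one_lt_d9.trans (by norm_num)).le
  calc Real.exp (-x ^ 2) ≤ Real.exp (1 + -x) := by
        rw [Real.exp_le_exp]
        nlinarith [sq_nonneg (x - 1 / 2)]
    _ = Real.exp 1 * Real.exp (-x) := Real.exp_add _ _
    _ ≤ _ := by gcongr

/-- The probability that a free particle crosses the rescaled distance `η`. -/
def tailProb (η : ℝ) : ℝ := erfc η / 2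

lemma tailProb_pos (η : ℝ) : 0 < tailProb η := half_pos (erfc_pos η)

lemma tailProb_lt_one (η : ℝ) : tailProb η < 1 := by
  have := erfc_lt_two η
  unfold tailProb
  linarith

lemma tailProb_neg (η : ℝ) : tailProb (-η) = 1 - tailProb η := by
  unfold tailProb
  rw [erfc_neg]
  ring

lemma tailProb_zero : tailProb 0 = 1 / 2 := by simp [tailProb, erfc_zero]

lemma continuous_tailProb : Continuous tailProb := continuous_erfc.div_const 2

lemma strictAnti_tailProb : StrictAnti tailProb := fun _ _ h =>
  div_lt_div_of_pos_right (strictAnti_erfc h) two_pos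

/-- The Gaussian tail is weakened to a simple exponential because this bound holds for negative `η`
too, and sums over particles become geometric. -/
lemma tailProb_le_exp (η : ℝ) : tailProb η ≤ 2 * Real.exp (-η) := by
  rcases le_total 0 η with h | h
  · have := erfc_le_mul_exp_neg_abs η h
    unfold tailProb
    linarith [Real.exp_pos (-η)]
  · have : 1 ≤ Real.exp (-η) := Real.one_le_exp (by linarith)
    linarith [tailProb_lt_one η]

lemma tailProb_le_half {η : ℝ} (h : 0 ≤ η) : tailProb η ≤ 1 / 2 := by
  rw [← tailProb_zero]
  exact strictAnti_tailProb.antitone h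

lemma integrableOn_tailProb (a : ℝ) : IntegrableOn tailProb (Ioi a) := by
  refine Integrable.mono' (g := fun η => 2 * Real.exp (-η))
    ((exp_neg_integrableOn_Ioi a one_pos).const_mul 2 |>.congr ?_)
    continuous_tailProb.aestronglyMeasurable (ae_of_all _ fun η => ?_)
  · exact ae_of_all _ fun x => by simp
  · rw [Real.norm_of_nonneg (tailProb_pos η).le]
    exact tailProb_le_exp η

lemma tendsto_erfc_atTop : Tendsto erfc atTop (𝓝 0) := by
  refine squeeze_zero' (Eventually.of_forall fun x => (erfc_pos x).le) ?_
    (g := fun x => 3 * Real.exp (-x)) ?_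
  · filter_upwards [eventually_ge_atTop 0] with x hx using erfc_le_mul_exp_neg_abs x hx
  · simpa using Real.tendsto_exp_neg_atTop_nhds_zero.const_mul 3

/-- The product `erfc η erfc (-η)`. -/
def erfcProd (η : ℝ) : ℝ := erfc η * erfc (-η)

lemma erfcProd_pos (η : ℝ) : 0 < erfcProd η := mul_pos (erfc_pos _) (erfc_pos _)

lemma erfcProd_eq (η : ℝ) : erfcProd η = 1 - (1 - erfc η) ^ 2 := by
  unfold erfcProd
  rw [erfc_neg]
  ring

lemma erfcProd_le_one (η : ℝ) : erfcProd η ≤ 1 := by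
  rw [erfcProd_eq]
  linarith [sq_nonneg (1 - erfc η)]

lemma erfcProd_le_two_mul (η : ℝ) : erfcProd η ≤ 2 * erfc η := by
  unfold erfcProd
  nlinarith [erfc_pos η, erfc_lt_two (-η)]

lemma erfc_le_erfcProd {η : ℝ} (h : 0 ≤ η) : erfc η ≤ erfcProd η := by
  have : erfc η ≤ 1 := erfc_zero ▸ strictAnti_erfc.antitone h
  unfold erfcProd
  rw [erfc_neg]
  nlinarith [erfc_pos η]

lemma continuous_erfcProd : Continuous erfcProd :=
  continuous_erfc.mul (continuous_erfc.comp continuous_neg)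

lemma integrableOn_erfcProd : IntegrableOn erfcProd (Ioi 0) := by
  refine Integrable.mono' ((integrableOn_tailProb 0).const_mul 4)
    continuous_erfcProd.aestronglyMeasurable (ae_of_all _ fun η => ?_)
  rw [Real.norm_of_nonneg (erfcProd_pos η).le]
  have := erfcProd_le_two_mul η
  unfold tailProb
  linarith

/-- `∫₀^∞ erfc η erfc (-η) dη = √(2 / π)`. -/
lemma integral_erfcProd : ∫ η in Ioi (0 : ℝ), erfcProd η = 2 / √(2 * Real.pi) := by
  have hp := sqrt_pi_pos
  -- `H` is an antiderivative obtained by parts. With `erf = 1 - erfc` and `q = 1 - erf²`, the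
  -- boundary term is `η q`, and the remaining `-η q'` is a multiple of `η e^(-η²) erf η`, which a
  -- second integration by parts reduces to `e^(-2 η²)`. Only the last term survives at infinity.
  set H : ℝ → ℝ := fun η => η * erfcProd η - 2 / √Real.pi * Real.exp (-η ^ 2) * (1 - erfc η)
    + 4 / Real.pi * ∫ u in (0 : ℝ)..η, Real.exp (-2 * u ^ 2) with hH
  have hpi : √Real.pi * √Real.pi = Real.pi := Real.mul_self_sqrt Real.pi_pos.le
  have hc : Continuous fun u : ℝ => Real.exp (-2 * u ^ 2) := by fun_prop
  have hderiv : ∀ η, HasDerivAt H (erfcProd η) η := by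
    intro η
    have h1 := (hasDerivAt_id η).mul (((hasDerivAt_erfc η).const_sub 1).pow 2 |>.const_sub 1)
    have he : HasDerivAt (fun η : ℝ => Real.exp (-η ^ 2)) (Real.exp (-η ^ 2) * (-(2 * η))) η := by
      simpa using ((hasDerivAt_pow 2 η).neg).exp
    have h2 := (he.const_mul (2 / √Real.pi)).mul ((hasDerivAt_erfc η).const_sub 1)
    have h3 := (intervalIntegral.integral_hasDerivAt_right (hc.intervalIntegrable 0 η)
      (hc.stronglyMeasurableAtFilter _ _) hc.continuousAt).const_mul (4 / Real.pi)
    have h4 := (h1.sub h2).add h3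
    refine (h4.congr_of_eventuallyEq ?_).congr_deriv ?_
    · refine Eventually.of_forall fun x => ?_
      simp [hH, erfcProd_eq]
    · rw [erfcProd_eq, show Real.exp (-2 * η ^ 2) = Real.exp (-η ^ 2) * Real.exp (-η ^ 2) by
        rw [← Real.exp_add]; congr 1; ring, ← hpi]
      simp
      field_simp
      ring
  have hlim : Tendsto H atTop (𝓝 (0 - 2 / √Real.pi * 0 * (1 - 0) +
      4 / Real.pi * (√(Real.pi / 2) / 2))) := by
    refine (Tendsto.sub ?_ ((tendsto_const_nhds.mul ?_).mul
      (tendsto_const_nhds.sub tendsto_erfc_atTop))).add (tendsto_const_nhds.mul ?_)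
    · refine squeeze_zero' (g := fun η => 6 * (η ^ 1 * Real.exp (-η))) ?_ ?_ ?_
      · filter_upwards [eventually_ge_atTop 0] with x hx using mul_nonneg hx (erfcProd_pos x).le
      · filter_upwards [eventually_ge_atTop 0] with x hx
        have := mul_le_mul_of_nonneg_left
          ((erfcProd_le_two_mul x).trans (by linarith [erfc_le_mul_exp_neg_abs x hx] :
            2 * erfc x ≤ 6 * Real.exp (-x))) hx
        linarith
      · simpa using (Real.tendsto_pow_mul_exp_neg_atTop_nhds_zero 1).const_mul 6
    · refine squeeze_zero' (g := fun η => 1 * Real.exp (-η)) ?_ ?_ ?_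
      · exact Eventually.of_forall fun x => (Real.exp_pos _).le
      · filter_upwards [eventually_ge_atTop 1] with x hx
        rw [one_mul, Real.exp_le_exp]
        nlinarith
      · simpa using Real.tendsto_exp_neg_atTop_nhds_zero
    · rw [← integral_gaussian_Ioi 2]
      exact intervalIntegral_tendsto_integral_Ioi 0
        (integrable_exp_neg_mul_sq two_pos).integrableOn tendsto_id
  rw [integral_Ioi_of_hasDerivAt_of_tendsto' (fun x _ => hderiv x) integrableOn_erfcProd hlim]
  have h0 : H 0 = 0 := by simp [hH, erfc_zero]
  rw [h0, Real.sqrt_div Real.pi_pos.le, Real.sqrt_mul two_pos.le]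
  have h2 : √(2 : ℝ) * √2 = 2 := Real.mul_self_sqrt two_pos.le
  have h2' : 0 < √(2 : ℝ) := by positivity
  rw [show (4 : ℝ) / Real.pi = 4 / (√Real.pi * √Real.pi) by rw [hpi]]
  field_simp
  linarith [h2]

/-! ### The integral `I(B) = ∫₀^∞ ln [1 + sinh² (B / 2) erfc η erfc (-η)] dη` -/

lemma logIntegrand_eq (B η : ℝ) :
    logIntegrand B η = Real.log (1 + Real.sinh (B / 2) ^ 2 * erfcProd η) := rfl

lemma sinh_half_sq (B : ℝ) : Real.sinh (B / 2) ^ 2 = (Real.cosh B - 1) / 2 := by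
  have h := Real.cosh_two_mul (B / 2)
  have h2 := Real.cosh_sq (B / 2)
  rw [mul_div_cancel₀ _ (two_ne_zero' ℝ)] at h
  linarith

/-- The strip of the complex plane on which the integrand has a holomorphic extension. -/
def analyticityStrip : Set ℂ := {z | |z.im| < Real.pi / 2}

lemma isOpen_analyticityStrip : IsOpen analyticityStrip :=
  isOpen_lt (continuous_abs.comp Complex.continuous_im) continuous_const

lemma convex_analyticityStrip : Convex ℝ analyticityStrip := by
  have : analyticityStrip = Complex.imLm ⁻¹' Ioo (-(Real.pi / 2)) (Real.pi / 2) := by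
    ext z
    simp [analyticityStrip, abs_lt]
  rw [this]
  exact (convex_Ioo _ _).linear_preimage _

lemma ofReal_mem_analyticityStrip (x : ℝ) : (x : ℂ) ∈ analyticityStrip := by
  simp [analyticityStrip, Real.pi_pos]

/-- The argument of the logarithm, extended to complex `B`. -/
def complexArg (z : ℂ) (η : ℝ) : ℂ := 1 + (erfcProd η / 2 : ℝ) * (Complex.cosh z - 1)

lemma re_cosh (z : ℂ) : (Complex.cosh z).re = Real.cosh z.re * Real.cos z.im := by
  conv_lhs => rw [← Complex.re_add_im z, Complex.cosh_add, Complex.cosh_mul_I, Complex.sinh_mul_I,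
    ← Complex.ofReal_cosh, ← Complex.ofReal_sinh, ← Complex.ofReal_cos, ← Complex.ofReal_sin]
  simp [-Complex.ofReal_cos]

/-- In the strip `cosh` has nonnegative real part, and `q ≤ 1`. This keeps the argument away from
the cut of the logarithm, uniformly in `η`. -/
lemma half_le_re_complexArg {z : ℂ} (hz : z ∈ analyticityStrip) (η : ℝ) :
    1 / 2 ≤ (complexArg z η).re := by
  have h1 : 0 ≤ (Complex.cosh z).re := by
    rw [re_cosh]
    exact mul_nonneg (Real.cosh_pos _).le (Real.cos_nonneg_of_mem_Icc (abs_le.mp (le_of_lt hz)))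
  have h2 : (complexArg z η).re = 1 + erfcProd η / 2 * ((Complex.cosh z).re - 1) := by
    simp only [complexArg, Complex.add_re, Complex.one_re, Complex.re_ofReal_mul, Complex.sub_re]
  rw [h2]
  nlinarith [erfcProd_pos η, erfcProd_le_one η]

lemma complexArg_ofReal (B η : ℝ) :
    complexArg B η = ((1 + Real.sinh (B / 2) ^ 2 * erfcProd η : ℝ) : ℂ) := by
  rw [complexArg, sinh_half_sq]
  push_cast
  ring

/-- The logarithmic derivative of `complexArg` in its first argument. -/
def complexSlope (z : ℂ) (η : ℝ) : ℂ :=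
  (erfcProd η / 2 : ℝ) * Complex.sinh z / complexArg z η

lemma hasDerivAt_log_complexArg {z : ℂ} (hz : z ∈ analyticityStrip) (η : ℝ) :
    HasDerivAt (fun z => Complex.log (complexArg z η)) (complexSlope z η) z := by
  have h := (((Complex.hasDerivAt_cosh z).sub_const 1).const_mul
    ((erfcProd η / 2 : ℝ) : ℂ)).const_add 1
  exact h.clog (Or.inl (by linarith [half_le_re_complexArg hz η] : 0 < (complexArg z η).re))

lemma norm_sinh_le (z : ℂ) : ‖Complex.sinh z‖ ≤ Real.exp ‖z‖ := by
  have h1 : ‖Complex.exp z‖ ≤ Real.exp ‖z‖ := Complex.norm_exp_le_exp_norm z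
  have h2 : ‖Complex.exp (-z)‖ ≤ Real.exp ‖z‖ := by
    simpa using Complex.norm_exp_le_exp_norm (-z)
  have h3 := norm_sub_le (Complex.exp z) (Complex.exp (-z))
  rw [Complex.sinh, norm_div, Complex.norm_ofNat]
  linarith

lemma norm_complexSlope_le {z : ℂ} (hz : z ∈ analyticityStrip) (η : ℝ) :
    ‖complexSlope z η‖ ≤ erfcProd η * Real.exp ‖z‖ := by
  have h1 : 1 / 2 ≤ ‖complexArg z η‖ :=
    (half_le_re_complexArg hz η).trans (Complex.re_le_norm _)
  have h2 := erfcProd_pos η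
  rw [complexSlope, norm_div, norm_mul, Complex.norm_real, Real.norm_of_nonneg (by positivity),
    div_le_iff₀ (by linarith)]
  have h3 := norm_sinh_le z
  have h4 : erfcProd η / 2 * ‖Complex.sinh z‖ ≤ erfcProd η / 2 * Real.exp ‖z‖ := by gcongr
  have h5 : erfcProd η * Real.exp ‖z‖ * (1 / 2) ≤ erfcProd η * Real.exp ‖z‖ * ‖complexArg z η‖ := by
    gcongr
  linarith

lemma continuous_complexArg (z : ℂ) : Continuous (complexArg z) := by
  unfold complexArg
  have := continuous_erfcProd
  fun_prop

lemma continuous_log_complexArg {z : ℂ} (hz : z ∈ analyticityStrip) :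
    Continuous fun η => Complex.log (complexArg z η) :=
  (continuous_complexArg z).clog fun η =>
    Or.inl (by linarith [half_le_re_complexArg hz η] : 0 < (complexArg z η).re)

lemma continuous_complexSlope {z : ℂ} (hz : z ∈ analyticityStrip) :
    Continuous (complexSlope z) := by
  unfold complexSlope
  have := continuous_erfcProd
  have := continuous_complexArg z
  refine Continuous.div (by fun_prop) (by fun_prop) fun η h => ?_
  have := half_le_re_complexArg hz η
  rw [h] at this
  norm_num at this

/-- The logarithm vanishes at `z = 0`, so the mean value inequality on the segment from `0` to `z`
turns the bound on the slope into a multiple of `q`, which is integrable. -/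
lemma norm_log_complexArg_le {z : ℂ} (hz : z ∈ analyticityStrip) (η : ℝ) :
    ‖Complex.log (complexArg z η)‖ ≤ erfcProd η * Real.exp ‖z‖ * ‖z‖ := by
  have h0 : (0 : ℂ) ∈ analyticityStrip := by simpa using ofReal_mem_analyticityStrip 0
  have hsub : segment ℝ (0 : ℂ) z ⊆ analyticityStrip := convex_analyticityStrip.segment_subset h0 hz
  have h := Convex.norm_image_sub_le_of_norm_hasDerivWithin_le
    (f := fun z => Complex.log (complexArg z η)) (f' := fun z => complexSlope z η)
    (s := segment ℝ (0 : ℂ) z) (C := erfcProd η * Real.exp ‖z‖)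
    (fun w hw => (hasDerivAt_log_complexArg (hsub hw) η).hasDerivWithinAt) (fun w hw => ?_)
    (convex_segment _ _) (left_mem_segment _ _ _) (right_mem_segment _ _ _)
  · simpa [complexArg] using h
  · refine (norm_complexSlope_le (hsub hw) η).trans ?_
    have hw' : ‖w‖ ≤ ‖z‖ := by
      obtain ⟨a, b, ha, hb, hab, rfl⟩ := hw
      rw [smul_zero, zero_add, norm_smul, Real.norm_of_nonneg hb]
      exact mul_le_of_le_one_left (norm_nonneg z) (by linarith)
    have := erfcProd_pos η
    gcongr

lemma integrableOn_log_complexArg {z : ℂ} (hz : z ∈ analyticityStrip) :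
    IntegrableOn (fun η => Complex.log (complexArg z η)) (Ioi 0) := by
  refine Integrable.mono' (integrableOn_erfcProd.mul_const (Real.exp ‖z‖ * ‖z‖))
    (continuous_log_complexArg hz).aestronglyMeasurable (ae_of_all _ fun η => ?_)
  rw [← mul_assoc]
  exact norm_log_complexArg_le hz η

/-- The holomorphic extension of `logIntegral`. -/
def complexLogIntegral (z : ℂ) : ℂ := ∫ η in Ioi (0 : ℝ), Complex.log (complexArg z η)

lemma hasDerivAt_complexLogIntegral {z : ℂ} (hz : z ∈ analyticityStrip) :
    IntegrableOn (complexSlope z) (Ioi 0) ∧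
      HasDerivAt complexLogIntegral (∫ η in Ioi (0 : ℝ), complexSlope z η) z := by
  refine hasDerivAt_integral_of_dominated_loc_of_deriv_le (μ := volume.restrict (Ioi (0 : ℝ)))
    (F := fun z η => Complex.log (complexArg z η)) (F' := complexSlope)
    (s := analyticityStrip ∩ Metric.ball z 1)
    (bound := fun η => erfcProd η * Real.exp (‖z‖ + 1))
    (inter_mem (isOpen_analyticityStrip.mem_nhds hz) (Metric.ball_mem_nhds z one_pos))
    ?_ (integrableOn_log_complexArg hz) (continuous_complexSlope hz).aestronglyMeasurable
    (ae_of_all _ fun η w hw => ?_) (integrableOn_erfcProd.mul_const _)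
    (ae_of_all _ fun η w hw => hasDerivAt_log_complexArg hw.1 η)
  · filter_upwards [isOpen_analyticityStrip.mem_nhds hz] with w hw
    exact (continuous_log_complexArg hw).aestronglyMeasurable
  · refine (norm_complexSlope_le hw.1 η).trans ?_
    have h1 : ‖w‖ ≤ ‖z‖ + 1 := by
      have := norm_le_norm_add_norm_sub z w
      have h2 := hw.2
      rw [Metric.mem_ball, dist_eq_norm] at h2
      rw [norm_sub_rev] at this
      linarith
    have := erfcProd_pos η
    gcongr

lemma logIntegrand_eq_re (B η : ℝ) :
    logIntegrand B η = (Complex.log (complexArg B η)).re := by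
  have : (0 : ℝ) ≤ 1 + Real.sinh (B / 2) ^ 2 * erfcProd η := by
    have := erfcProd_pos η
    positivity
  rw [complexArg_ofReal, ← Complex.ofReal_log this, Complex.ofReal_re, logIntegrand_eq]

lemma integrableOn_logIntegrand (B : ℝ) : IntegrableOn (logIntegrand B) (Ioi 0) := by
  rw [show logIntegrand B = fun η => (Complex.log (complexArg B η)).re from
    funext (logIntegrand_eq_re B)]
  exact (integrableOn_log_complexArg (ofReal_mem_analyticityStrip B)).re

lemma logIntegral_eq_re (B : ℝ) : logIntegral B = (complexLogIntegral B).re := by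
  rw [logIntegral, complexLogIntegral, ← RCLike.re_eq_complex_re,
    ← integral_re (integrableOn_log_complexArg (ofReal_mem_analyticityStrip B))]
  exact integral_congr_ae (ae_of_all _ fun η => logIntegrand_eq_re B η)

lemma analyticAt_complexLogIntegral {z : ℂ} (hz : z ∈ analyticityStrip) :
    AnalyticAt ℂ complexLogIntegral z :=
  DifferentiableOn.analyticAt
    (fun _ hw => (hasDerivAt_complexLogIntegral hw).2.differentiableAt.differentiableWithinAt)
    (isOpen_analyticityStrip.mem_nhds hz)

lemma analyticAt_logIntegral (B : ℝ) : AnalyticAt ℝ logIntegral B := by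
  rw [show logIntegral = fun B : ℝ => (complexLogIntegral B).re from funext logIntegral_eq_re]
  exact (analyticAt_complexLogIntegral (ofReal_mem_analyticityStrip B)).re_ofReal

lemma contDiff_logIntegral {n : WithTop ℕ∞} : ContDiff ℝ n logIntegral :=
  contDiff_iff_contDiffAt.mpr fun B => (analyticAt_logIntegral B).contDiffAt

/-- The derivative of `logIntegrand` in its first argument. -/
def slope (B η : ℝ) : ℝ :=
  erfcProd η / 2 * Real.sinh B / (1 + erfcProd η / 2 * (Real.cosh B - 1))

lemma complexSlope_ofReal (B η : ℝ) : complexSlope B η = (slope B η : ℂ) := by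
  simp [complexSlope, slope, complexArg]

lemma integrableOn_slope (B : ℝ) : IntegrableOn (slope B) (Ioi 0) := by
  have h := (hasDerivAt_complexLogIntegral (ofReal_mem_analyticityStrip B)).1.re
  simpa [complexSlope_ofReal, IntegrableOn] using h

lemma hasDerivAt_logIntegral (B : ℝ) :
    HasDerivAt logIntegral (∫ η in Ioi (0 : ℝ), slope B η) B := by
  have h := (hasDerivAt_complexLogIntegral (ofReal_mem_analyticityStrip B)).2.real_of_complex
  rw [show logIntegral = fun B : ℝ => (complexLogIntegral B).re from funext logIntegral_eq_re]
  have h2 : (∫ η in Ioi (0 : ℝ), complexSlope B η).re = ∫ η in Ioi (0 : ℝ), slope B η := by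
    simp_rw [complexSlope_ofReal]
    rw [integral_complex_ofReal, Complex.ofReal_re]
  rwa [h2] at h

lemma differentiable_logIntegral : Differentiable ℝ logIntegral := fun B =>
  (hasDerivAt_logIntegral B).differentiableAt

/-- After clearing denominators the difference is a positive multiple of `(1 - q/2) (sinh B₂ - sinh
B₁) + (q/2) sinh (B₂ - B₁)`. Thus the integrand is strictly convex in `B` for each `η`. -/
lemma slope_strictMono (η : ℝ) : StrictMono fun B => slope B η := by
  intro B₁ B₂ h
  have hq := erfcProd_pos η
  have hq1 := erfcProd_le_one η
  have hd : ∀ B, 0 < 1 + erfcProd η / 2 * (Real.cosh B - 1) := fun B => by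
    have := Real.one_le_cosh B
    nlinarith
  simp only [slope]
  rw [div_lt_div_iff₀ (hd _) (hd _)]
  have h1 : Real.sinh B₁ < Real.sinh B₂ := Real.sinh_lt_sinh.mpr h
  have h2 : 0 < Real.sinh (B₂ - B₁) := Real.sinh_pos_iff.mpr (by linarith)
  rw [Real.sinh_sub] at h2
  have h3 : 0 < (1 - erfcProd η / 2) * (Real.sinh B₂ - Real.sinh B₁) +
      erfcProd η / 2 * (Real.sinh B₂ * Real.cosh B₁ - Real.cosh B₂ * Real.sinh B₁) :=
    add_pos (mul_pos (by linarith) (by linarith)) (by positivity)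
  have h4 := mul_pos (half_pos hq) h3
  linarith

lemma strictMono_deriv_logIntegral : StrictMono (deriv logIntegral) := by
  intro B₁ B₂ h
  rw [(hasDerivAt_logIntegral _).deriv, (hasDerivAt_logIntegral _).deriv, ← sub_pos,
    ← integral_sub (integrableOn_slope _) (integrableOn_slope _)]
  have hpos : ∀ η, 0 < slope B₂ η - slope B₁ η := fun η =>
    sub_pos.mpr (slope_strictMono η h)
  rw [integral_pos_iff_support_of_nonneg (fun η => (hpos η).le)
    ((integrableOn_slope _).sub (integrableOn_slope _))]
  have : Function.support (fun η => slope B₂ η - slope B₁ η) = univ :=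
    eq_univ_of_forall fun η => (hpos η).ne'
  rw [this]
  simp

lemma logIntegral_neg (B : ℝ) : logIntegral (-B) = logIntegral B := by
  simp [logIntegral, logIntegrand, neg_div, Real.sinh_neg]

lemma logIntegral_zero : logIntegral 0 = 0 := by simp [logIntegral, logIntegrand]

lemma deriv_logIntegral_neg (B : ℝ) : deriv logIntegral (-B) = -deriv logIntegral B := by
  have h := deriv_comp_neg logIntegral B
  rw [show (fun x => logIntegral (-x)) = logIntegral from funext logIntegral_neg] at h
  rw [h, neg_neg]

lemma convexOn_logIntegral : ConvexOn ℝ univ logIntegral :=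
  strictMono_deriv_logIntegral.monotone.convexOn_univ_of_deriv differentiable_logIntegral

/-- A convex differentiable function lies above its tangents. -/
lemma logIntegral_tangent_le (B C : ℝ) :
    logIntegral C + deriv logIntegral C * (B - C) ≤ logIntegral B := by
  have hd := fun x => differentiable_logIntegral x
  rcases lt_trichotomy B C with h | h | h
  · have := convexOn_logIntegral.slope_le_deriv (mem_univ B) (mem_univ C) h (hd C)
    rw [slope_def_field, div_le_iff₀ (by linarith)] at this
    linarith
  · simp [h]
  · have := convexOn_logIntegral.deriv_le_slope (mem_univ C) (mem_univ B) h (hd C)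
    rw [slope_def_field, le_div_iff₀ (by linarith)] at this
    linarith

lemma limitCGF_eq (ρ σ l : ℝ) : limitCGF ρ σ l = σ * ρ * logIntegral (l / ρ) := by
  rw [limitCGF, logIntegral]
  simp only [logIntegrand]
  rw [show l / ρ / 2 = l / (2 * ρ) by rw [div_div, mul_comm]]

/-! ### Cumulants -/

/-- If the order `m` of the zero were less than `n`, then `f x = x ^ m g x` with `g 0 ≠ 0`, whereas
the bound forces `g = O(x ^ (n - m))` and so `g 0 = 0`. This lets Taylor coefficients be read off an
approximation without differentiating under the integral. -/
lemma iteratedDeriv_eq_zero_of_isBigO {f : ℝ → ℝ} (hf : AnalyticAt ℝ f 0) {n : ℕ}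
    (hO : f =O[𝓝 0] fun x => x ^ n) {k : ℕ} (hk : k < n) : iteratedDeriv k f 0 = 0 := by
  suffices h : (n : ℕ∞) ≤ analyticOrderAt f 0 from
    (natCast_le_analyticOrderAt_iff_iteratedDeriv_eq_zero hf).mp h k hk
  by_contra! h
  obtain ⟨m, hm⟩ := ENat.ne_top_iff_exists.mp h.ne_top
  rw [← hm, Nat.cast_lt] at h
  obtain ⟨g, hg, hg0, hfg⟩ := hf.analyticOrderAt_eq_natCast.mp hm.symm
  have hgO : g =O[𝓝[≠] 0] fun x => x ^ (n - m) := by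
    obtain ⟨C, hC⟩ := hO.bound
    refine Asymptotics.IsBigO.of_bound C ?_
    filter_upwards [nhdsWithin_le_nhds hC, nhdsWithin_le_nhds hfg, self_mem_nhdsWithin]
      with x hx hfx hx0
    have hx0' : 0 < ‖x‖ ^ m := pow_pos (norm_pos_iff.mpr hx0) m
    rw [hfx, sub_zero, norm_smul, norm_pow, norm_pow] at hx
    rw [norm_pow]
    refine le_of_mul_le_mul_left ?_ hx0'
    calc ‖x‖ ^ m * ‖g x‖ ≤ C * ‖x‖ ^ n := hx
      _ = ‖x‖ ^ m * (C * ‖x‖ ^ (n - m)) := by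
        rw [mul_left_comm, ← pow_add, Nat.add_sub_cancel' h.le]
  have h0 : Tendsto g (𝓝[≠] 0) (𝓝 0) := by
    refine hgO.trans_tendsto ?_
    have hc : Tendsto (fun x : ℝ => x ^ (n - m)) (𝓝 0) (𝓝 (0 ^ (n - m))) :=
      (continuous_pow (n - m)).tendsto 0
    rw [zero_pow (by omega)] at hc
    exact hc.mono_left nhdsWithin_le_nhds
  exact hg0 (tendsto_nhds_unique (hg.continuousAt.tendsto.mono_left nhdsWithin_le_nhds) h0)

lemma abs_log_one_add_sub_le {x : ℝ} (h0 : 0 ≤ x) (h1 : x ≤ 1 / 2) :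
    |Real.log (1 + x) - (x - x ^ 2 / 2 + x ^ 3 / 3)| ≤ 2 * x ^ 4 := by
  have h := Real.abs_log_sub_add_sum_range_le (x := -x)
    (by rw [abs_neg, abs_of_nonneg h0]; linarith) 3
  rw [abs_neg, abs_of_nonneg h0, le_div_iff₀ (by linarith)] at h
  simp only [Finset.sum_range_succ, Finset.sum_range_zero, sub_neg_eq_add] at h
  norm_num at h
  have h2 : |Real.log (1 + x) - (x - x ^ 2 / 2 + x ^ 3 / 3)| =
      |-x + x ^ 2 / 2 + (-x) ^ 3 / 3 + Real.log (1 + x)| := by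
    congr 1
    ring
  rw [h2]
  nlinarith [abs_nonneg (-x + x ^ 2 / 2 + (-x) ^ 3 / 3 + Real.log (1 + x))]

lemma integrableOn_erfcProd_pow {n : ℕ} (hn : n ≠ 0) :
    IntegrableOn (fun η => erfcProd η ^ n) (Ioi 0) := by
  refine Integrable.mono' integrableOn_erfcProd (continuous_erfcProd.pow n).aestronglyMeasurable
    (ae_of_all _ fun η => ?_)
  rw [Real.norm_of_nonneg (pow_nonneg (erfcProd_pos η).le n)]
  exact pow_le_of_le_one (erfcProd_pos η).le (erfcProd_le_one η) hn

/-- `∫₀^∞ (erfc η erfc (-η))ⁿ dη`. -/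
def erfcMoment (n : ℕ) : ℝ := ∫ η in Ioi (0 : ℝ), erfcProd η ^ n

/-- The combination of hyperbolic cosines that agrees with `logIntegral` up to order eight. -/
def coshApprox (B : ℝ) : ℝ :=
  (-erfcMoment 1 / 2 - 3 * erfcMoment 2 / 16 - 10 * erfcMoment 3 / 96) +
  (erfcMoment 1 / 2 + erfcMoment 2 / 4 + 5 * erfcMoment 3 / 32) * Real.cosh (1 * B) +
  (-erfcMoment 2 / 16 - erfcMoment 3 / 16) * Real.cosh (2 * B) +
  erfcMoment 3 / 96 * Real.cosh (3 * B)

/-- The integrand is the expansion of `ln (1 + w q)` to third order, where `w = sinh² (B / 2) =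
(cosh B - 1) / 2`. Powers of `w` are combinations of `cosh (j B)`, whose derivatives at `0` are
powers of `j`. The neglected `w ^ 4` is of order `B ^ 8`, so the sixth cumulant is still exact. -/
lemma coshApprox_eq (B : ℝ) : coshApprox B =
    ∫ η in Ioi (0 : ℝ), (Real.sinh (B / 2) ^ 2 * erfcProd η ^ 1 -
      Real.sinh (B / 2) ^ 4 / 2 * erfcProd η ^ 2 + Real.sinh (B / 2) ^ 6 / 3 * erfcProd η ^ 3) := by
  have i1 := (integrableOn_erfcProd_pow one_ne_zero).const_mul (Real.sinh (B / 2) ^ 2)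
  have i2 := (integrableOn_erfcProd_pow two_ne_zero).const_mul (Real.sinh (B / 2) ^ 4 / 2)
  have i3 := (integrableOn_erfcProd_pow three_ne_zero).const_mul (Real.sinh (B / 2) ^ 6 / 3)
  rw [integral_add (i1.sub' i2) i3, integral_sub i1 i2, integral_const_mul, integral_const_mul,
    integral_const_mul]
  change _ = _ * erfcMoment 1 - _ * erfcMoment 2 + _ * erfcMoment 3
  rw [show Real.sinh (B / 2) ^ 4 = (Real.sinh (B / 2) ^ 2) ^ 2 by ring,
    show Real.sinh (B / 2) ^ 6 = (Real.sinh (B / 2) ^ 2) ^ 3 by ring, sinh_half_sq]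
  rw [coshApprox, one_mul, Real.cosh_two_mul, Real.cosh_three_mul, Real.sinh_sq]
  ring

lemma logIntegral_sub_coshApprox_isBigO :
    (fun B => logIntegral B - coshApprox B) =O[𝓝 0] fun B => B ^ 8 := by
  have hs : (fun B : ℝ => Real.sinh (B / 2)) =O[𝓝 0] fun B => B := by
    have hd : HasDerivAt (fun B : ℝ => Real.sinh (B / 2)) (Real.cosh (0 / 2) * (1 / 2)) 0 :=
      ((hasDerivAt_id (0 : ℝ)).div_const 2).sinh
    simpa using hd.isBigO_sub
  refine Asymptotics.IsBigO.trans ?_ (hs.pow 8)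
  refine Asymptotics.IsBigO.of_bound (2 * erfcMoment 1) ?_
  have hsmall : ∀ᶠ B : ℝ in 𝓝 0, Real.sinh (B / 2) ^ 2 < 1 / 2 := by
    have hc : Continuous fun B : ℝ => Real.sinh (B / 2) ^ 2 :=
      (Real.continuous_sinh.comp (continuous_id.div_const 2)).pow 2
    exact hc.continuousAt.eventually_lt continuousAt_const (by simp)
  filter_upwards [hsmall] with B hB
  have i1 := (integrableOn_erfcProd_pow one_ne_zero).const_mul (Real.sinh (B / 2) ^ 2)
  have i2 := (integrableOn_erfcProd_pow two_ne_zero).const_mul (Real.sinh (B / 2) ^ 4 / 2)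
  have i3 := (integrableOn_erfcProd_pow three_ne_zero).const_mul (Real.sinh (B / 2) ^ 6 / 3)
  have i4 : Integrable (fun η => Real.sinh (B / 2) ^ 2 * erfcProd η ^ 1 -
      Real.sinh (B / 2) ^ 4 / 2 * erfcProd η ^ 2 + Real.sinh (B / 2) ^ 6 / 3 * erfcProd η ^ 3)
      (volume.restrict (Ioi 0)) := (i1.sub i2).add i3
  rw [coshApprox_eq, logIntegral, ← integral_sub (integrableOn_logIntegrand B) i4]
  have hbound := norm_integral_le_of_norm_le
    (f := fun η => logIntegrand B η - (Real.sinh (B / 2) ^ 2 * erfcProd η ^ 1 -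
      Real.sinh (B / 2) ^ 4 / 2 * erfcProd η ^ 2 + Real.sinh (B / 2) ^ 6 / 3 * erfcProd η ^ 3))
    ((integrableOn_erfcProd_pow one_ne_zero).const_mul (2 * Real.sinh (B / 2) ^ 8))
    (ae_of_all _ fun η => ?_)
  · refine hbound.trans (le_of_eq ?_)
    rw [integral_const_mul, norm_pow, Real.norm_eq_abs, Even.pow_abs (by decide)]
    change _ * erfcMoment 1 = _
    ring
  · have hq := erfcProd_pos η
    have hq1 := erfcProd_le_one η
    have hw : 0 ≤ Real.sinh (B / 2) ^ 2 := sq_nonneg _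
    have h := abs_log_one_add_sub_le (x := Real.sinh (B / 2) ^ 2 * erfcProd η) (by positivity)
      ((mul_le_of_le_one_right hw hq1).trans hB.le)
    rw [logIntegrand_eq, Real.norm_eq_abs]
    refine le_trans (le_of_eq ?_) (h.trans ?_)
    · congr 1
      ring
    · have h4 : erfcProd η ^ 4 ≤ erfcProd η ^ 1 := pow_le_pow_of_le_one hq.le hq1 (by norm_num)
      calc 2 * (Real.sinh (B / 2) ^ 2 * erfcProd η) ^ 4
          = 2 * Real.sinh (B / 2) ^ 8 * erfcProd η ^ 4 := by ring
        _ ≤ 2 * Real.sinh (B / 2) ^ 8 * erfcProd η ^ 1 :=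
          mul_le_mul_of_nonneg_left h4 (by positivity)

lemma analyticAt_coshApprox (x : ℝ) : AnalyticAt ℝ coshApprox x := by
  have h : ∀ c : ℝ, AnalyticAt ℝ (fun B => Real.cosh (c * B)) x := fun c =>
    (Real.analyticAt_cosh).fun_comp (analyticAt_const.mul analyticAt_id)
  unfold coshApprox
  exact ((analyticAt_const.add (analyticAt_const.mul (h 1))).add
    (analyticAt_const.mul (h 2))).add (analyticAt_const.mul (h 3))

lemma iteratedDeriv_even_cosh_mul_zero (c : ℝ) (n : ℕ) :
    iteratedDeriv (2 * n) (fun B => Real.cosh (c * B)) 0 = c ^ (2 * n) := by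
  rw [iteratedDeriv_comp_const_mul Real.contDiff_cosh, Real.iteratedDeriv_even_cosh]
  simp

lemma iteratedDeriv_coshApprox {n : ℕ} (hn : n ≠ 0) : iteratedDeriv (2 * n) coshApprox 0 =
    (erfcMoment 1 / 2 + erfcMoment 2 / 4 + 5 * erfcMoment 3 / 32) * 1 ^ (2 * n) +
    (-erfcMoment 2 / 16 - erfcMoment 3 / 16) * 2 ^ (2 * n) +
    erfcMoment 3 / 96 * 3 ^ (2 * n) := by
  have h : ∀ a c : ℝ, ContDiffAt ℝ ((2 * n : ℕ) : WithTop ℕ∞) (fun B => a * Real.cosh (c * B)) 0 :=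
    fun a c => by fun_prop
  unfold coshApprox
  rw [iteratedDeriv_fun_add (by fun_prop) (h _ _), iteratedDeriv_fun_add (by fun_prop) (h _ _),
    iteratedDeriv_const_add (by omega), iteratedDeriv_const_mul_field,
    iteratedDeriv_const_mul_field, iteratedDeriv_const_mul_field,
    iteratedDeriv_even_cosh_mul_zero, iteratedDeriv_even_cosh_mul_zero,
    iteratedDeriv_even_cosh_mul_zero]

lemma iteratedDeriv_logIntegral {n : ℕ} (hn : n ≠ 0) (hn4 : n < 4) :
    iteratedDeriv (2 * n) logIntegral 0 =
    (erfcMoment 1 / 2 + erfcMoment 2 / 4 + 5 * erfcMoment 3 / 32) * 1 ^ (2 * n) +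
    (-erfcMoment 2 / 16 - erfcMoment 3 / 16) * 2 ^ (2 * n) +
    erfcMoment 3 / 96 * 3 ^ (2 * n) := by
  have h := iteratedDeriv_eq_zero_of_isBigO
    ((analyticAt_logIntegral 0).sub (analyticAt_coshApprox 0))
    logIntegral_sub_coshApprox_isBigO (k := 2 * n) (by omega)
  rw [iteratedDeriv_sub (analyticAt_logIntegral 0).contDiffAt
    (analyticAt_coshApprox 0).contDiffAt, sub_eq_zero] at h
  rw [h, iteratedDeriv_coshApprox hn]

lemma contDiff_limitCGF (ρ σ : ℝ) {n : WithTop ℕ∞} : ContDiff ℝ n (limitCGF ρ σ) := by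
  rw [show limitCGF ρ σ = fun l => σ * ρ * logIntegral (l / ρ) from funext (limitCGF_eq ρ σ)]
  exact contDiff_const.mul (contDiff_logIntegral.comp (contDiff_id.div_const ρ))

lemma iteratedDeriv_limitCGF (ρ σ : ℝ) (n : ℕ) :
    iteratedDeriv n (limitCGF ρ σ) 0 = σ * ρ * (1 / ρ ^ n * iteratedDeriv n logIntegral 0) := by
  rw [show limitCGF ρ σ = fun l => σ * ρ * logIntegral (ρ⁻¹ * l) from funext fun l => by
    rw [limitCGF_eq, div_eq_inv_mul], iteratedDeriv_const_mul_field,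
    iteratedDeriv_comp_const_mul contDiff_logIntegral]
  simp

lemma iteratedDeriv_odd_limitCGF (ρ σ : ℝ) (k : ℕ) :
    iteratedDeriv (2 * k + 1) (limitCGF ρ σ) 0 = 0 := by
  have h := iteratedDeriv_comp_neg (2 * k + 1) logIntegral 0
  rw [show (fun x => logIntegral (-x)) = logIntegral from funext logIntegral_neg, neg_zero,
    Odd.neg_one_pow ⟨k, rfl⟩] at h
  simp only [neg_smul, one_smul] at h
  rw [iteratedDeriv_limitCGF, show iteratedDeriv (2 * k + 1) logIntegral 0 = 0 by linarith]
  simp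

lemma iteratedDeriv_two_limitCGF {ρ : ℝ} (hρ : 0 < ρ) (σ : ℝ) :
    iteratedDeriv 2 (limitCGF ρ σ) 0 = σ / (2 * ρ) * ∫ η in Ioi (0 : ℝ), erfc η * erfc (-η) := by
  have h := iteratedDeriv_logIntegral (n := 1) (by norm_num) (by norm_num)
  have hm : erfcMoment 1 = ∫ η in Ioi (0 : ℝ), erfc η * erfc (-η) := by simp [erfcMoment, erfcProd]
  rw [iteratedDeriv_limitCGF, show (2 : ℕ) = 2 * 1 by rfl, h, ← hm]
  field_simp
  ring

lemma iteratedDeriv_four_limitCGF {ρ : ℝ} (hρ : 0 < ρ) (σ : ℝ) :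
    iteratedDeriv 4 (limitCGF ρ σ) 0 = σ / (2 * ρ ^ 3) * ∫ η in Ioi (0 : ℝ),
      (1 - 3 / 2 * (erfc η * erfc (-η))) * (erfc η * erfc (-η)) := by
  have h := iteratedDeriv_logIntegral (n := 2) (by norm_num) (by norm_num)
  have hm : ∫ η in Ioi (0 : ℝ), (1 - 3 / 2 * (erfc η * erfc (-η))) * (erfc η * erfc (-η)) =
      erfcMoment 1 - 3 / 2 * erfcMoment 2 := by
    rw [erfcMoment, erfcMoment, ← integral_const_mul,
      ← integral_sub (integrableOn_erfcProd_pow one_ne_zero)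
        ((integrableOn_erfcProd_pow two_ne_zero).const_mul _)]
    refine integral_congr_ae (ae_of_all _ fun η => ?_)
    simp only [erfcProd]
    ring
  rw [iteratedDeriv_limitCGF, show (4 : ℕ) = 2 * 2 by rfl, h, hm]
  field_simp
  ring

lemma iteratedDeriv_six_limitCGF {ρ : ℝ} (hρ : 0 < ρ) (σ : ℝ) :
    iteratedDeriv 6 (limitCGF ρ σ) 0 = σ / (2 * ρ ^ 5) * ∫ η in Ioi (0 : ℝ),
      (1 - 15 / 2 * ((1 - erfc η * erfc (-η)) * (erfc η * erfc (-η)))) *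
        (erfc η * erfc (-η)) := by
  have h := iteratedDeriv_logIntegral (n := 3) (by norm_num) (by norm_num)
  have hm : ∫ η in Ioi (0 : ℝ), (1 - 15 / 2 * ((1 - erfc η * erfc (-η)) *
      (erfc η * erfc (-η)))) * (erfc η * erfc (-η)) =
      erfcMoment 1 - 15 / 2 * erfcMoment 2 + 15 / 2 * erfcMoment 3 := by
    have i1 := integrableOn_erfcProd_pow one_ne_zero
    have i2 := (integrableOn_erfcProd_pow two_ne_zero).const_mul (15 / 2)
    have i3 := (integrableOn_erfcProd_pow three_ne_zero).const_mul (15 / 2)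
    rw [erfcMoment, erfcMoment, erfcMoment, ← integral_const_mul, ← integral_const_mul,
      ← integral_sub i1 i2, ← integral_add (i1.sub' i2) i3]
    refine integral_congr_ae (ae_of_all _ fun η => ?_)
    simp only [erfcProd]
    ring
  rw [iteratedDeriv_limitCGF, show (6 : ℕ) = 2 * 3 by rfl, h, hm]
  field_simp
  ring

/-! ### Growth of `logIntegral` -/

lemma logIntegrand_le {B η : ℝ} (hB : 0 ≤ B) (hη : 0 ≤ η) :
    logIntegrand B η ≤ Real.log (1 + Real.exp (B - η ^ 2)) := by
  have hq := erfcProd_pos η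
  have h1 : Real.sinh (B / 2) ^ 2 ≤ Real.exp B / 4 := by
    have h0 : 0 ≤ Real.sinh (B / 2) := Real.sinh_nonneg_iff.mpr (by linarith)
    have h2 : Real.sinh (B / 2) ≤ Real.exp (B / 2) / 2 := by
      rw [Real.sinh_eq]
      linarith [Real.exp_pos (-(B / 2))]
    calc Real.sinh (B / 2) ^ 2 ≤ (Real.exp (B / 2) / 2) ^ 2 := by gcongr
      _ = Real.exp B / 4 := by
        rw [div_pow, ← Real.exp_nat_mul]
        norm_num
        ring_nf
  have h2 : erfcProd η ≤ 2 * Real.exp (-η ^ 2) :=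
    (erfcProd_le_two_mul η).trans (by linarith [erfc_le_exp_neg_sq hη])
  rw [logIntegrand_eq]
  refine Real.log_le_log (by positivity) ?_
  have h3 : Real.sinh (B / 2) ^ 2 * erfcProd η ≤ Real.exp B / 4 * (2 * Real.exp (-η ^ 2)) := by
    gcongr
  rw [sub_eq_add_neg, Real.exp_add]
  have := mul_pos (Real.exp_pos B) (Real.exp_pos (-η ^ 2))
  linarith

/-- With `B = s²` the integrand is close to the positive part of `s² - η²`, whose integral is `2 s³
/ 3`. Up to `η = s` the excess is at most `1` per unit length, as `ln (1 + e^a) ≤ a + 1` for `a ≥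
0`; beyond `s` what remains is below a Gaussian, as `s² - η² ≤ -(η - s)²`. -/
lemma logIntegral_sq_le {s : ℝ} (hs : 0 ≤ s) :
    logIntegral (s ^ 2) ≤ 2 / 3 * s ^ 3 + s + 1 := by
  have hint := integrableOn_logIntegrand (s ^ 2)
  rw [logIntegral, ← Ioc_union_Ioi_eq_Ioi hs, setIntegral_union (Ioc_disjoint_Ioi le_rfl)
    measurableSet_Ioi (hint.mono_set Ioc_subset_Ioi_self) (hint.mono_set (Ioi_subset_Ioi hs))]
  refine add_le_add (b := 2 / 3 * s ^ 3 + s) ?_ ?_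
  · have hc : Continuous fun η : ℝ => s ^ 2 - η ^ 2 + 1 := by fun_prop
    calc ∫ η in Ioc 0 s, logIntegrand (s ^ 2) η ≤ ∫ η in Ioc 0 s, (s ^ 2 - η ^ 2 + 1) := by
          refine setIntegral_mono_on (hint.mono_set Ioc_subset_Ioi_self)
            (hc.integrableOn_Icc.mono_set Ioc_subset_Icc_self) measurableSet_Ioc fun η hη => ?_
          refine (logIntegrand_le (sq_nonneg s) hη.1.le).trans ?_
          have hpos : 0 ≤ s ^ 2 - η ^ 2 := by nlinarith [hη.1, hη.2]
          rw [Real.log_le_iff_le_exp (by positivity), Real.exp_add]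
          have h1 := Real.one_le_exp hpos
          have h2 : (2 : ℝ) ≤ Real.exp 1 := by linarith [Real.exp_one_gt_d9]
          nlinarith
      _ = 2 / 3 * s ^ 3 + s := by
          rw [← intervalIntegral.integral_of_le hs, intervalIntegral.integral_add
            (Continuous.intervalIntegrable (by fun_prop) _ _)
            (Continuous.intervalIntegrable (by fun_prop) _ _), intervalIntegral.integral_sub
            (Continuous.intervalIntegrable (by fun_prop) _ _)
            (Continuous.intervalIntegrable (by fun_prop) _ _), integral_pow]
          simp
          ring
  · calc ∫ η in Ioi s, logIntegrand (s ^ 2) η ≤ ∫ η in Ioi s, Real.exp (-(η - s) ^ 2) := by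
          refine setIntegral_mono_on (hint.mono_set (Ioi_subset_Ioi hs))
            (integrable_exp_neg_sq.comp_sub_right s).integrableOn measurableSet_Ioi fun η hη => ?_
          have hη' : s < η := hη
          refine (logIntegrand_le (sq_nonneg s) (hs.trans hη'.le)).trans ?_
          refine (Real.log_le_sub_one_of_pos (by positivity)).trans ?_
          rw [add_sub_cancel_left, Real.exp_le_exp]
          nlinarith [mul_nonneg hs (sub_nonneg.mpr hη'.le)]
      _ = √Real.pi / 2 := by
          rw [← integral_Ioi_exp_neg_sq]
          have := (measurePreserving_sub_right volume s).setIntegral_preimage_emb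
            (MeasurableEquiv.subRight s).measurableEmbedding
            (fun u : ℝ => Real.exp (-u ^ 2)) (Ioi 0)
          rw [← this]
          simp
      _ ≤ 1 := by linarith [sqrt_pi_le_two]

lemma logIntegrand_nonneg (B η : ℝ) : 0 ≤ logIntegrand B η := by
  rw [logIntegrand_eq]
  have := erfcProd_pos η
  exact Real.log_nonneg (by nlinarith [mul_nonneg (sq_nonneg (Real.sinh (B / 2))) this.le])

lemma le_logIntegrand {B η : ℝ} (hB : 1 ≤ B) (hη : 0 ≤ η) :
    B - 3 - (η + 1) ^ 2 ≤ logIntegrand B η := by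
  have h1 : Real.exp (B / 2) / 4 ≤ Real.sinh (B / 2) := by
    rw [Real.sinh_eq]
    have h2 : Real.exp (B / 2) = Real.exp (-(B / 2)) * Real.exp B := by
      rw [← Real.exp_add]
      congr 1
      ring
    have h3 : 2 ≤ Real.exp B := by
      linarith [Real.exp_one_gt_d9, Real.exp_le_exp.mpr hB]
    nlinarith [Real.exp_pos (-(B / 2))]
  -- The `3` in the bound absorbs the factor `1 / 16`, the square of the `1 / 4` in the lower bound
  -- for `sinh`.
  have h16 : Real.exp (-3) ≤ 1 / 16 := by
    rw [Real.exp_neg, ← one_div, one_div_le_one_div (Real.exp_pos _) (by norm_num)]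
    have : Real.exp 3 = Real.exp 1 ^ 3 := by rw [← Real.exp_nat_mul]; norm_num
    rw [this]
    calc (16 : ℝ) ≤ 2.7 ^ 3 := by norm_num
      _ ≤ _ := by gcongr; linarith [Real.exp_one_gt_d9]
  rw [logIntegrand_eq]
  have hq := erfcProd_pos η
  rw [Real.le_log_iff_exp_le (by positivity)]
  have h4 := (exp_neg_sq_le_erfc hη).trans (erfc_le_erfcProd hη)
  calc Real.exp (B - 3 - (η + 1) ^ 2) =
        Real.exp (B / 2) ^ 2 * Real.exp (-3) * Real.exp (-(η + 1) ^ 2) := by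
        rw [← Real.exp_nat_mul, ← Real.exp_add, ← Real.exp_add]
        congr 1
        push_cast
        ring
    _ ≤ Real.exp (B / 2) ^ 2 * (1 / 16) * erfcProd η := by gcongr
    _ = (Real.exp (B / 2) / 4) ^ 2 * erfcProd η := by ring
    _ ≤ Real.sinh (B / 2) ^ 2 * erfcProd η := by gcongr
    _ ≤ _ := by linarith

lemma le_logIntegral_sq {s : ℝ} (hs : 1 ≤ s) :
    2 / 3 * s ^ 3 - s ^ 2 - 4 * s ≤ logIntegral (s ^ 2) := by
  have hint := integrableOn_logIntegrand (s ^ 2)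
  have hs0 : 0 ≤ s := by linarith
  have hc : Continuous fun η : ℝ => s ^ 2 - 3 - (η + 1) ^ 2 := by fun_prop
  calc 2 / 3 * s ^ 3 - s ^ 2 - 4 * s = ∫ η in Ioc 0 s, (s ^ 2 - 3 - (η + 1) ^ 2) := by
        rw [← intervalIntegral.integral_of_le hs0, intervalIntegral.integral_sub
            (Continuous.intervalIntegrable (by fun_prop) _ _)
            (Continuous.intervalIntegrable (by fun_prop) _ _),
            intervalIntegral.integral_comp_add_right (fun x => x ^ 2), integral_pow]
        simp
        ring
    _ ≤ ∫ η in Ioc 0 s, logIntegrand (s ^ 2) η :=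
        setIntegral_mono_on (hc.integrableOn_Icc.mono_set Ioc_subset_Icc_self)
          (hint.mono_set Ioc_subset_Ioi_self) measurableSet_Ioc
          fun η hη => le_logIntegrand (by nlinarith) hη.1.le
    _ ≤ logIntegral (s ^ 2) := setIntegral_mono_set hint
        (ae_of_all _ fun η => logIntegrand_nonneg _ η) (ae_of_all _ Ioc_subset_Ioi_self)

/-- The tangent at `s²` lies below `I` at the origin, so `I(s²) ≤ s² I'(s²)`. The factor `2 / 3` is
not sharp, but it suffices for surjectivity of `I'` and for lower-order terms. -/
lemma le_deriv_logIntegral_sq {s : ℝ} (hs : 1 ≤ s) :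
    2 / 3 * s - 5 ≤ deriv logIntegral (s ^ 2) := by
  have h1 := logIntegral_tangent_le 0 (s ^ 2)
  rw [logIntegral_zero] at h1
  have h2 := le_logIntegral_sq hs
  have hs2 : 0 < s ^ 2 := by positivity
  refine le_of_mul_le_mul_right ?_ hs2
  nlinarith

lemma continuous_deriv_logIntegral : Continuous (deriv logIntegral) :=
  (contDiff_logIntegral (n := 1)).continuous_deriv le_rfl

lemma tendsto_deriv_logIntegral_atTop : Tendsto (deriv logIntegral) atTop atTop := by
  refine tendsto_atTop_mono' atTop (f₁ := fun B => 2 / 3 * √B - 5) ?_ ?_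
  · filter_upwards [eventually_ge_atTop 1] with B hB
    have h := le_deriv_logIntegral_sq (s := √B) (Real.one_le_sqrt.mpr hB)
    rwa [Real.sq_sqrt (by linarith)] at h
  · exact tendsto_atTop_add_const_right _ _
      (Real.tendsto_sqrt_atTop.const_mul_atTop (by norm_num))

lemma surjective_deriv_logIntegral : Function.Surjective (deriv logIntegral) := by
  refine continuous_deriv_logIntegral.surjective tendsto_deriv_logIntegral_atTop ?_
  have h : deriv logIntegral = fun B => -deriv logIntegral (-B) := by
    funext B
    rw [deriv_logIntegral_neg, neg_neg]
  rw [h]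
  exact tendsto_neg_atTop_atBot.comp (tendsto_deriv_logIntegral_atTop.comp tendsto_neg_atBot_atTop)

/-! ### The large deviation function -/

/-- `I'` as an order isomorphism of the real line. -/
def derivIso : ℝ ≃o ℝ :=
  strictMono_deriv_logIntegral.orderIsoOfSurjective _ surjective_deriv_logIntegral

lemma derivIso_apply (B : ℝ) : derivIso B = deriv logIntegral B := rfl

/-- The solution `B` of `ξ = σ I'(B)`. -/
def conjVar (σ ξ : ℝ) : ℝ := derivIso.symm (ξ / σ)

/-- The quenched large deviation function of the tracer. -/
def ldf (ρ σ ξ : ℝ) : ℝ := ρ * conjVar σ ξ * ξ - ρ * σ * logIntegral (conjVar σ ξ)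

section Legendre

variable {ρ σ : ℝ}

lemma mul_deriv_conjVar (hσ : 0 < σ) (ξ : ℝ) : σ * deriv logIntegral (conjVar σ ξ) = ξ := by
  rw [← derivIso_apply, conjVar, OrderIso.apply_symm_apply]
  field_simp

lemma eq_conjVar_iff (hσ : 0 < σ) {ξ B : ℝ} : ξ = σ * deriv logIntegral B ↔ B = conjVar σ ξ := by
  constructor
  · intro h
    rw [conjVar, h, mul_div_cancel_left₀ _ hσ.ne', ← derivIso_apply, OrderIso.symm_apply_apply]
  · rintro rfl
    exact (mul_deriv_conjVar hσ ξ).symm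

lemma conjVar_strictMono (hσ : 0 < σ) : StrictMono (conjVar σ) := fun _ _ h =>
  derivIso.symm.strictMono (div_lt_div_of_pos_right h hσ)

lemma deriv_logIntegral_zero : deriv logIntegral 0 = 0 := by
  have := deriv_logIntegral_neg 0
  rw [neg_zero] at this
  linarith

lemma conjVar_zero (hσ : 0 < σ) : conjVar σ 0 = 0 :=
  ((eq_conjVar_iff hσ).mp (by simp [deriv_logIntegral_zero])).symm

lemma conjVar_neg (hσ : 0 < σ) (ξ : ℝ) : conjVar σ (-ξ) = -conjVar σ ξ := by
  refine ((eq_conjVar_iff hσ).mp ?_).symm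
  rw [deriv_logIntegral_neg, mul_neg, mul_deriv_conjVar hσ]

lemma continuous_conjVar (σ : ℝ) : Continuous (conjVar σ) :=
  derivIso.symm.continuous.comp (continuous_id.div_const σ)

lemma continuous_ldf (ρ σ : ℝ) : Continuous (ldf ρ σ) := by
  have h1 := continuous_conjVar σ
  have h2 := differentiable_logIntegral.continuous
  unfold ldf
  fun_prop

/-- The Fenchel–Young inequality: `I` lies above its tangent at the conjugate variable. Hence the
parametric formula is the supremum over `B`, and every `B` yields a lower bound. -/
lemma le_ldf (hρ : 0 < ρ) (hσ : 0 < σ) (B ξ : ℝ) :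
    ρ * B * ξ - ρ * σ * logIntegral B ≤ ldf ρ σ ξ := by
  have h := logIntegral_tangent_le B (conjVar σ ξ)
  have h2 := mul_deriv_conjVar hσ ξ
  unfold ldf
  have h3 : ρ * (σ * (logIntegral (conjVar σ ξ) + deriv logIntegral (conjVar σ ξ) *
      (B - conjVar σ ξ))) ≤ ρ * (σ * logIntegral B) := by gcongr
  have h4 : σ * (deriv logIntegral (conjVar σ ξ) * (B - conjVar σ ξ)) = ξ * (B - conjVar σ ξ) := by
    rw [← mul_assoc, h2]
  linear_combination h3 - ρ * h4

lemma ldf_nonneg (hρ : 0 < ρ) (hσ : 0 < σ) (ξ : ℝ) : 0 ≤ ldf ρ σ ξ := by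
  simpa [logIntegral_zero] using le_ldf hρ hσ 0 ξ

lemma ldf_zero (hσ : 0 < σ) : ldf ρ σ 0 = 0 := by
  simp [ldf, conjVar_zero hσ, logIntegral_zero]

lemma ldf_neg (hσ : 0 < σ) (ξ : ℝ) : ldf ρ σ (-ξ) = ldf ρ σ ξ := by
  simp [ldf, conjVar_neg hσ, logIntegral_neg]

lemma ldf_strictMonoOn (hρ : 0 < ρ) (hσ : 0 < σ) : StrictMonoOn (ldf ρ σ) (Ici 0) := by
  intro ξ₁ h₁ ξ₂ h₂ h
  rcases (mem_Ici.mp h₁).eq_or_lt with h0 | h0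
  · subst h0
    rw [ldf_zero hσ]
    -- The support line at `0` is horizontal and gives no strict increase; the one at `ξ₂ / 2` has
    -- positive slope and is already nonnegative at `ξ₂ / 2`.
    have hB : 0 < conjVar σ (ξ₂ / 2) := by
      rw [← conjVar_zero hσ]
      exact conjVar_strictMono hσ (by linarith)
    have h1 := le_ldf hρ hσ (conjVar σ (ξ₂ / 2)) ξ₂
    have h2 := ldf_nonneg hρ hσ (ξ₂ / 2)
    unfold ldf at h2
    nlinarith [mul_pos (mul_pos hρ hB) h]
  · have hB : 0 < conjVar σ ξ₁ := by
      rw [← conjVar_zero hσ]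
      exact conjVar_strictMono hσ h0
    have h1 := le_ldf hρ hσ (conjVar σ ξ₁) ξ₂
    refine lt_of_lt_of_le ?_ h1
    unfold ldf
    nlinarith [mul_pos (mul_pos hρ hB) (sub_pos.mpr h)]

lemma ldf_abs (hσ : 0 < σ) (ξ : ℝ) : ldf ρ σ |ξ| = ldf ρ σ ξ := by
  rcases abs_choice ξ with h | h
  · rw [h]
  · rw [h, ldf_neg hσ]

lemma isGreatest_legendre (hρ : 0 < ρ) (hσ : 0 < σ) (l : ℝ) :
    IsGreatest (range fun ξ => l * ξ - ldf ρ σ ξ) (limitCGF ρ σ l) := by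
  have hl : ρ * (l / ρ) = l := by field_simp
  refine ⟨⟨σ * deriv logIntegral (l / ρ), ?_⟩, ?_⟩
  · have h := (eq_conjVar_iff hσ (ξ := σ * deriv logIntegral (l / ρ)) (B := l / ρ)).mp rfl
    simp only [ldf]
    rw [← h, limitCGF_eq, hl]
    ring
  · rintro _ ⟨ξ, rfl⟩
    have := le_ldf hρ hσ (l / ρ) ξ
    rw [hl] at this
    rw [limitCGF_eq]
    linarith

/-- The choice `B = (x / σ)²` is the maximiser when `I(B)` is replaced by its leading term `2/3
B^(3/2)`. -/
lemma ldf_lower_bound (hρ : 0 < ρ) (hσ : 0 < σ) {x : ℝ} (hx : 0 < x) :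
    ρ * (x ^ 3 / (3 * σ ^ 2) - x - σ) ≤ ldf ρ σ x := by
  refine le_trans ?_ (le_ldf hρ hσ ((x / σ) ^ 2) x)
  have h := logIntegral_sq_le (s := x / σ) (by positivity)
  have h2 : σ * logIntegral ((x / σ) ^ 2) ≤ σ * (2 / 3 * (x / σ) ^ 3 + x / σ + 1) := by gcongr
  have h3 : (x / σ) ^ 2 * x - σ * (2 / 3 * (x / σ) ^ 3 + x / σ + 1) =
      x ^ 3 / (3 * σ ^ 2) - x - σ := by
    field_simp
    ring
  rw [← h3]
  nlinarith

/-- With `B = s²` the main part `s² x - 2 σ s³ / 3` has maximum `x³ / (3 σ²)`. Of the errors in the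
lower bound for `I`, the term `σ s²` is absorbed by replacing `x` with `x + σ`, and `4 σ s` is at
most `6 x + 30 σ` by the bound on `I'`. -/
lemma ldf_upper_bound (hρ : 0 < ρ) (hσ : 0 < σ) {x : ℝ} (hx : 0 < x) :
    ldf ρ σ x ≤ ρ * ((x + σ) ^ 3 / (3 * σ ^ 2) + 6 * x + 30 * σ) := by
  have hB : 0 < conjVar σ x := by
    rw [← conjVar_zero hσ]
    exact conjVar_strictMono hσ hx
  have hderiv := mul_deriv_conjVar hσ x
  have hcub : 0 ≤ (x + σ) ^ 3 / (3 * σ ^ 2) := by positivity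
  rw [ldf, show ρ * conjVar σ x * x - ρ * σ * logIntegral (conjVar σ x) =
    ρ * (conjVar σ x * x - σ * logIntegral (conjVar σ x)) by ring]
  refine mul_le_mul_of_nonneg_left ?_ hρ.le
  set B := conjVar σ x
  rcases le_total B 1 with h1 | h1
  · have hI : 0 ≤ logIntegral B := by
      have := logIntegral_tangent_le B 0
      rwa [logIntegral_zero, deriv_logIntegral_zero, zero_mul, add_zero] at this
    nlinarith [mul_nonneg hσ.le hI]
  · set s := √B
    have hs : 1 ≤ s := Real.one_le_sqrt.mpr h1
    have hsB : s ^ 2 = B := Real.sq_sqrt hB.le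
    rw [← hsB] at hderiv ⊢
    have h2 : σ * (2 / 3 * s - 5) ≤ x := by
      rw [← hderiv]
      gcongr
      exact le_deriv_logIntegral_sq hs
    have h3 : σ * (2 / 3 * s ^ 3 - s ^ 2 - 4 * s) ≤ σ * logIntegral (s ^ 2) := by
      gcongr
      exact le_logIntegral_sq hs
    have h4 : s ^ 2 * (x + σ) - 2 * σ / 3 * s ^ 3 ≤ (x + σ) ^ 3 / (3 * σ ^ 2) := by
      rw [le_div_iff₀ (by positivity)]
      -- For `u = x + σ` this product expands to `u³ - 3 σ² s² u + 2 σ³ s³`.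
      have : 0 ≤ ((x + σ) - σ * s) ^ 2 * ((x + σ) + 2 * σ * s) := by positivity
      nlinarith
    nlinarith

lemma tendsto_ldf_div_cube (hρ : 0 < ρ) (hσ : 0 < σ) :
    Tendsto (fun ξ => ldf ρ σ ξ / (ρ / (3 * σ ^ 2) * |ξ| ^ 3)) (Bornology.cobounded ℝ) (𝓝 1) := by
  have key : Tendsto (fun x => ldf ρ σ x / (ρ / (3 * σ ^ 2) * x ^ 3)) atTop (𝓝 1) := by
    have hinv : Tendsto (fun x : ℝ => x⁻¹) atTop (𝓝 0) := tendsto_inv_atTop_zero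
    have l1 : Tendsto (fun x : ℝ => 1 - 3 * σ ^ 2 * (x⁻¹ ^ 2 + σ * x⁻¹ ^ 3)) atTop (𝓝 1) := by
      have := ((hinv.pow 2).add ((hinv.pow 3).const_mul σ)).const_mul (3 * σ ^ 2) |>.const_sub 1
      simpa using this
    have l2 : Tendsto (fun x : ℝ => (1 + σ * x⁻¹) ^ 3 + 3 * σ ^ 2 *
        (6 * x⁻¹ ^ 2 + 30 * σ * x⁻¹ ^ 3)) atTop (𝓝 1) := by
      have := (((hinv.const_mul σ).const_add 1).pow 3).add
        ((((hinv.pow 2).const_mul 6).add ((hinv.pow 3).const_mul (30 * σ))).const_mul (3 * σ ^ 2))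
      simpa using this
    refine tendsto_of_tendsto_of_tendsto_of_le_of_le' l1 l2 ?_ ?_
    · filter_upwards [eventually_gt_atTop 0] with x hx
      rw [le_div_iff₀ (by positivity)]
      refine le_trans (le_of_eq ?_) (ldf_lower_bound hρ hσ hx)
      field_simp
      ring
    · filter_upwards [eventually_gt_atTop 0] with x hx
      rw [div_le_iff₀ (by positivity)]
      refine (ldf_upper_bound hρ hσ hx).trans (le_of_eq ?_)
      field_simp
      ring
  refine (key.comp tendsto_norm_cobounded_atTop).congr fun ξ => ?_
  simp [Real.norm_eq_abs, ldf_abs hσ]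

end Legendre

/-! ### Exponential asymptotics -/

/-- `x i = exp (a i * (c + o(1)))`. -/
def LogAsymp {ι : Type*} (l : Filter ι) (a x : ι → ℝ) (c : ℝ) : Prop :=
  ∀ ε : ℝ, 0 < ε → ∀ᶠ i in l, Real.exp (a i * (c - ε)) ≤ x i ∧ x i ≤ Real.exp (a i * (c + ε))

section LogAsymp

variable {ι : Type*} {l : Filter ι} {a x y : ι → ℝ} {c c' : ℝ}

lemma LogAsymp.tendsto (ha : Tendsto a l atTop) (h : LogAsymp l a x c) :
    Tendsto (fun i => Real.log (x i) / a i) l (𝓝 c) := by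
  rw [Metric.tendsto_nhds]
  intro ε hε
  filter_upwards [h (ε / 2) (half_pos hε), ha.eventually_gt_atTop 0] with i hi hai
  have hx : 0 < x i := (Real.exp_pos _).trans_le hi.1
  have h1 := (Real.le_log_iff_exp_le hx).mpr hi.1
  have h2 := (Real.log_le_iff_le_exp hx).mpr hi.2
  rw [Real.dist_eq, abs_lt]
  constructor
  · rw [lt_sub_iff_add_lt, lt_div_iff₀ hai]
    nlinarith
  · rw [sub_lt_iff_lt_add, div_lt_iff₀ hai]
    nlinarith

lemma LogAsymp.of_tendsto (ha : Tendsto a l atTop) (hx : ∀ᶠ i in l, 0 < x i)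
    (h : Tendsto (fun i => Real.log (x i) / a i) l (𝓝 c)) : LogAsymp l a x c := by
  intro ε hε
  rw [Metric.tendsto_nhds] at h
  filter_upwards [h ε hε, ha.eventually_gt_atTop 0, hx] with i hi hai hxi
  rw [Real.dist_eq, abs_lt, lt_sub_iff_add_lt, lt_div_iff₀ hai, sub_lt_iff_lt_add,
    div_lt_iff₀ hai] at hi
  rw [← Real.le_log_iff_exp_le hxi, ← Real.log_le_iff_le_exp hxi]
  constructor <;> nlinarith

/-- Constant factors are invisible on the exponential scale. Uniformity in `c` lets a single event
serve several exponents. -/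
lemma eventually_const_mul_exp_le (ha : Tendsto a l atTop) (N : ℝ) {ε : ℝ} (hε : 0 < ε) :
    ∀ᶠ i in l, ∀ c, N * Real.exp (a i * c) ≤ Real.exp (a i * (c + ε)) := by
  have h : Tendsto (fun i => Real.exp (a i * ε)) l atTop :=
    Real.tendsto_exp_atTop.comp (ha.atTop_mul_const hε)
  filter_upwards [h.eventually_ge_atTop N] with i hi c
  rw [mul_add, Real.exp_add, mul_comm]
  exact mul_le_mul_of_nonneg_left hi (Real.exp_pos _).le

/-- The larger exponential dominates. The intended use is the mass of an interval, written as the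
difference of two tails with different rates. -/
lemma LogAsymp.sub_lower (ha : Tendsto a l atTop) (hx : LogAsymp l a x c)
    (hy : LogAsymp l a y c') (hc : c' < c) {ε : ℝ} (hε : 0 < ε) :
    ∀ᶠ i in l, Real.exp (a i * (c - ε)) ≤ x i - y i := by
  -- With this `κ`, both `2 e^(a (c - ε))` and `2 y` are at most `e^(a (c - κ)) ≤ x`; averaging the
  -- two inequalities gives the claim.
  set κ := min (ε / 2) ((c - c') / 4)
  have hκ : 0 < κ := lt_min (half_pos hε) (by linarith)
  have hκ1 : κ ≤ ε / 2 := min_le_left _ _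
  have hκ2 : κ ≤ (c - c') / 4 := min_le_right _ _
  filter_upwards [hx κ hκ, hy κ hκ, eventually_const_mul_exp_le ha 2 hκ,
    ha.eventually_gt_atTop 0] with i h1 h2 h3 hai
  have h4 := h3 (c - ε)
  have h5 := h3 (c' + κ)
  have h6 : Real.exp (a i * (c - ε + κ)) ≤ Real.exp (a i * (c - κ)) := by
    gcongr
    linarith
  have h7 : Real.exp (a i * (c' + κ + κ)) ≤ Real.exp (a i * (c - κ)) := by
    gcongr
    linarith
  linarith [h1.1, h2.2]

end LogAsymp

/-! ### Lower bound by tilting -/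

/-- The lower bound of the Gärtner–Ellis theorem. -/
lemma tilting_lower_bound {Ω ι : Type*} [MeasurableSpace Ω] {P : Measure Ω}
    [IsProbabilityMeasure P] {l : Filter ι} {a : ι → ℝ} (ha : Tendsto a l atTop)
    {Q : ι → Ω → ℝ} (hQ : ∀ i, AEMeasurable (Q i) P)
    (hint : ∀ i B, Integrable (fun ω => Real.exp (B * Q i ω)) P) {Λ : ℝ → ℝ}
    (hΛ : ∀ B, LogAsymp l a (fun i => ∫ ω, Real.exp (B * Q i ω) ∂P) (Λ B)) {B₀ m : ℝ}
    (hm : HasDerivAt Λ m B₀) {δ ε : ℝ} (hδ : 0 < δ) (hε : 0 < ε) :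
    ∀ᶠ i in l, Real.exp (a i * (Λ B₀ - B₀ * m - |B₀| * δ - ε)) ≤
      P.real {ω | |Q i ω - a i * m| < a i * δ} := by
  -- Differentiability at `B₀` provides a second, small tilt `s` for which the error of the linear
  -- approximation is only half of the gain `s δ` of Chernoff's bound.
  obtain ⟨s, hs, hs1, hs2⟩ : ∃ s : ℝ, 0 < s ∧ Λ (B₀ + s) - Λ B₀ - s * m ≤ s * (δ / 2) ∧
      Λ (B₀ - s) - Λ B₀ + s * m ≤ s * (δ / 2) := by
    have h := (hasDerivAt_iff_isLittleO.mp hm).bound (half_pos hδ)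
    rw [Metric.eventually_nhds_iff] at h
    obtain ⟨r, hr, h⟩ := h
    refine ⟨r / 2, half_pos hr, ?_, ?_⟩
    · have := h (y := B₀ + r / 2) (by simp [abs_of_pos hr]; linarith)
      rw [add_sub_cancel_left, smul_eq_mul, Real.norm_eq_abs, Real.norm_eq_abs,
        abs_of_pos (half_pos hr)] at this
      linarith [le_abs_self (Λ (B₀ + r / 2) - Λ B₀ - r / 2 * m)]
    · have := h (y := B₀ - r / 2) (by simp [abs_of_pos hr]; linarith)
      rw [sub_sub_cancel_left, smul_eq_mul, Real.norm_eq_abs, Real.norm_eq_abs, abs_neg,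
        abs_of_pos (half_pos hr)] at this
      linarith [le_abs_self (Λ (B₀ - r / 2) - Λ B₀ - -(r / 2) * m)]
  set κ := min (s * δ / 8) (ε / 2)
  have hκ : 0 < κ := lt_min (by positivity) (half_pos hε)
  have hκ1 : κ ≤ s * δ / 8 := min_le_left _ _
  have hκ2 : κ ≤ ε / 2 := min_le_right _ _
  filter_upwards [hΛ B₀ κ hκ, hΛ (B₀ + s) κ hκ, hΛ (B₀ - s) κ hκ,
    eventually_const_mul_exp_le ha 4 hκ, ha.eventually_gt_atTop 0] with i h0 h1 h2 h3 hai
  set A := {ω | |Q i ω - a i * m| < a i * δ}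
  have hA : NullMeasurableSet A P :=
    nullMeasurableSet_lt ((hQ i).sub_const _).abs aemeasurable_const
  -- The tilted weight is split without introducing a tilted measure. On `A` it is at most a
  -- constant; outside, the deviation of `Q` in either direction is paid for by the extra tilt `±
  -- s`.
  have hpt : ∀ ω, Real.exp (B₀ * Q i ω) ≤
      A.indicator (fun _ => Real.exp (a i * (B₀ * m + |B₀| * δ))) ω +
      Real.exp (-(s * (a i * (m + δ)))) * Real.exp ((B₀ + s) * Q i ω) +
      Real.exp (s * (a i * (m - δ))) * Real.exp ((B₀ - s) * Q i ω) := by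
    intro ω
    rw [← Real.exp_add, ← Real.exp_add]
    by_cases hω : ω ∈ A
    · rw [indicator_of_mem hω]
      have : Real.exp (B₀ * Q i ω) ≤ Real.exp (a i * (B₀ * m + |B₀| * δ)) := by
        rw [Real.exp_le_exp]
        have h4 : B₀ * (Q i ω - a i * m) ≤ |B₀| * (a i * δ) := by
          refine (le_abs_self _).trans ?_
          rw [abs_mul]
          exact mul_le_mul_of_nonneg_left (le_of_lt hω) (abs_nonneg _)
        linarith
      have p1 := Real.exp_pos (-(s * (a i * (m + δ))) + (B₀ + s) * Q i ω)
      have p2 := Real.exp_pos (s * (a i * (m - δ)) + (B₀ - s) * Q i ω)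
      linarith
    · rw [indicator_of_notMem hω, zero_add]
      have hω' : a i * δ ≤ |Q i ω - a i * m| := not_lt.mp hω
      rcases le_abs.mp hω' with h4 | h4
      · have : Real.exp (B₀ * Q i ω) ≤ Real.exp (-(s * (a i * (m + δ))) + (B₀ + s) * Q i ω) := by
          rw [Real.exp_le_exp]
          nlinarith
        linarith [Real.exp_pos (s * (a i * (m - δ)) + (B₀ - s) * Q i ω)]
      · have : Real.exp (B₀ * Q i ω) ≤ Real.exp (s * (a i * (m - δ)) + (B₀ - s) * Q i ω) := by
          rw [Real.exp_le_exp]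
          nlinarith
        linarith [Real.exp_pos (-(s * (a i * (m + δ))) + (B₀ + s) * Q i ω)]
  have hindic : Integrable (A.indicator fun _ => Real.exp (a i * (B₀ * m + |B₀| * δ))) P :=
    (integrable_const _).indicator₀ hA
  have i1 := (hint i (B₀ + s)).const_mul (Real.exp (-(s * (a i * (m + δ)))))
  have i2 := (hint i (B₀ - s)).const_mul (Real.exp (s * (a i * (m - δ))))
  have hI : ∫ ω, Real.exp (B₀ * Q i ω) ∂P ≤ P.real A * Real.exp (a i * (B₀ * m + |B₀| * δ)) +
      Real.exp (-(s * (a i * (m + δ)))) * ∫ ω, Real.exp ((B₀ + s) * Q i ω) ∂P +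
      Real.exp (s * (a i * (m - δ))) * ∫ ω, Real.exp ((B₀ - s) * Q i ω) ∂P := by
    refine (integral_mono (hint i B₀) ((hindic.add i1).add i2) hpt).trans (le_of_eq ?_)
    have e1 : ∫ ω, A.indicator (fun _ => Real.exp (a i * (B₀ * m + |B₀| * δ))) ω ∂P =
        P.real A * Real.exp (a i * (B₀ * m + |B₀| * δ)) := by
      rw [integral_indicator₀ hA, setIntegral_const, smul_eq_mul]
    rw [← e1, ← integral_const_mul, ← integral_const_mul, ← integral_add hindic i1]
    exact integral_add (hindic.add i1) i2
  have hE1 : Real.exp (-(s * (a i * (m + δ)))) * ∫ ω, Real.exp ((B₀ + s) * Q i ω) ∂P ≤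
      Real.exp (a i * (Λ B₀ - κ - κ)) := by
    refine (mul_le_mul_of_nonneg_left h1.2 (Real.exp_pos _).le).trans ?_
    rw [← Real.exp_add, Real.exp_le_exp]
    have : a i * (Λ (B₀ + s) + κ - s * m - s * δ) ≤ a i * (Λ B₀ - κ - κ) := by
      refine mul_le_mul_of_nonneg_left ?_ hai.le
      linarith
    linarith
  have hE2 : Real.exp (s * (a i * (m - δ))) * ∫ ω, Real.exp ((B₀ - s) * Q i ω) ∂P ≤
      Real.exp (a i * (Λ B₀ - κ - κ)) := by
    refine (mul_le_mul_of_nonneg_left h2.2 (Real.exp_pos _).le).trans ?_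
    rw [← Real.exp_add, Real.exp_le_exp]
    have : a i * (Λ (B₀ - s) + κ + s * m - s * δ) ≤ a i * (Λ B₀ - κ - κ) := by
      refine mul_le_mul_of_nonneg_left ?_ hai.le
      linarith
    linarith
  -- The factor `4` makes each of the two error terms at most a quarter of the total integral, so
  -- the contribution of `A` dominates.
  have h4 := h3 (Λ B₀ - κ - κ)
  rw [sub_add_cancel] at h4
  have h5 : Real.exp (a i * (Λ B₀ - κ - κ)) ≤
      P.real A * Real.exp (a i * (B₀ * m + |B₀| * δ)) := by
    linarith [h0.1, Real.exp_pos (a i * (Λ B₀ - κ - κ))]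
  rw [← div_le_iff₀ (Real.exp_pos _), ← Real.exp_sub] at h5
  refine le_trans ?_ h5
  rw [Real.exp_le_exp, ← mul_sub]
  refine mul_le_mul_of_nonneg_left ?_ hai.le
  linarith

/-! ### From tails to open sets and to exponential integrals -/

section Varadhan

variable {ι : Type*} {l : Filter ι} {a : ι → ℝ} {ν : ι → Measure ℝ}
  [∀ i, IsProbabilityMeasure (ν i)] {φ : ℝ → ℝ}

/-- The two tails of `ν i` decay at speed `a i` with the rates `φ`. -/
structure HasTailRates (l : Filter ι) (a : ι → ℝ) (ν : ι → Measure ℝ) (φ : ℝ → ℝ) : Prop where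
  right : ∀ r : ℚ, 0 < r → LogAsymp l a (fun i => (ν i).real (Ioi (r : ℝ))) (-φ r)
  left : ∀ r : ℚ, r < 0 → LogAsymp l a (fun i => (ν i).real (Iic (r : ℝ))) (-φ r)

/-- An even continuous rate function that increases on the positive half-line. -/
structure IsEvenRate (φ : ℝ → ℝ) : Prop where
  continuous : Continuous φ
  zero : φ 0 = 0
  even : ∀ x, φ |x| = φ x
  strictMonoOn : StrictMonoOn φ (Ici 0)

lemma IsEvenRate.nonneg (hφ : IsEvenRate φ) (x : ℝ) : 0 ≤ φ x := by
  rw [← hφ.even, ← hφ.zero]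
  exact hφ.strictMonoOn.monotoneOn self_mem_Ici (abs_nonneg x) (abs_nonneg x)

/-- A short interval next to `ξ`, on the side away from the origin, lies in `G` and carries rates
close to `φ ξ`. Its mass is a difference of two tails whose rates differ because `φ` is strictly
monotone. The endpoints are rational since the tail rates are only given there. -/
lemma HasTailRates.lower_bound (ha : Tendsto a l atTop) (hφ : IsEvenRate φ)
    (h : HasTailRates l a ν φ) {G : Set ℝ} (hG : IsOpen G) {ξ : ℝ} (hξ : ξ ∈ G) {ε : ℝ}
    (hε : 0 < ε) : ∀ᶠ i in l, Real.exp (a i * (-φ ξ - ε)) ≤ (ν i).real G := by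
  obtain ⟨d, hd, hdG⟩ := Metric.isOpen_iff.mp (hG.inter
    (isOpen_lt hφ.continuous continuous_const : IsOpen {x | φ x < φ ξ + ε / 2})) ξ
    ⟨hξ, by simp [hε]⟩
  rcases le_or_gt 0 ξ with h0 | h0
  · obtain ⟨r, hr1, hr2⟩ := exists_rat_btwn (show ξ < ξ + d by linarith)
    obtain ⟨s, hs1, hs2⟩ := exists_rat_btwn hr2
    have hrs : φ r < φ s := hφ.strictMonoOn (mem_Ici.mpr (by linarith))
      (mem_Ici.mpr (by linarith)) hs1
    have hr := (hdG (a := r) (by rw [Metric.mem_ball, Real.dist_eq, abs_lt]; constructor <;> linarith)).2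
    have hr0 : (0 : ℝ) < r := by linarith
    have hs0 : (0 : ℝ) < s := by linarith
    filter_upwards [(h.right r (by exact_mod_cast hr0)).sub_lower ha
      (h.right s (by exact_mod_cast hs0)) (neg_lt_neg hrs) (half_pos hε),
      ha.eventually_gt_atTop 0] with i hi hai
    have hsub : Ioi (r : ℝ) \ Ioi (s : ℝ) ⊆ G := fun x hx => (hdG (a := x) (by
      have h1 : (r : ℝ) < x := hx.1
      have h2 : x ≤ s := not_lt.mp hx.2
      rw [Metric.mem_ball, Real.dist_eq, abs_lt]; constructor <;> linarith)).1
    rw [← measureReal_sdiff (Ioi_subset_Ioi hs1.le) measurableSet_Ioi] at hi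
    refine le_trans ?_ (hi.trans (measureReal_mono hsub))
    rw [Real.exp_le_exp]
    refine mul_le_mul_of_nonneg_left ?_ hai.le
    have : φ r < φ ξ + ε / 2 := hr
    linarith
  · obtain ⟨r, hr2, hr1⟩ := exists_rat_btwn (show ξ - d < ξ by linarith)
    obtain ⟨s, hs2, hs1⟩ := exists_rat_btwn hr2
    have hrs : φ r < φ s := by
      rw [← hφ.even r, ← hφ.even s]
      refine hφ.strictMonoOn (mem_Ici.mpr (abs_nonneg _)) (mem_Ici.mpr (abs_nonneg _)) ?_
      rw [abs_of_neg (by linarith), abs_of_neg (by linarith)]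
      linarith
    have hr := (hdG (a := r) (by rw [Metric.mem_ball, Real.dist_eq, abs_lt]; constructor <;> linarith)).2
    have hr0 : (r : ℝ) < 0 := by linarith
    have hs0 : (s : ℝ) < 0 := by linarith
    filter_upwards [(h.left r (by exact_mod_cast hr0)).sub_lower ha
      (h.left s (by exact_mod_cast hs0)) (neg_lt_neg hrs) (half_pos hε),
      ha.eventually_gt_atTop 0] with i hi hai
    have hsub : Iic (r : ℝ) \ Iic (s : ℝ) ⊆ G := fun x hx => (hdG (a := x) (by
      have h1 : x ≤ r := hx.1
      have h2 : (s : ℝ) < x := not_le.mp hx.2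
      rw [Metric.mem_ball, Real.dist_eq, abs_lt]; constructor <;> linarith)).1
    rw [← measureReal_sdiff (Iic_subset_Iic.mpr hs1.le) measurableSet_Iic] at hi
    refine le_trans ?_ (hi.trans (measureReal_mono hsub))
    rw [Real.exp_le_exp]
    refine mul_le_mul_of_nonneg_left ?_ hai.le
    have : φ r < φ ξ + ε / 2 := hr
    linarith

/-- If `c > ε`, the intermediate value theorem gives a rational radius `r` with `φ r` just below
`c`. As `φ` is even and monotone, `G` avoids `[-r, r]` and its mass is at most that of the two
tails. If `c ≤ ε`, the bound exceeds `1`. -/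
lemma HasTailRates.upper_bound (ha : Tendsto a l atTop) (hφ : IsEvenRate φ)
    (h : HasTailRates l a ν φ) {G : Set ℝ} (hG : G.Nonempty) {c : ℝ}
    (hc : ∀ ξ ∈ G, c ≤ φ ξ) {ε : ℝ} (hε : 0 < ε) :
    ∀ᶠ i in l, (ν i).real G ≤ Real.exp (a i * (-c + ε)) := by
  rcases le_or_gt c ε with h0 | h0
  · filter_upwards [ha.eventually_gt_atTop 0] with i hai
    exact measureReal_le_one.trans (Real.one_le_exp (mul_nonneg hai.le (by linarith)))
  · obtain ⟨g, hg⟩ := hG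
    obtain ⟨x, hx1, hx2⟩ : ∃ x ∈ Icc 0 |g|, φ x = c - ε / 4 := by
      have := intermediate_value_Icc (abs_nonneg g) hφ.continuous.continuousOn
      refine this ⟨?_, ?_⟩
      · rw [hφ.zero]
        linarith
      · rw [hφ.even]
        linarith [hc g hg]
    have hx0 : 0 < x := by
      refine lt_of_le_of_ne hx1.1 ?_
      rintro rfl
      rw [hφ.zero] at hx2
      linarith
    have hopen : IsOpen {y | 0 < y ∧ c - ε / 2 < φ y ∧ φ y < c} :=
      (isOpen_lt continuous_const continuous_id).inter
        ((isOpen_lt continuous_const hφ.continuous).inter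
          (isOpen_lt hφ.continuous continuous_const))
    obtain ⟨r, hr0, hr1, hr2⟩ : ∃ r : ℚ, (0 : ℝ) < r ∧ c - ε / 2 < φ r ∧ φ r < c := by
      exact Rat.denseRange_cast.exists_mem_open hopen ⟨x, hx0, by linarith, by linarith⟩
    have hsub : G ⊆ Iic (-(r : ℝ)) ∪ Ioi (r : ℝ) := by
      intro y hy
      by_contra hn
      rw [mem_union, not_or] at hn
      have h1 : |y| ≤ r := abs_le.mpr ⟨(not_le.mp hn.1).le, not_lt.mp hn.2⟩
      have h2 := hφ.strictMonoOn.monotoneOn (abs_nonneg y) (mem_Ici.mpr hr0.le) h1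
      rw [hφ.even] at h2
      linarith [hc y hy]
    have hl := h.left (-r) (by simpa using (by exact_mod_cast hr0 : (0 : ℚ) < r)) (ε / 4)
      (by linarith)
    have heq : φ ((-r : ℚ) : ℝ) = φ r := by
      rw [← hφ.even, Rat.cast_neg, abs_neg, hφ.even]
    rw [heq] at hl
    filter_upwards [h.right r (by exact_mod_cast hr0) (ε / 4) (by linarith), hl,
      eventually_const_mul_exp_le ha 2 (show 0 < ε / 4 by linarith), ha.eventually_gt_atTop 0]
      with i h1 h2 h3 hai
    have h4 := h3 (-φ r + ε / 4)
    rw [Rat.cast_neg] at h2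
    have h5 := (measureReal_mono (μ := ν i) hsub).trans (measureReal_union_le _ _)
    have h6 : Real.exp (a i * (-φ r + ε / 4 + ε / 4)) ≤ Real.exp (a i * (-c + ε)) := by
      rw [Real.exp_le_exp]
      exact mul_le_mul_of_nonneg_left (by linarith) hai.le
    linarith [h1.2, h2.2]

/-- The large deviation principle on open sets. -/
lemma HasTailRates.logAsymp_open (ha : Tendsto a l atTop) (hφ : IsEvenRate φ)
    (h : HasTailRates l a ν φ) {G : Set ℝ} (hG : IsOpen G) (hne : G.Nonempty) :
    LogAsymp l a (fun i => (ν i).real G) (-sInf (φ '' G)) := by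
  intro ε hε
  have hbdd : BddBelow (φ '' G) := ⟨0, by rintro _ ⟨x, _, rfl⟩; exact hφ.nonneg x⟩
  obtain ⟨_, ⟨ξ, hξ, rfl⟩, hlt⟩ := exists_lt_of_csInf_lt (hne.image φ)
    (show sInf (φ '' G) < sInf (φ '' G) + ε / 2 by linarith)
  filter_upwards [h.lower_bound ha hφ hG hξ (half_pos hε),
    h.upper_bound ha hφ hne (fun x hx => csInf_le hbdd (mem_image_of_mem φ hx)) hε,
    ha.eventually_gt_atTop 0] with i h1 h2 hai
  refine ⟨le_trans ?_ h1, h2⟩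
  rw [Real.exp_le_exp]
  exact mul_le_mul_of_nonneg_left (by linarith) hai.le

/-- Varadhan's lemma for exponential integrals. -/
lemma HasTailRates.logAsymp_integral (ha : Tendsto a l atTop) (hφ : IsEvenRate φ)
    (h : HasTailRates l a ν φ) (hint : ∀ b i, Integrable (fun x => Real.exp (b * x)) (ν i))
    (hbound : ∀ b, ∃ C, ∀ᶠ i in l, ∫ x, Real.exp (b * a i * x) ∂(ν i) ≤ Real.exp (a i * C))
    {b M : ℝ} (hM : IsGreatest (range fun ξ => b * ξ - φ ξ) M) :
    LogAsymp l a (fun i => ∫ x, Real.exp (b * a i * x) ∂(ν i)) M := by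
  intro ε hε
  refine Eventually.and ?_ ?_
  -- Lower bound: only a small ball around a maximiser `ξ` is kept.
  · obtain ⟨ξ, hξ⟩ := hM.1
    obtain ⟨d, hd, hbd⟩ : ∃ d : ℝ, 0 < d ∧ |b| * d ≤ ε / 2 :=
      ⟨ε / (2 * (|b| + 1)), by positivity, by
        rw [mul_div_assoc', div_le_div_iff₀ (by positivity) two_pos]
        nlinarith [abs_nonneg b]⟩
    filter_upwards [h.lower_bound ha hφ Metric.isOpen_ball (Metric.mem_ball_self hd (x := ξ))
      (half_pos hε), ha.eventually_gt_atTop 0] with i hi hai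
    have h1 : ∫ x in Metric.ball ξ d, Real.exp (a i * (b * ξ - ε / 2)) ∂(ν i) ≤
        ∫ x, Real.exp (b * a i * x) ∂(ν i) := by
      refine (setIntegral_mono_on (by simp) (hint _ i).integrableOn Metric.isOpen_ball.measurableSet
        fun x hx => ?_).trans (setIntegral_le_integral (hint _ i)
          (ae_of_all _ fun x => (Real.exp_pos _).le))
      rw [Real.exp_le_exp]
      rw [Metric.mem_ball, Real.dist_eq] at hx
      have h2 : |b * (ξ - x)| ≤ |b| * d := by
        rw [abs_mul, abs_sub_comm]
        gcongr
      have h3 : b * ξ - ε / 2 ≤ b * x := by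
        linarith [le_abs_self (b * (ξ - x))]
      nlinarith
    rw [setIntegral_const, smul_eq_mul] at h1
    refine le_trans ?_ h1
    simp only at hξ
    have h2 := mul_le_mul_of_nonneg_right hi (Real.exp_pos (a i * (b * ξ - ε / 2))).le
    rw [← Real.exp_add] at h2
    refine le_trans (le_of_eq ?_) h2
    congr 1
    rw [← hξ]
    ring
  · obtain ⟨d, hd, hbd⟩ : ∃ d : ℝ, 0 < d ∧ |b| * d ≤ ε / 8 :=
      ⟨ε / (8 * (|b| + 1)), by positivity, by
        rw [mul_div_assoc', div_le_div_iff₀ (by positivity) (by norm_num)]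
        nlinarith [abs_nonneg b]⟩
    obtain ⟨C₁, hC₁⟩ := hbound (|b| + 1)
    obtain ⟨C₂, hC₂⟩ := hbound (-(|b| + 1))
    set C := max C₁ C₂
    -- Outside `[-R, R]` the integrand is bounded by the weights with exponents `±(|b| + 1)` times
    -- `e^(-a R)`, which contribute at most `e^(a (C - R)) = e^(a M)` each.
    set R := C - M
    obtain ⟨t, -, ht⟩ := (isCompact_Icc (a := -R) (b := R)).elim_nhds_subcover
      (fun x => Metric.ball x d) (fun x _ => Metric.ball_mem_nhds x hd)
    have hball : ∀ x ∈ t, ∀ᶠ i in l, (ν i).real (Metric.ball x d) ≤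
        Real.exp (a i * (M - b * x + ε / 8 + ε / 8)) := by
      intro x _
      have := h.upper_bound (G := Metric.ball x d) ha hφ ⟨x, Metric.mem_ball_self hd⟩
        (c := b * x - ε / 8 - M) (fun y hy => ?_) (show 0 < ε / 8 by linarith)
      · refine this.mono fun i hi => hi.trans (le_of_eq ?_)
        congr 1
        ring
      · have h1 : b * y - φ y ≤ M := hM.2 (mem_range_self y)
        rw [Metric.mem_ball, Real.dist_eq] at hy
        have h2 : |b * (x - y)| ≤ |b| * d := by
          rw [abs_mul, abs_sub_comm]
          gcongr
        linarith [le_abs_self (b * (x - y))]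
    filter_upwards [(Filter.eventually_all_finset t).mpr hball, hC₁, hC₂,
      eventually_const_mul_exp_le ha (t.card + 2) (half_pos hε), ha.eventually_gt_atTop 0]
      with i hi h1 h2 h3 hai
    -- Inside `[-R, R]` the exponential is nearly constant on each ball of a finite cover. The count
    -- `t.card + 2` is that of the balls and the two outer terms.
    have hpt : ∀ x, Real.exp (b * a i * x) ≤
        (∑ z ∈ t, (Metric.ball z d).indicator (fun _ => Real.exp (a i * (b * z + ε / 8))) x) +
        Real.exp (-(a i * R)) * (Real.exp ((|b| + 1) * a i * x) +
          Real.exp (-(|b| + 1) * a i * x)) := by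
      intro x
      have hs : 0 ≤ ∑ z ∈ t, (Metric.ball z d).indicator
          (fun _ => Real.exp (a i * (b * z + ε / 8))) x :=
        Finset.sum_nonneg fun z _ => indicator_nonneg (fun _ _ => (Real.exp_pos _).le) x
      by_cases hx : x ∈ Icc (-R) R
      · obtain ⟨z, hz, hxz⟩ := mem_iUnion₂.mp (ht hx)
        have h4 := Finset.single_le_sum (f := fun z => (Metric.ball z d).indicator
          (fun _ => Real.exp (a i * (b * z + ε / 8))) x)
          (fun z _ => indicator_nonneg (fun _ _ => (Real.exp_pos _).le) x) hz
        simp only [indicator_of_mem hxz] at h4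
        have h5 : Real.exp (b * a i * x) ≤ Real.exp (a i * (b * z + ε / 8)) := by
          rw [Real.exp_le_exp]
          rw [Metric.mem_ball, Real.dist_eq] at hxz
          have h6 : |b * (x - z)| ≤ |b| * d := by
            rw [abs_mul]
            gcongr
          have h7 : b * x ≤ b * z + ε / 8 := by
            linarith [le_abs_self (b * (x - z))]
          nlinarith
        have h6 : 0 ≤ Real.exp (-(a i * R)) * (Real.exp ((|b| + 1) * a i * x) +
          Real.exp (-(|b| + 1) * a i * x)) := by positivity
        linarith
      · have h4 : R ≤ |x| := by
          by_contra! hlt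
          exact hx (abs_le.mp hlt.le)
        have h5 : Real.exp (b * a i * x) ≤ Real.exp (-(a i * R)) *
            Real.exp ((|b| + 1) * a i * |x|) := by
          rw [← Real.exp_add, Real.exp_le_exp]
          have h6 : b * x ≤ |b| * |x| := by
            rw [← abs_mul]
            exact le_abs_self _
          have h7 : b * x ≤ -R + (|b| + 1) * |x| := by linarith
          have := mul_le_mul_of_nonneg_left h7 hai.le
          linarith
        have h6 : Real.exp ((|b| + 1) * a i * |x|) ≤ Real.exp ((|b| + 1) * a i * x) +
            Real.exp (-(|b| + 1) * a i * x) := by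
          rcases abs_choice x with hc | hc
          · rw [hc]
            linarith [Real.exp_pos (-(|b| + 1) * a i * x)]
          · rw [hc, show (|b| + 1) * a i * -x = -(|b| + 1) * a i * x by ring]
            linarith [Real.exp_pos ((|b| + 1) * a i * x)]
        have h7 := mul_le_mul_of_nonneg_left h6 (Real.exp_pos (-(a i * R))).le
        linarith
    have iind : ∀ z ∈ t, Integrable ((Metric.ball z d).indicator
        (fun _ => Real.exp (a i * (b * z + ε / 8)))) (ν i) := fun z _ =>
      (integrable_const _).indicator Metric.isOpen_ball.measurableSet
    have isum : Integrable (fun x => ∑ z ∈ t, (Metric.ball z d).indicator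
        (fun _ => Real.exp (a i * (b * z + ε / 8))) x) (ν i) := integrable_finsetSum t iind
    have iadd : Integrable (fun x => Real.exp ((|b| + 1) * a i * x) +
          Real.exp (-(|b| + 1) * a i * x)) (ν i) := (hint _ i).add (hint _ i)
    have hI := integral_mono (hint _ i) (isum.add (iadd.const_mul _)) hpt
    refine hI.trans ?_
    have e1 : ∫ x, ((fun x => ∑ z ∈ t, (Metric.ball z d).indicator
        (fun _ => Real.exp (a i * (b * z + ε / 8))) x) + fun x => Real.exp (-(a i * R)) *
        (Real.exp ((|b| + 1) * a i * x) + Real.exp (-(|b| + 1) * a i * x))) x ∂(ν i) =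
        (∑ z ∈ t, (ν i).real (Metric.ball z d) * Real.exp (a i * (b * z + ε / 8))) +
        Real.exp (-(a i * R)) * (∫ x, Real.exp ((|b| + 1) * a i * x) ∂(ν i) +
          ∫ x, Real.exp (-(|b| + 1) * a i * x) ∂(ν i)) := by
      simp only [Pi.add_apply]
      rw [integral_add isum (iadd.const_mul _), integral_finsetSum t iind, integral_const_mul,
        integral_add (hint _ i) (hint _ i)]
      congr 1
      refine Finset.sum_congr rfl fun z _ => ?_
      rw [integral_indicator Metric.isOpen_ball.measurableSet, setIntegral_const, smul_eq_mul]
    rw [e1]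
    have hsum : ∑ z ∈ t, (ν i).real (Metric.ball z d) * Real.exp (a i * (b * z + ε / 8)) ≤
        t.card * Real.exp (a i * (M + ε / 2)) := by
      rw [← nsmul_eq_mul]
      refine Finset.sum_le_card_nsmul _ _ _ fun z hz => ?_
      refine (mul_le_mul_of_nonneg_right (hi z hz) (Real.exp_pos _).le).trans ?_
      rw [← Real.exp_add, Real.exp_le_exp, ← mul_add]
      exact mul_le_mul_of_nonneg_left (by linarith) hai.le
    have hCexp : ∀ c, c ≤ C → Real.exp (-(a i * R)) * Real.exp (a i * c) ≤
        Real.exp (a i * (M + ε / 2)) := by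
      intro c hc
      rw [← Real.exp_add, Real.exp_le_exp]
      have : a i * (-R + c) ≤ a i * (M + ε / 2) :=
        mul_le_mul_of_nonneg_left (by simp only [R]; linarith) hai.le
      linarith
    have t1 := hCexp C₁ (le_max_left _ _)
    have t2 := hCexp C₂ (le_max_right _ _)
    have t3 := mul_le_mul_of_nonneg_left (add_le_add h1 h2) (Real.exp_pos (-(a i * R))).le
    have h4 := h3 (M + ε / 2)
    rw [add_assoc, add_halves] at h4
    have h5 : ((t.card : ℝ) + 2) * Real.exp (a i * (M + ε / 2)) =
      t.card * Real.exp (a i * (M + ε / 2)) + 2 * Real.exp (a i * (M + ε / 2)) := by ring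
    linarith

end Varadhan

/-! ### Exponential moments of infinite sums of independent variables -/

section InfiniteSum

variable {Ω ι : Type*} [MeasurableSpace Ω] {P : Measure Ω}
  {U : ι → Ω → ℝ}

/-- A family of independent variables in `[-1, 1]` of which almost surely only finitely many do
not vanish. -/
structure IsIndepSummable (P : Measure Ω) (U : ι → Ω → ℝ) : Prop where
  measurable : ∀ k, Measurable (U k)
  indep : iIndepFun U P
  abs_le_one : ∀ k ω, |U k ω| ≤ 1
  summable : Summable fun k => P.real {ω | U k ω ≠ 0}

lemma IsIndepSummable.measurableSet_ne_zero (h : IsIndepSummable P U) (k : ι) :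
    MeasurableSet {ω | U k ω ≠ 0} := (h.measurable k) (measurableSet_singleton 0).compl

variable [IsProbabilityMeasure P]

lemma IsIndepSummable.ae_finite [Countable ι] (h : IsIndepSummable P U) :
    ∀ᵐ ω ∂P, {k | U k ω ≠ 0}.Finite := by
  refine ae_finite_setOfPred_mem (s := fun k => {ω | U k ω ≠ 0}) ?_
  simpa [ofReal_measureReal] using h.summable.tsum_ofReal_ne_top

lemma hasSum_of_finite_support {ι : Type*} {f : ι → ℝ} (h : {k | f k ≠ 0}.Finite) :
    HasSum f (∑' k, f k) :=
  (summable_of_ne_finset_zero (s := h.toFinset) fun k hk => by simpa using hk).hasSum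

/-- Pointwise, the exponential is at most `1 + (e^R - 1)` times the indicator of `U k ≠ 0`; then `1
+ u ≤ e^u` prepares the product over `k`. -/
lemma IsIndepSummable.integral_exp_abs_le (h : IsIndepSummable P U) {R : ℝ} (hR : 0 ≤ R) (k : ι) :
    Integrable (fun ω => Real.exp (R * |U k ω|)) P ∧
    ∫ ω, Real.exp (R * |U k ω|) ∂P ≤
      Real.exp ((Real.exp R - 1) * P.real {ω | U k ω ≠ 0}) := by
  have hR1 : 1 ≤ Real.exp R := Real.one_le_exp hR
  have hint : Integrable (fun ω => Real.exp (R * |U k ω|)) P := by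
    refine Integrable.of_bound (C := Real.exp R) ?_ (ae_of_all _ fun ω => ?_)
    · have := h.measurable k
      fun_prop
    · rw [Real.norm_of_nonneg (Real.exp_pos _).le, Real.exp_le_exp]
      exact mul_le_of_le_one_right hR (h.abs_le_one k ω)
  refine ⟨hint, ?_⟩
  have hind := (integrable_const (μ := P) (Real.exp R - 1)).indicator (h.measurableSet_ne_zero k)
  have h1 : ∫ ω, Real.exp (R * |U k ω|) ∂P ≤
      ∫ ω, (1 + {ω | U k ω ≠ 0}.indicator (fun _ => Real.exp R - 1) ω) ∂P := by
    refine integral_mono hint ((integrable_const 1).add hind) fun ω => ?_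
    by_cases hω : U k ω = 0
    · simp [hω]
    · rw [indicator_of_mem (by exact hω)]
      have : Real.exp (R * |U k ω|) ≤ Real.exp R := by
        rw [Real.exp_le_exp]
        exact mul_le_of_le_one_right hR (h.abs_le_one k ω)
      linarith
  rw [integral_add (integrable_const 1) hind, integral_indicator (h.measurableSet_ne_zero k),
    setIntegral_const] at h1
  simp only [integral_const, probReal_univ, smul_eq_mul, one_mul] at h1
  refine h1.trans ?_
  rw [add_comm, mul_comm]
  exact Real.add_one_le_exp _

/-- For finite sums independence gives a product bounded uniformly in the finite set, and Fatou's
lemma passes to the series. The result is the dominating function for all later limits of finite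
products. -/
lemma IsIndepSummable.integrable_exp_tsum_abs [Countable ι] (h : IsIndepSummable P U) {R : ℝ}
    (hR : 0 ≤ R) : Integrable (fun ω => Real.exp (R * ∑' k, |U k ω|)) P ∧
      ∫ ω, Real.exp (R * ∑' k, |U k ω|) ∂P ≤
        Real.exp ((Real.exp R - 1) * ∑' k, P.real {ω | U k ω ≠ 0}) := by
  have hmeas : ∀ k, Measurable fun ω => |U k ω| := fun k => by
    have := h.measurable k
    fun_prop
  have hind : iIndepFun (fun k ω => |U k ω|) P := h.indep.comp (fun _ x => |x|) fun _ => by fun_prop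
  have hR1 : 0 ≤ Real.exp R - 1 := by linarith [Real.one_le_exp hR]
  have hlim : ∀ᵐ ω ∂P, Tendsto (fun s : Finset ι => Real.exp (R * ∑ k ∈ s, |U k ω|)) atTop
      (𝓝 (Real.exp (R * ∑' k, |U k ω|))) := by
    filter_upwards [h.ae_finite] with ω hω
    have h2 : HasSum (fun k => |U k ω|) (∑' k, |U k ω|) :=
      hasSum_of_finite_support (by simpa using hω)
    exact (Real.continuous_exp.tendsto _).comp (h2.const_mul R)
  have hae : AEMeasurable (fun ω => Real.exp (R * ∑' k, |U k ω|)) P :=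
    aemeasurable_of_tendsto_metrizable_ae atTop
      (fun s => Measurable.aemeasurable (by fun_prop)) hlim
  have hbd : ∀ s : Finset ι, ∫⁻ ω, ENNReal.ofReal (Real.exp (R * ∑ k ∈ s, |U k ω|)) ∂P ≤
      ENNReal.ofReal (Real.exp ((Real.exp R - 1) * ∑' k, P.real {ω | U k ω ≠ 0})) := by
    intro s
    have hi := hind.integrable_exp_mul_sum hmeas (s := s) (t := R)
      fun k _ => (h.integral_exp_abs_le hR k).1
    have hm := hind.mgf_sum hmeas s (t := R)
    simp only [mgf, Finset.sum_apply] at hm hi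
    rw [← ofReal_integral_eq_lintegral_ofReal hi (ae_of_all _ fun ω => (Real.exp_pos _).le), hm]
    refine ENNReal.ofReal_le_ofReal ?_
    calc ∏ k ∈ s, ∫ ω, Real.exp (R * |U k ω|) ∂P
        ≤ ∏ k ∈ s, Real.exp ((Real.exp R - 1) * P.real {ω | U k ω ≠ 0}) :=
          Finset.prod_le_prod (fun k _ => integral_nonneg fun ω => (Real.exp_pos _).le)
            fun k _ => (h.integral_exp_abs_le hR k).2
      _ = Real.exp ((Real.exp R - 1) * ∑ k ∈ s, P.real {ω | U k ω ≠ 0}) := by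
          rw [← Real.exp_sum, Finset.mul_sum]
      _ ≤ _ := by
          rw [Real.exp_le_exp]
          exact mul_le_mul_of_nonneg_left
            (h.summable.sum_le_tsum s fun k _ => measureReal_nonneg) hR1
  have hfatou : ∫⁻ ω, ENNReal.ofReal (Real.exp (R * ∑' k, |U k ω|)) ∂P ≤
      ENNReal.ofReal (Real.exp ((Real.exp R - 1) * ∑' k, P.real {ω | U k ω ≠ 0})) := by
    calc ∫⁻ ω, ENNReal.ofReal (Real.exp (R * ∑' k, |U k ω|)) ∂P
        = ∫⁻ ω, liminf (fun s : Finset ι =>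
            ENNReal.ofReal (Real.exp (R * ∑ k ∈ s, |U k ω|))) atTop ∂P := by
          refine lintegral_congr_ae ?_
          filter_upwards [hlim] with ω hω
          exact ((ENNReal.continuous_ofReal.tendsto _).comp hω).liminf_eq.symm
      _ ≤ liminf (fun s : Finset ι =>
            ∫⁻ ω, ENNReal.ofReal (Real.exp (R * ∑ k ∈ s, |U k ω|)) ∂P) atTop :=
          lintegral_liminf_le fun s => by fun_prop
      _ ≤ _ := by
          refine (liminf_le_liminf (Eventually.of_forall hbd)).trans ?_
          simp
  have hint : Integrable (fun ω => Real.exp (R * ∑' k, |U k ω|)) P := by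
    refine ⟨hae.aestronglyMeasurable, ?_⟩
    rw [hasFiniteIntegral_iff_ofReal (ae_of_all _ fun ω => (Real.exp_pos _).le)]
    exact hfatou.trans_lt ENNReal.ofReal_lt_top
  refine ⟨hint, ?_⟩
  rw [← ofReal_integral_eq_lintegral_ofReal hint (ae_of_all _ fun ω => (Real.exp_pos _).le),
    ENNReal.ofReal_le_ofReal_iff (Real.exp_pos _).le] at hfatou
  exact hfatou

lemma IsIndepSummable.aemeasurable_tsum [Countable ι] (h : IsIndepSummable P U) :
    AEMeasurable (fun ω => ∑' k, U k ω) P := by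
  refine aemeasurable_of_tendsto_metrizable_ae (atTop : Filter (Finset ι))
    (f := fun s ω => ∑ k ∈ s, U k ω) (fun s => ?_) ?_
  · have := h.measurable
    exact Measurable.aemeasurable (by fun_prop)
  · filter_upwards [h.ae_finite] with ω hω using hasSum_of_finite_support hω

lemma IsIndepSummable.integrable_exp_tsum [Countable ι] (h : IsIndepSummable P U) (B : ℝ) :
    Integrable (fun ω => Real.exp (B * ∑' k, U k ω)) P := by
  refine Integrable.mono' (h.integrable_exp_tsum_abs (abs_nonneg B)).1
    (h.aemeasurable_tsum.const_mul B).exp.aestronglyMeasurable ?_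
  filter_upwards [h.ae_finite] with ω hω
  rw [Real.norm_of_nonneg (Real.exp_pos _).le, Real.exp_le_exp]
  have h2 : Summable fun k => |U k ω| := (hasSum_of_finite_support (by simpa using hω)).summable
  calc B * ∑' k, U k ω ≤ |B * ∑' k, U k ω| := le_abs_self _
    _ = |B| * |∑' k, U k ω| := abs_mul _ _
    _ ≤ |B| * ∑' k, |U k ω| := by
      gcongr
      exact norm_tsum_le_tsum_norm (f := fun k => U k ω) h2

/-- The exponential moments factorise. -/
lemma IsIndepSummable.tendsto_prod_integral_cexp [Countable ι] (h : IsIndepSummable P U) (z : ℂ) :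
    Tendsto (fun s : Finset ι => ∏ k ∈ s, ∫ ω, Complex.exp (z * U k ω) ∂P) atTop
      (𝓝 (∫ ω, Complex.exp (z * (∑' k, U k ω : ℝ)) ∂P)) := by
  have hprod : ∀ s : Finset ι, ∏ k ∈ s, ∫ ω, Complex.exp (z * U k ω) ∂P =
      ∫ ω, Complex.exp (z * (∑ k ∈ s, U k ω : ℝ)) ∂P := by
    intro s
    have hi : iIndepFun (fun (k : s) ω => U k ω) P := h.indep.precomp Subtype.val_injective
    have := hi.integral_fun_prod_comp (𝓧 := fun _ => ℝ) (X := fun (k : s) ω => U k ω) (𝕜 := ℂ)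
      (f := fun _ x => Complex.exp (z * (x : ℂ)))
      (fun k => (h.measurable k.1).aemeasurable)
      (fun k => Measurable.aestronglyMeasurable (by fun_prop))
    rw [Finset.prod_coe_sort s (fun k => ∫ ω, Complex.exp (z * U k ω) ∂P)] at this
    rw [← this]
    refine integral_congr_ae (ae_of_all _ fun ω => ?_)
    simp only
    rw [Finset.prod_coe_sort s (fun k => Complex.exp (z * U k ω)), ← Complex.exp_sum,
      Complex.ofReal_sum, Finset.mul_sum]
  simp_rw [hprod]
  refine tendsto_integral_filter_of_dominated_convergence
    (fun ω => Real.exp (‖z‖ * ∑' k, |U k ω|)) (Eventually.of_forall fun s => ?_)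
    (Eventually.of_forall fun s => ?_) (h.integrable_exp_tsum_abs (norm_nonneg z)).1 ?_
  · have := h.measurable
    exact Measurable.aestronglyMeasurable (by fun_prop)
  · filter_upwards [h.ae_finite] with ω hω
    have h2 : Summable fun k => |U k ω| := (hasSum_of_finite_support (by simpa using hω)).summable
    refine (Complex.norm_exp_le_exp_norm _).trans ?_
    rw [Real.exp_le_exp, norm_mul, Complex.norm_real]
    gcongr
    exact (norm_sum_le _ _).trans (h2.sum_le_tsum s fun k _ => abs_nonneg _)
  · filter_upwards [h.ae_finite] with ω hω
    have h2 := hasSum_of_finite_support hω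
    have h3 : Tendsto (fun s : Finset ι => ∑ k ∈ s, U k ω) atTop (𝓝 (∑' k, U k ω)) := h2
    have hc : Continuous fun x : ℝ => Complex.exp (z * x) := by fun_prop
    exact (hc.tendsto _).comp h3

/-- A complex exponential moment as the exponential of a series. -/
lemma IsIndepSummable.integral_cexp_tsum [Countable ι] (h : IsIndepSummable P U) {z : ℂ}
    {L : ι → ℂ} (hL : ∀ k, ∫ ω, Complex.exp (z * U k ω) ∂P = Complex.exp (L k))
    (hsum : Summable L) :
    ∫ ω, Complex.exp (z * (∑' k, U k ω : ℝ)) ∂P = Complex.exp (∑' k, L k) := by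
  refine tendsto_nhds_unique (h.tendsto_prod_integral_cexp z) ?_
  simp_rw [hL, ← Complex.exp_sum]
  exact (Complex.continuous_exp.tendsto _).comp hsum.hasSum

/-- A real exponential moment as the exponential of a series. -/
lemma IsIndepSummable.integral_exp_tsum [Countable ι] (h : IsIndepSummable P U) {B : ℝ}
    {L : ι → ℝ} (hL : ∀ k, ∫ ω, Real.exp (B * U k ω) ∂P = Real.exp (L k))
    (hsum : Summable L) :
    ∫ ω, Real.exp (B * ∑' k, U k ω) ∂P = Real.exp (∑' k, L k) := by
  have h1 := h.integral_cexp_tsum (z := B) (L := fun k => (L k : ℂ)) (fun k => by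
    rw [← Complex.ofReal_exp, ← hL, ← integral_complex_ofReal]
    simp) (Complex.ofRealCLM.summable hsum)
  rw [← Complex.ofReal_tsum, ← Complex.ofReal_exp] at h1
  rw [← Complex.ofReal_inj, ← h1, ← integral_complex_ofReal]
  simp

end InfiniteSum

/-! ### Sums over the integers as integrals -/

/-- Turns sums over labels into integrals over the line, so that Riemann sums can be treated by
rescaling the variable and dominated convergence. -/
lemma measurePreserving_ceil :
    MeasurePreserving (Int.ceil : ℝ → ℤ) volume Measure.count := by
  refine ⟨Int.measurable_ceil, Measure.ext_of_singleton fun k => ?_⟩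
  rw [Measure.map_apply Int.measurable_ceil (measurableSet_singleton k), Int.preimage_ceil_singleton,
    Measure.count_singleton, Real.volume_Ioc]
  simp

lemma summable_iff_integrable_ceil {F : ℤ → ℝ} :
    Summable F ↔ Integrable fun u : ℝ => F ⌈u⌉ := by
  rw [← summable_norm_iff, ← integrable_count_iff, ← measurePreserving_ceil.map_eq]
  exact integrable_map_measure (measurable_of_countable F).aestronglyMeasurable
    Int.measurable_ceil.aemeasurable

lemma tsum_eq_integral_ceil {F : ℤ → ℝ} (hF : Summable F) :
    ∑' k, F k = ∫ u : ℝ, F ⌈u⌉ := by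
  have h := integral_map (μ := volume) (φ := (Int.ceil : ℝ → ℤ)) Int.measurable_ceil.aemeasurable
    (f := F) (measurable_of_countable F).aestronglyMeasurable
  have h2 := integral_countable (integrable_count_iff.mpr (summable_norm_iff.mpr hF))
  simp only [measureReal_def, Measure.count_singleton, ENNReal.toReal_one, one_smul] at h2
  rw [← h2, ← measurePreserving_ceil.map_eq, h]

lemma integrable_exp_neg_abs {c : ℝ} (hc : 0 < c) (a : ℝ) :
    Integrable fun u : ℝ => Real.exp (-(c * |u - a|)) := by
  have h : Integrable fun u : ℝ => Real.exp (-(c * |u|)) := by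
    have := (integrableOn_Ioi_comp_mul_left_iff (fun x => Real.exp (-x)) 0 hc).mpr
      (by simpa using exp_neg_integrableOn_Ioi 0 one_pos)
    rw [← integrableOn_univ, ← Iic_union_Ioi (a := (0 : ℝ)), integrableOn_union]
    constructor
    · rw [← integrableOn_Ici_iff_integrableOn_Ioi] at this
      have h2 := this.comp_neg
      simp only [neg_Ici, neg_zero] at h2
      refine h2.congr_fun (fun u hu => ?_) measurableSet_Iic
      simp only [abs_of_nonpos (mem_Iic.mp hu)]
    · refine this.congr_fun (fun u hu => ?_) measurableSet_Ioi
      simp only [abs_of_pos (mem_Ioi.mp hu)]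
  exact h.comp_sub_right a

lemma integral_exp_neg_abs {c : ℝ} (hc : 0 < c) (a : ℝ) :
    ∫ u : ℝ, Real.exp (-(c * |u - a|)) = 2 / c := by
  rw [integral_sub_right_eq_self (fun u => Real.exp (-(c * |u|))) a,
    integral_comp_abs (f := fun u => Real.exp (-(c * u)))]
  have := integral_comp_mul_left_Ioi (fun x => Real.exp (-x)) 0 hc
  rw [mul_zero, integral_exp_neg_Ioi_zero] at this
  rw [this, smul_eq_mul]
  ring

lemma exp_neg_abs_ceil_le {c : ℝ} (hc : 0 ≤ c) (a u : ℝ) :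
    Real.exp (-(c * |(⌈u⌉ : ℝ) - a|)) ≤ Real.exp c * Real.exp (-(c * |u - a|)) := by
  rw [← Real.exp_add, Real.exp_le_exp]
  have h1 : |u - a| ≤ |(⌈u⌉ : ℝ) - a| + 1 := by
    have h2 : |u - ⌈u⌉| ≤ 1 := by
      rw [abs_le]
      constructor <;> linarith [Int.ceil_lt_add_one u, Int.le_ceil u]
    calc |u - a| = |((⌈u⌉ : ℝ) - a) + (u - ⌈u⌉)| := by ring_nf
      _ ≤ _ := (abs_add_le _ _).trans (by linarith)
  nlinarith

lemma summable_exp_neg_abs {c : ℝ} (hc : 0 < c) (a : ℝ) :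
    Summable fun k : ℤ => Real.exp (-(c * |(k : ℝ) - a|)) := by
  rw [summable_iff_integrable_ceil]
  refine Integrable.mono' ((integrable_exp_neg_abs hc a).const_mul (Real.exp c)) ?_
    (ae_of_all _ fun u => ?_)
  · exact Measurable.aestronglyMeasurable (by fun_prop)
  · rw [Real.norm_of_nonneg (Real.exp_pos _).le]
    exact exp_neg_abs_ceil_le hc.le a u

lemma tsum_exp_neg_abs_le {c : ℝ} (hc : 0 < c) (a : ℝ) :
    ∑' k : ℤ, Real.exp (-(c * |(k : ℝ) - a|)) ≤ Real.exp c * (2 / c) := by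
  have hs := summable_exp_neg_abs hc a
  rw [tsum_eq_integral_ceil hs, ← integral_exp_neg_abs hc a, ← integral_const_mul]
  exact integral_mono (summable_iff_integrable_ceil.mp hs)
    ((integrable_exp_neg_abs hc a).const_mul _) fun u => exp_neg_abs_ceil_le hc.le a u

/-! ### Free particles and their crossings -/

section Crossings

variable {Ω : Type*} [MeasurableSpace Ω] {P : Measure Ω}

/-- The displacements of free particles after some time, with the scale `s = σ √t`. -/
structure IsFreeNoise (P : Measure Ω) (s : ℝ) (V : ℤ → Ω → ℝ) : Prop where
  measurable : ∀ k, Measurable (V k)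
  indep : iIndepFun V P
  tail : ∀ k a, P.real {ω | a < V k ω} = tailProb (a / s)

lemma IsFreeNoise.compl_tail [IsProbabilityMeasure P] {s : ℝ} {V : ℤ → Ω → ℝ}
    (hV : IsFreeNoise P s V) (k : ℤ) (a : ℝ) : P.real {ω | V k ω ≤ a} = tailProb (-a / s) := by
  have h : {ω | V k ω ≤ a} = {ω | a < V k ω}ᶜ := by
    ext ω
    simp
  rw [h, probReal_compl_eq_one_sub (measurableSet_lt measurable_const (hV.measurable k)), hV.tail,
    neg_div, tailProb_neg]

lemma gaussianReal_real_Ioi {v : ℝ≥0} (hv : v ≠ 0) (a : ℝ) :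
    (gaussianReal 0 v).real (Ioi a) = tailProb (a / √(2 * v)) := by
  have hv0 : (0 : ℝ) < v := by positivity
  have hc : 0 < √(2 * (v : ℝ)) := by positivity
  rw [Measure.real, gaussianReal_apply_eq_integral _ hv, ENNReal.toReal_ofReal
    (integral_nonneg fun x => gaussianPDFReal_nonneg _ _ _), tailProb, erfc]
  have h := integral_comp_mul_left_Ioi (gaussianPDFReal 0 v) (a / √(2 * v)) hc
  rw [mul_div_cancel₀ _ hc.ne', smul_eq_mul, eq_inv_mul_iff_mul_eq₀ hc.ne'] at h
  rw [← h, ← integral_const_mul, ← integral_const_mul, ← integral_div]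
  refine integral_congr_ae (ae_of_all _ fun u => ?_)
  have hsq : √(2 * (v : ℝ)) ^ 2 = 2 * v := Real.sq_sqrt (by positivity)
  simp only [gaussianPDFReal, sub_zero]
  rw [mul_pow, hsq, show -(2 * (v : ℝ) * u ^ 2) / (2 * v) = -u ^ 2 by field_simp,
    show (2 : ℝ) * Real.pi * v = Real.pi * (2 * v) by ring, Real.sqrt_mul Real.pi_pos.le]
  have := sqrt_pi_pos
  field_simp

/-- The contribution of particle `k` to the flow through `x`, for the configuration `z`. -/
def crossing (z : ℤ → ℝ) (x : ℝ) (k : ℤ) : ℝ :=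
  if 1 ≤ k then (if z k ≤ x then 1 else 0) else if x < z k then -1 else 0

/-- The probability that particle `k` contributes to the flow through `x`. -/
def crossProb (y : ℤ → ℝ) (s x : ℝ) (k : ℤ) : ℝ :=
  if 1 ≤ k then tailProb ((y k - x) / s) else tailProb ((x - y k) / s)

/-- `ln (1 + p (e^B - 1))` with `p = tailProb η`. -/
def bernoulliCGF (B η : ℝ) : ℝ := Real.log (1 + tailProb η * (Real.exp B - 1))

/-- The contribution of particle `k` to the cumulant generating function of the flow. -/
def crossingCGF (y : ℤ → ℝ) (s x B : ℝ) (k : ℤ) : ℝ :=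
  if 1 ≤ k then bernoulliCGF B ((y k - x) / s) else bernoulliCGF (-B) ((x - y k) / s)

lemma bernoulliCGF_arg_pos (B η : ℝ) : 0 < 1 + tailProb η * (Real.exp B - 1) := by
  nlinarith [tailProb_pos η, tailProb_lt_one η, Real.exp_pos B, mul_pos (tailProb_pos η)
    (Real.exp_pos B)]

lemma exp_bernoulliCGF (B η : ℝ) :
    Real.exp (bernoulliCGF B η) = 1 + tailProb η * (Real.exp B - 1) :=
  Real.exp_log (bernoulliCGF_arg_pos B η)

/-- Particle–hole symmetry: `-η` exchanges `p` with `1 - p`, and `1 + (1 - p) (e^(-B) - 1) = e^(-B)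
(1 + p (e^B - 1))`. -/
lemma bernoulliCGF_neg (B η : ℝ) : bernoulliCGF (-B) (-η) = bernoulliCGF B η - B := by
  apply Real.exp_injective
  rw [Real.exp_sub, exp_bernoulliCGF, exp_bernoulliCGF, tailProb_neg, Real.exp_neg]
  field_simp
  ring

lemma bernoulliCGF_le (B η : ℝ) : bernoulliCGF B η ≤ tailProb η * (Real.exp B - 1) := by
  have := Real.log_le_sub_one_of_pos (bernoulliCGF_arg_pos B η)
  unfold bernoulliCGF
  linarith

/-- Both sides come from `1 - 1 / u ≤ ln u ≤ u - 1`. Being linear in the crossing probability, the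
bound reduces summability to that of the probabilities. -/
lemma abs_bernoulliCGF_le (B η : ℝ) : |bernoulliCGF B η| ≤ Real.exp |B| * tailProb η := by
  have hp := tailProb_pos η
  have hp1 := tailProb_lt_one η
  rw [abs_le]
  constructor
  · have h1 := bernoulliCGF_arg_pos B η
    have h2 := Real.one_sub_inv_le_log_of_pos h1
    refine le_trans ?_ h2
    rcases le_total 0 B with hB | hB
    · have h3 : 1 ≤ Real.exp B := Real.one_le_exp hB
      have h4 : (1 + tailProb η * (Real.exp B - 1))⁻¹ ≤ 1 :=
        inv_le_one_of_one_le₀ (by nlinarith)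
      nlinarith [mul_pos (Real.exp_pos |B|) hp]
    · rw [abs_of_nonpos hB]
      have h3 : Real.exp B ≤ 1 := Real.exp_le_one_iff.mpr hB
      have h4 : Real.exp B ≤ 1 + tailProb η * (Real.exp B - 1) := by nlinarith
      have h5 : (1 + tailProb η * (Real.exp B - 1))⁻¹ ≤ 1 + Real.exp (-B) * tailProb η := by
        rw [inv_le_iff_one_le_mul₀ h1]
        have e : Real.exp (-B) * Real.exp B = 1 := by rw [← Real.exp_add]; simp
        have h6 := mul_le_mul_of_nonneg_left h4 (mul_pos (Real.exp_pos (-B)) hp).le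
        have h7 : Real.exp (-B) * tailProb η * Real.exp B = tailProb η := by
          rw [mul_right_comm, e, one_mul]
        nlinarith [mul_pos hp (Real.exp_pos B)]
      linarith
  · refine (bernoulliCGF_le B η).trans ?_
    rw [mul_comm]
    refine mul_le_mul_of_nonneg_right ?_ hp.le
    linarith [Real.exp_le_exp.mpr (le_abs_self B)]

lemma continuous_bernoulliCGF (B : ℝ) : Continuous (bernoulliCGF B) := by
  have := continuous_tailProb
  exact Continuous.log (by fun_prop) fun η => (bernoulliCGF_arg_pos B η).ne'

lemma abs_crossingCGF_le (y : ℤ → ℝ) (s x B : ℝ) (k : ℤ) :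
    |crossingCGF y s x B k| ≤ Real.exp |B| * crossProb y s x k := by
  unfold crossingCGF crossProb
  split_ifs
  · exact abs_bernoulliCGF_le _ _
  · rw [← abs_neg B]
    exact abs_bernoulliCGF_le _ _

lemma crossProb_pos (y : ℤ → ℝ) (s x : ℝ) (k : ℤ) : 0 < crossProb y s x k := by
  unfold crossProb
  split_ifs <;> exact tailProb_pos _

variable {ρ K s : ℝ} {y : ℤ → ℝ}

/-- The particle `k` is within `|k| / (2ρ) + K` of `k / ρ`. -/
def IsNearUniform (ρ K : ℝ) (y : ℤ → ℝ) : Prop :=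
  ∀ k : ℤ, |y k - k / ρ| ≤ |(k : ℝ)| / (2 * ρ) + K

/-- To cross `x`, particle `k` has to travel at least `|k| / (2 ρ) - K - |x|`, so the exponential
tail bound decays geometrically in `|k|`. -/
lemma IsNearUniform.crossProb_le (hρ : 0 < ρ) (hs : 0 < s) (hy : IsNearUniform ρ K y)
    (x : ℝ) (k : ℤ) : crossProb y s x k ≤
      2 * Real.exp ((K + |x|) / s) * Real.exp (-(1 / (2 * ρ * s) * |(k : ℝ) - 0|)) := by
  have key : ∀ η, (|(k : ℝ)| / (2 * ρ) - K - |x|) / s ≤ η → tailProb η ≤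
      2 * Real.exp ((K + |x|) / s) * Real.exp (-(1 / (2 * ρ * s) * |(k : ℝ) - 0|)) := by
    intro η hη
    refine (tailProb_le_exp η).trans ?_
    rw [mul_assoc, ← Real.exp_add]
    gcongr
    rw [sub_zero]
    have : (|(k : ℝ)| / (2 * ρ) - K - |x|) / s =
        -((K + |x|) / s + -(1 / (2 * ρ * s) * |(k : ℝ)|)) := by
      field_simp
      ring
    linarith
  have hb := abs_le.mp (hy k)
  have hx := abs_le.mp (le_refl |x|)
  have h2 : (k : ℝ) / ρ = 2 * (k / (2 * ρ)) := by field_simp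
  unfold crossProb
  split_ifs with hk
  · apply key
    have hk0 : (0 : ℝ) < k := by exact_mod_cast hk
    rw [abs_of_pos hk0] at hb ⊢
    refine div_le_div_of_nonneg_right ?_ hs.le
    linarith [hb.1, hx.2]
  · apply key
    have hk0 : (k : ℝ) ≤ 0 := by exact_mod_cast (by omega : k ≤ 0)
    rw [abs_of_nonpos hk0] at hb ⊢
    refine div_le_div_of_nonneg_right ?_ hs.le
    have : -(k : ℝ) / (2 * ρ) = -(k / (2 * ρ)) := neg_div _ _
    linarith [hb.2, hx.1]

lemma IsNearUniform.summable_crossProb (hρ : 0 < ρ) (hs : 0 < s) (hy : IsNearUniform ρ K y)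
    (x : ℝ) : Summable (crossProb y s x) :=
  Summable.of_nonneg_of_le (fun k => (crossProb_pos y s x k).le) (hy.crossProb_le hρ hs x)
    ((summable_exp_neg_abs (by positivity) 0).mul_left _)

lemma IsNearUniform.summable_crossingCGF (hρ : 0 < ρ) (hs : 0 < s) (hy : IsNearUniform ρ K y)
    (x B : ℝ) : Summable (crossingCGF y s x B) :=
  Summable.of_norm_bounded ((hy.summable_crossProb hρ hs x).mul_left (Real.exp |B|))
    (abs_crossingCGF_le y s x B)

lemma measurable_crossing {z : ℤ → Ω → ℝ} {k : ℤ} (hz : Measurable (z k)) (x : ℝ) :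
    Measurable fun ω => crossing (fun k => z k ω) x k := by
  unfold crossing
  split_ifs
  · exact Measurable.ite (measurableSet_le hz measurable_const) measurable_const measurable_const
  · exact Measurable.ite (measurableSet_lt measurable_const hz) measurable_const measurable_const

variable [IsProbabilityMeasure P] {V : ℤ → Ω → ℝ}

lemma IsFreeNoise.prob_crossing (hV : IsFreeNoise P s V) (y : ℤ → ℝ) (x : ℝ) (k : ℤ) :
    P.real {ω | crossing (fun k => y k + V k ω) x k ≠ 0} = crossProb y s x k := by
  unfold crossProb
  split_ifs with hk
  · have : {ω | crossing (fun k => y k + V k ω) x k ≠ 0} = {ω | V k ω ≤ x - y k} := by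
      ext ω
      simp only [crossing, if_pos hk, mem_ofPred_eq]
      split_ifs with h <;> simp <;> linarith
    rw [this, hV.compl_tail, neg_sub]
  · have : {ω | crossing (fun k => y k + V k ω) x k ≠ 0} = {ω | x - y k < V k ω} := by
      ext ω
      simp only [crossing, if_neg hk, mem_ofPred_eq]
      split_ifs with h <;> simp <;> linarith
    rw [this, hV.tail]

lemma IsFreeNoise.isIndepSummable (hV : IsFreeNoise P s V) (hρ : 0 < ρ) (hs : 0 < s)
    (hy : IsNearUniform ρ K y) (x : ℝ) :
    IsIndepSummable P fun k ω => crossing (fun k => y k + V k ω) x k where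
  measurable k := measurable_crossing (by have := hV.measurable k; fun_prop) x
  indep := by
    have h := hV.indep.comp (fun k v => crossing (fun _ => y k + v) x k)
      fun k => measurable_crossing (z := fun _ v => y k + v) (by fun_prop) x
    exact h
  abs_le_one k ω := by
    unfold crossing
    split_ifs <;> simp
  summable := by
    simp_rw [hV.prob_crossing]
    exact hy.summable_crossProb hρ hs x

/-- The net flow through `x`. -/
def flow (z : ℤ → ℝ) (x : ℝ) : ℝ := ∑' k, crossing z x k

lemma IsFreeNoise.integral_cexp_crossing (hV : IsFreeNoise P s V) (y : ℤ → ℝ) (x : ℝ) (z : ℂ)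
    (k : ℤ) : ∫ ω, Complex.exp (z * crossing (fun k => y k + V k ω) x k) ∂P =
      1 + crossProb y s x k * (Complex.exp (if 1 ≤ k then z else -z) - 1) := by
  set A := {ω | crossing (fun k => y k + V k ω) x k ≠ 0} with hA
  have hAm : MeasurableSet A :=
    measurable_crossing (z := fun k ω => y k + V k ω) (by have := hV.measurable k; fun_prop) x
      (measurableSet_singleton 0).compl
  have h1 : ∀ ω, Complex.exp (z * crossing (fun k => y k + V k ω) x k) =
      1 + A.indicator (fun _ => Complex.exp (if 1 ≤ k then z else -z) - 1) ω := by
    intro ω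
    by_cases h : ω ∈ A
    · rw [indicator_of_mem h]
      simp only [hA, mem_ofPred_eq, crossing] at h ⊢
      split_ifs at h ⊢ <;> simp_all
    · rw [indicator_of_notMem h]
      simp only [hA, mem_ofPred_eq, not_not] at h
      simp [h]
  simp_rw [h1]
  rw [integral_add (integrable_const _) ((integrable_const _).indicator hAm),
    integral_indicator hAm, setIntegral_const, hA, hV.prob_crossing]
  simp

lemma IsFreeNoise.integral_exp_crossing (hV : IsFreeNoise P s V) (y : ℤ → ℝ) (x B : ℝ)
    (k : ℤ) : ∫ ω, Real.exp (B * crossing (fun k => y k + V k ω) x k) ∂P =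
      Real.exp (crossingCGF y s x B k) := by
  have h := hV.integral_cexp_crossing y x B k
  rw [← Complex.ofReal_inj, ← integral_complex_ofReal]
  push_cast
  rw [h, ← Complex.ofReal_exp]
  unfold crossingCGF crossProb
  split_ifs
  · rw [exp_bernoulliCGF]
    push_cast
    ring
  · rw [exp_bernoulliCGF]
    push_cast
    ring

lemma IsFreeNoise.integral_exp_flow (hV : IsFreeNoise P s V) (hρ : 0 < ρ) (hs : 0 < s)
    (hy : IsNearUniform ρ K y) (x B : ℝ) :
    ∫ ω, Real.exp (B * flow (fun k => y k + V k ω) x) ∂P =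
      Real.exp (∑' k, crossingCGF y s x B k) :=
  (hV.isIndepSummable hρ hs hy x).integral_exp_tsum
    (fun k => hV.integral_exp_crossing y x B k) (hy.summable_crossingCGF hρ hs x B)

end Crossings

/-! ### Limit of the cumulant generating function of the flow -/

section FlowLimit

lemma integrableOn_bernoulliCGF (B a : ℝ) : IntegrableOn (bernoulliCGF B) (Ioi a) :=
  Integrable.mono' ((integrableOn_tailProb a).const_mul (Real.exp |B|))
    (continuous_bernoulliCGF B).aestronglyMeasurable
    (ae_of_all _ fun η => abs_bernoulliCGF_le B η)

/-- The product of the two arguments is `1 + 2 p (1 - p) (cosh B - 1)`, and `4 p (1 - p) = erfc η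
erfc (-η)`. This is where the integrand of `I` originates. -/
lemma bernoulliCGF_add (B η : ℝ) :
    bernoulliCGF B η + bernoulliCGF (-B) η = logIntegrand B η := by
  have h1 := bernoulliCGF_arg_pos B η
  have h2 := bernoulliCGF_arg_pos (-B) η
  rw [bernoulliCGF, bernoulliCGF, ← Real.log_mul h1.ne' h2.ne', logIntegrand_eq, sinh_half_sq,
    Real.cosh_eq, erfcProd, erfc_neg, tailProb]
  congr 1
  have e : Real.exp B * Real.exp (-B) = 1 := by rw [← Real.exp_add]; simp
  linear_combination (erfc η / 2) ^ 2 * e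

/-- The step removes the limit `B` at `η → -∞`. Particle–hole symmetry folds the negative half-line
onto the positive one, where the values at `B` and `-B` add up to the integrand of `I`. -/
lemma integral_bernoulliCGF_sub_indicator (B : ℝ) :
    Integrable (fun η => bernoulliCGF B η - (Iic 0).indicator (fun _ => B) η) ∧
    ∫ η, (bernoulliCGF B η - (Iic 0).indicator (fun _ => B) η) = logIntegral B := by
  have e1 : EqOn (fun η => bernoulliCGF B η - (Iic 0).indicator (fun _ => B) η)
      (bernoulliCGF B) (Ioi 0) := fun η hη => by
    have : η ∉ Iic (0 : ℝ) := fun h => absurd (mem_Iic.mp h) (not_le.mpr hη)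
    simp [indicator_of_notMem this]
  have e2 : EqOn (fun η => bernoulliCGF B η - (Iic 0).indicator (fun _ => B) η)
      (fun η => bernoulliCGF (-B) (-η)) (Iic 0) := fun η hη => by
    simp only [indicator_of_mem hη]
    rw [bernoulliCGF_neg]
  have i1 : IntegrableOn (fun η => bernoulliCGF B η - (Iic 0).indicator (fun _ => B) η) (Ioi 0) :=
    (integrableOn_bernoulliCGF B 0).congr_fun e1.symm measurableSet_Ioi
  have i2 : IntegrableOn (fun η => bernoulliCGF B η - (Iic 0).indicator (fun _ => B) η)
      (Iic 0) := by
    have := (integrableOn_bernoulliCGF (-B) 0)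
    rw [← integrableOn_Ici_iff_integrableOn_Ioi] at this
    have h2 := this.comp_neg
    simp only [neg_Ici, neg_zero] at h2
    exact h2.congr_fun e2.symm measurableSet_Iic
  refine ⟨?_, ?_⟩
  · rw [← integrableOn_univ, ← Iic_union_Ioi (a := (0 : ℝ))]
    exact i2.union i1
  · rw [← intervalIntegral.integral_Iic_add_Ioi i2 i1, setIntegral_congr_fun measurableSet_Ioi e1,
      setIntegral_congr_fun measurableSet_Iic e2, integral_comp_neg_Iic, neg_zero, add_comm,
      ← integral_add (integrableOn_bernoulliCGF B 0) (integrableOn_bernoulliCGF (-B) 0)]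
    exact integral_congr_ae (ae_of_all _ fun η => bernoulliCGF_add B η)

/-- The signed area gained when a step of height `B` is moved by `c`; it yields the term linear in
`ξ`. -/
lemma integral_indicator_Iic_sub (B c : ℝ) :
    Integrable (fun η => (Iic 0).indicator (fun _ => B) η - (Iic (-c)).indicator (fun _ => B) η) ∧
    ∫ η, ((Iic 0).indicator (fun _ => B) η - (Iic (-c)).indicator (fun _ => B) η) = B * c := by
  rcases le_total 0 c with hc | hc
  · have e : (fun η => (Iic 0).indicator (fun _ => B) η - (Iic (-c)).indicator (fun _ => B) η) =
        (Ioc (-c) 0).indicator fun _ => B := by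
      funext η
      simp only [indicator_apply, mem_Iic, mem_Ioc]
      split_ifs <;> simp <;> grind
    rw [e]
    refine ⟨(integrable_indicator_iff measurableSet_Ioc).mpr (by simp), ?_⟩
    rw [integral_indicator measurableSet_Ioc, setIntegral_const, Real.volume_real_Ioc_of_le
      (by linarith), smul_eq_mul]
    ring
  · have e : (fun η => (Iic 0).indicator (fun _ => B) η - (Iic (-c)).indicator (fun _ => B) η) =
        (Ioc 0 (-c)).indicator fun _ => -B := by
      funext η
      simp only [indicator_apply, mem_Iic, mem_Ioc]
      split_ifs <;> simp <;> grind
    rw [e]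
    refine ⟨(integrable_indicator_iff measurableSet_Ioc).mpr (by simp), ?_⟩
    rw [integral_indicator measurableSet_Ioc, setIntegral_const, Real.volume_real_Ioc_of_le
      (by linarith), smul_eq_mul]
    ring

/-- The limiting cumulant generating function of the flow through `ξ √t`. -/
def flowCGF (ρ σ ξ B : ℝ) : ℝ := ρ * B * ξ + ρ * σ * logIntegral B

variable {ρ σ : ℝ}

/-- At macroscopic label `v` the rescaled distance is `η = (v / ρ - ξ) / σ`, with Jacobian `ρ σ`.
The labels change side at `η = -ξ / σ` instead of `0`, and moving the step there costs `B ξ / σ`. -/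
lemma integral_limit_profile (hρ : 0 < ρ) (hσ : 0 < σ) (ξ B : ℝ) :
    ∫ v : ℝ, (if 0 < v then bernoulliCGF B ((v / ρ - ξ) / σ)
      else bernoulliCGF (-B) ((ξ - v / ρ) / σ)) = flowCGF ρ σ ξ B := by
  set H : ℝ → ℝ := fun η => (bernoulliCGF B η - (Iic 0).indicator (fun _ => B) η) +
    ((Iic 0).indicator (fun _ => B) η - (Iic (-(ξ / σ))).indicator (fun _ => B) η) with hH
  have h1 : ∀ v : ℝ, (if 0 < v then bernoulliCGF B ((v / ρ - ξ) / σ)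
      else bernoulliCGF (-B) ((ξ - v / ρ) / σ)) = H ((ρ * σ)⁻¹ * v - ξ / σ) := by
    intro v
    have hη : (v / ρ - ξ) / σ = (ρ * σ)⁻¹ * v - ξ / σ := by field_simp
    have hv : (ρ * σ)⁻¹ * v - ξ / σ ∈ Iic (-(ξ / σ)) ↔ ¬ 0 < v := by
      have hpos : 0 < (ρ * σ)⁻¹ := by positivity
      rw [mem_Iic, not_lt, sub_le_iff_le_add, neg_add_cancel]
      exact ⟨fun h => by by_contra! hv; exact absurd (mul_pos hpos hv) (not_lt.mpr h),
        fun h => mul_nonpos_of_nonneg_of_nonpos hpos.le h⟩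
    simp only [hH, sub_add_sub_cancel, indicator_apply, hv]
    split_ifs with hv0
    · rw [hη, sub_zero]
    · rw [show (ξ - v / ρ) / σ = -((v / ρ - ξ) / σ) by ring, bernoulliCGF_neg, hη]
  simp_rw [h1]
  rw [Measure.integral_comp_mul_left (fun u => H (u - ξ / σ)), integral_sub_right_eq_self H,
    hH, integral_add (integral_bernoulliCGF_sub_indicator B).1
      (integral_indicator_Iic_sub B (ξ / σ)).1, (integral_bernoulliCGF_sub_indicator B).2,
    (integral_indicator_Iic_sub B (ξ / σ)).2, inv_inv, abs_of_pos (by positivity), smul_eq_mul,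
    flowCGF]
  field_simp
  ring

/-- The configuration `y` has the flat macroscopic profile `ρ`. -/
def HasFlatProfile (ρ : ℝ) (y : ℤ → ℝ) : Prop :=
  ∀ ε : ℝ, 0 < ε → ∃ K : ℝ, ∀ k : ℤ, |y k - k / ρ| ≤ ε * |(k : ℝ)| + K

lemma HasFlatProfile.exists_isNearUniform {y : ℤ → ℝ} (hρ : 0 < ρ) (hy : HasFlatProfile ρ y) :
    ∃ K, 0 ≤ K ∧ IsNearUniform ρ K y := by
  obtain ⟨K, hK⟩ := hy (1 / (2 * ρ)) (by positivity)
  refine ⟨|K|, abs_nonneg K, fun k => (hK k).trans ?_⟩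
  have := le_abs_self K
  rw [div_mul_eq_mul_div, one_mul]
  linarith

lemma abs_ceil_mul_div_sub_le {r : ℝ} (hr : 0 < r) (v : ℝ) : |(⌈r * v⌉ : ℝ) / r - v| ≤ 1 / r := by
  have h1 := Int.le_ceil (r * v)
  have h2 := Int.ceil_lt_add_one (r * v)
  rw [div_sub' hr.ne', abs_div, abs_of_pos hr]
  gcongr
  rw [abs_le]
  constructor <;> linarith

variable {ι : Type*} {l : Filter ι} {r : ι → ℝ}

lemma tendsto_one_div_of_atTop (hr : Tendsto r l atTop) : Tendsto (fun i => 1 / r i) l (𝓝 0) := by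
  simp_rw [one_div]
  exact tendsto_inv_atTop_zero.comp hr

lemma HasFlatProfile.tendsto_ceil {y : ℤ → ℝ} (hρ : 0 < ρ) (hy : HasFlatProfile ρ y)
    (hr : Tendsto r l atTop) (v : ℝ) :
    Tendsto (fun i => y ⌈r i * v⌉ / r i) l (𝓝 (v / ρ)) := by
  have hinv := tendsto_one_div_of_atTop hr
  rw [Metric.tendsto_nhds]
  intro ε hε
  set ε' := ε / (4 * (|v| + 1)) with hε'
  have hε'pos : 0 < ε' := by positivity
  obtain ⟨K, hK⟩ := hy ε' hε'pos
  have h1 : ∀ᶠ i in l, 1 / r i < 1 := hinv.eventually_lt_const one_pos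
  have h2 : ∀ᶠ i in l, K * (1 / r i) + 1 / ρ * (1 / r i) < ε / 2 := by
    have : Tendsto (fun i => K * (1 / r i) + 1 / ρ * (1 / r i)) l (𝓝 0) := by
      simpa using (hinv.const_mul K).add (hinv.const_mul (1 / ρ))
    exact this.eventually_lt_const (half_pos hε)
  filter_upwards [h1, h2, hr.eventually_gt_atTop 0] with i h1 h2 hri
  have h3 := abs_ceil_mul_div_sub_le hri v
  have h4 : |y ⌈r i * v⌉ / r i - (⌈r i * v⌉ : ℝ) / r i / ρ| ≤
      ε' * |(⌈r i * v⌉ : ℝ) / r i| + K * (1 / r i) := by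
    have := hK ⌈r i * v⌉
    rw [show y ⌈r i * v⌉ / r i - (⌈r i * v⌉ : ℝ) / r i / ρ =
      (y ⌈r i * v⌉ - (⌈r i * v⌉ : ℝ) / ρ) / r i by field_simp, abs_div, abs_div, abs_of_pos hri,
      div_le_iff₀ hri]
    refine this.trans (le_of_eq ?_)
    field_simp
  have h5 : |(⌈r i * v⌉ : ℝ) / r i| ≤ |v| + 1 := by
    have := abs_sub_abs_le_abs_sub ((⌈r i * v⌉ : ℝ) / r i) v
    linarith
  have h6 : |(⌈r i * v⌉ : ℝ) / r i / ρ - v / ρ| ≤ 1 / ρ * (1 / r i) := by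
    rw [← sub_div, abs_div, abs_of_pos hρ, div_eq_inv_mul, one_div ρ]
    gcongr
  rw [Real.dist_eq]
  calc |y ⌈r i * v⌉ / r i - v / ρ|
      ≤ |y ⌈r i * v⌉ / r i - (⌈r i * v⌉ : ℝ) / r i / ρ| +
        |(⌈r i * v⌉ : ℝ) / r i / ρ - v / ρ| := abs_sub_le _ _ _
    _ ≤ ε' * (|v| + 1) + K * (1 / r i) + 1 / ρ * (1 / r i) := by
        have := mul_le_mul_of_nonneg_left h5 hε'pos.le
        linarith
    _ = ε / 4 + (K * (1 / r i) + 1 / ρ * (1 / r i)) := by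
        rw [hε']
        field_simp
        ring
    _ < ε := by linarith

/-- The series divided by `r` is the integral of a step function of `v = k / r`. It converges
pointwise by the flat profile and has an exponential majorant. -/
lemma HasFlatProfile.tendsto_tsum_crossingCGF [l.IsCountablyGenerated] {y : ℤ → ℝ} (hρ : 0 < ρ)
    (hσ : 0 < σ) (hy : HasFlatProfile ρ y) (hr : Tendsto r l atTop) (ξ B : ℝ) :
    Tendsto (fun i => (∑' k, crossingCGF y (σ * r i) (ξ * r i) B k) / r i) l
      (𝓝 (flowCGF ρ σ ξ B)) := by
  obtain ⟨K, hK0, hK⟩ := hy.exists_isNearUniform hρ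
  have h1 : ∀ᶠ i in l, ∫ v, crossingCGF y (σ * r i) (ξ * r i) B ⌈r i * v⌉ =
      (∑' k, crossingCGF y (σ * r i) (ξ * r i) B k) / r i := by
    filter_upwards [hr.eventually_gt_atTop 0] with i hri
    rw [tsum_eq_integral_ceil (hK.summable_crossingCGF hρ (mul_pos hσ hri) _ _),
      Measure.integral_comp_mul_left (fun u => crossingCGF y (σ * r i) (ξ * r i) B ⌈u⌉),
      abs_of_pos (inv_pos.mpr hri), smul_eq_mul, div_eq_inv_mul]
  refine Tendsto.congr' h1 ?_
  rw [← integral_limit_profile hρ hσ]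
  set c := 1 / (2 * ρ * σ) with hc
  have hcpos : 0 < c := by positivity
  -- For `r ≥ 1` the factor `(K + |ξ r|) / (σ r)` is at most `(K + |ξ|) / σ`, and rounding `r v` up
  -- to a label costs at most `e^c`.
  set D := Real.exp |B| * (2 * Real.exp ((K + |ξ|) / σ)) * Real.exp c with hD
  refine tendsto_integral_filter_of_dominated_convergence
    (fun v => D * Real.exp (-(c * |v - 0|))) (Eventually.of_forall fun i => ?_) ?_
    ((integrable_exp_neg_abs hcpos 0).const_mul D) ?_
  · exact ((measurable_of_countable (crossingCGF y (σ * r i) (ξ * r i) B)).comp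
      (Int.measurable_ceil.comp (measurable_const_mul (r i)))).aestronglyMeasurable
  · filter_upwards [hr.eventually_ge_atTop 1] with i hri
    have hri0 : 0 < r i := by linarith
    refine ae_of_all _ fun v => ?_
    rw [Real.norm_eq_abs]
    refine (abs_crossingCGF_le _ _ _ _ _).trans ?_
    have h1 := hK.crossProb_le hρ (mul_pos hσ hri0) (ξ * r i) ⌈r i * v⌉
    refine (mul_le_mul_of_nonneg_left h1 (Real.exp_pos _).le).trans ?_
    have e1 : D * Real.exp (-(c * |v - 0|)) = Real.exp |B| *
        (2 * Real.exp ((K + |ξ|) / σ + c + -(c * |v - 0|))) := by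
      rw [hD, Real.exp_add, Real.exp_add]
      ring
    rw [e1, mul_assoc 2, ← Real.exp_add]
    refine mul_le_mul_of_nonneg_left (mul_le_mul_of_nonneg_left ?_ zero_le_two)
      (Real.exp_pos _).le
    rw [Real.exp_le_exp]
    have h2 := abs_ceil_mul_div_sub_le hri0 v
    have h3 : |v| - 1 ≤ |(⌈r i * v⌉ : ℝ) - 0| / r i := by
      have h4 : |v| - |(⌈r i * v⌉ : ℝ) / r i| ≤ 1 / r i := by
        have := abs_sub_abs_le_abs_sub v ((⌈r i * v⌉ : ℝ) / r i)
        rw [abs_sub_comm] at this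
        linarith
      have h5 : 1 / r i ≤ 1 := by
        rw [div_le_one hri0]
        exact hri
      rw [sub_zero]
      rw [abs_div, abs_of_pos hri0] at h4
      linarith
    have h6 : 1 / (2 * ρ * (σ * r i)) * |(⌈r i * v⌉ : ℝ) - 0| =
        c * (|(⌈r i * v⌉ : ℝ) - 0| / r i) := by
      rw [hc]
      field_simp
    have h7 : (K + |ξ * r i|) / (σ * r i) ≤ (K + |ξ|) / σ := by
      rw [abs_mul, abs_of_pos hri0, div_le_div_iff₀ (by positivity) hσ]
      nlinarith [mul_nonneg (mul_nonneg hK0 hσ.le) (sub_nonneg.mpr hri)]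
    rw [h6, sub_zero v]
    nlinarith
  · refine ae_of_all _ fun v => ?_
    have hy' := hy.tendsto_ceil hρ hr v
    have hξ : Tendsto (fun i => ξ * r i / r i) l (𝓝 ξ) := by
      refine tendsto_const_nhds.congr' ?_
      filter_upwards [hr.eventually_gt_atTop 0] with i hri
      field_simp
    unfold crossingCGF
    by_cases hv : 0 < v
    · rw [if_pos hv]
      have hlim := ((continuous_bernoulliCGF B).tendsto _).comp ((hy'.sub hξ).div_const σ)
      refine hlim.congr' ?_
      filter_upwards [hr.eventually_gt_atTop 0] with i hri
      rw [if_pos (Int.one_le_ceil_iff.mpr (mul_pos hri hv)), Function.comp_apply]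
      congr 1
      field_simp
    · rw [if_neg hv]
      have hlim := ((continuous_bernoulliCGF (-B)).tendsto _).comp ((hξ.sub hy').div_const σ)
      refine hlim.congr' ?_
      filter_upwards [hr.eventually_gt_atTop 0] with i hri
      rw [if_neg, Function.comp_apply]
      · congr 1
        field_simp
      · rw [Int.one_le_ceil_iff, not_lt]
        exact mul_nonpos_of_nonneg_of_nonpos hri.le (not_lt.mp hv)

end FlowLimit

/-! ### Tails of the tracer -/

section Tails

variable {Ω : Type*} [MeasurableSpace Ω] {P : Measure Ω} [IsProbabilityMeasure P] {ρ σ : ℝ}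
  {ι : Type*} {l : Filter ι} {r : ι → ℝ} {y : ℤ → ℝ} {V : ι → ℤ → Ω → ℝ}

lemma logAsymp_exp_flow [l.IsCountablyGenerated] (hρ : 0 < ρ) (hσ : 0 < σ)
    (hy : HasFlatProfile ρ y) (hr0 : ∀ i, 0 < r i) (hr : Tendsto r l atTop)
    (hV : ∀ i, IsFreeNoise P (σ * r i) (V i)) (ξ B : ℝ) :
    LogAsymp l r (fun i => ∫ ω, Real.exp (B * flow (fun k => y k + V i k ω) (ξ * r i)) ∂P)
      (flowCGF ρ σ ξ B) := by
  obtain ⟨K, -, hK⟩ := hy.exists_isNearUniform hρ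
  have h : ∀ i, ∫ ω, Real.exp (B * flow (fun k => y k + V i k ω) (ξ * r i)) ∂P =
      Real.exp (∑' k, crossingCGF y (σ * r i) (ξ * r i) B k) := fun i =>
    (hV i).integral_exp_flow hρ (mul_pos hσ (hr0 i)) hK _ _
  simp_rw [h]
  refine LogAsymp.of_tendsto hr (Eventually.of_forall fun i => Real.exp_pos _) ?_
  simp_rw [Real.log_exp]
  exact hy.tendsto_tsum_crossingCGF hρ hσ hr ξ B

/-- The stationary point of the convex function `B ↦ ρ B ξ + ρ σ I(B)` solves `σ I'(B) = -ξ`. So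
this tilt optimises Chernoff's bound for the sign of the flow. -/
lemma flowCGF_neg_conjVar (ρ σ ξ : ℝ) : flowCGF ρ σ ξ (-conjVar σ ξ) = -ldf ρ σ ξ := by
  rw [flowCGF, logIntegral_neg, ldf]
  ring

lemma hasDerivAt_flowCGF (hσ : 0 < σ) (ρ ξ ξ₁ : ℝ) :
    HasDerivAt (flowCGF ρ σ ξ) (ρ * (ξ - ξ₁)) (-conjVar σ ξ₁) := by
  have h1 := ((hasDerivAt_id (-conjVar σ ξ₁)).const_mul ρ).mul_const ξ
  have h2 := (differentiable_logIntegral (-conjVar σ ξ₁)).hasDerivAt.const_mul (ρ * σ)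
  refine (h1.add h2).congr_deriv ?_
  rw [deriv_logIntegral_neg]
  linear_combination -ρ * mul_deriv_conjVar hσ ξ₁

/-- The exponential rate produced by tilting towards `ξ₁` is almost optimal near `ξ`. -/
lemma eventually_tilt_rate (ρ σ ξ : ℝ) {ε : ℝ} (hε : 0 < ε) :
    ∀ᶠ ξ₁ in 𝓝 ξ, -ldf ρ σ ξ - ε < flowCGF ρ σ ξ (-conjVar σ ξ₁) -
      -conjVar σ ξ₁ * (ρ * (ξ - ξ₁)) - |-conjVar σ ξ₁| * |ρ * (ξ - ξ₁)| := by
  have h1 := continuous_conjVar σ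
  have h2 := differentiable_logIntegral.continuous
  have hc : Continuous fun ξ₁ => flowCGF ρ σ ξ (-conjVar σ ξ₁) -
      -conjVar σ ξ₁ * (ρ * (ξ - ξ₁)) - |-conjVar σ ξ₁| * |ρ * (ξ - ξ₁)| := by
    unfold flowCGF
    fun_prop
  refine hc.continuousAt.eventually_const_lt ?_
  simp only [sub_self, mul_zero, abs_zero, sub_zero, flowCGF_neg_conjVar]
  linarith

lemma conjVar_pos (hσ : 0 < σ) {ξ : ℝ} (h : 0 < ξ) : 0 < conjVar σ ξ := by
  rw [← conjVar_zero hσ]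
  exact conjVar_strictMono hσ h

/-- Chernoff's bound at the origin. -/
lemma prob_le_of_nonneg_exponent {Q : Ω → ℝ} {B : ℝ} {A : Set Ω} (hA : NullMeasurableSet A P)
    (hint : Integrable (fun ω => Real.exp (B * Q ω)) P) (h : ∀ ω ∈ A, 0 ≤ B * Q ω) :
    P.real A ≤ ∫ ω, Real.exp (B * Q ω) ∂P := by
  have h1 : ∫ ω in A, (1 : ℝ) ∂P ≤ ∫ ω in A, Real.exp (B * Q ω) ∂P := by
    refine setIntegral_mono_on₀ (by simp) hint.integrableOn hA fun ω hω => ?_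
    exact Real.one_le_exp (h ω hω)
  rw [setIntegral_const, smul_eq_mul, mul_one] at h1
  exact h1.trans (setIntegral_le_integral hint (ae_of_all _ fun ω => (Real.exp_pos _).le))

/-- The upper bound is Chernoff's at the optimal tilt. Under that tilt the flow has mean zero on the
scale considered, which does not force the event; the lower bound therefore tilts towards some `ξ₁ >
ξ`, where the mean `ρ (ξ - ξ₁)` is negative, with `ξ₁` close to `ξ`. -/
lemma logAsymp_flow_neg [l.IsCountablyGenerated] (hρ : 0 < ρ) (hσ : 0 < σ)
    (hy : HasFlatProfile ρ y) (hr0 : ∀ i, 0 < r i) (hr : Tendsto r l atTop)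
    (hV : ∀ i, IsFreeNoise P (σ * r i) (V i)) {ξ : ℝ} (hξ : 0 < ξ) :
    LogAsymp l r (fun i => P.real {ω | flow (fun k => y k + V i k ω) (ξ * r i) < 0})
      (-ldf ρ σ ξ) := by
  obtain ⟨K, -, hK⟩ := hy.exists_isNearUniform hρ
  have hS := fun i => (hV i).isIndepSummable hρ (mul_pos hσ (hr0 i)) hK (ξ * r i)
  have hΛ := logAsymp_exp_flow hρ hσ hy hr0 hr hV ξ
  intro ε hε
  refine Eventually.and ?_ ?_
  · obtain ⟨ξ₁, h1, h2⟩ := ((eventually_tilt_rate ρ σ ξ (half_pos hε)).filter_mono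
      nhdsWithin_le_nhds |>.and (self_mem_nhdsWithin : Ioi ξ ∈ 𝓝[>] ξ)).exists
    have hm : ρ * (ξ - ξ₁) < 0 := mul_neg_of_pos_of_neg hρ (sub_neg.mpr h2)
    have h3 := tilting_lower_bound hr (fun i => (hS i).aemeasurable_tsum)
      (fun i => (hS i).integrable_exp_tsum) hΛ (hasDerivAt_flowCGF hσ ρ ξ ξ₁)
      (abs_pos.mpr hm.ne) (half_pos hε)
    filter_upwards [h3] with i hi
    have hri := hr0 i
    refine le_trans ?_ (hi.trans (measureReal_mono fun ω hω => ?_))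
    · rw [Real.exp_le_exp]
      exact mul_le_mul_of_nonneg_left (by linarith) hri.le
    · have h4 : |flow (fun k => y k + V i k ω) (ξ * r i) - r i * (ρ * (ξ - ξ₁))| <
          r i * |ρ * (ξ - ξ₁)| := hω
      rw [abs_of_neg hm] at h4
      have h5 := (abs_lt.mp h4).2
      change flow _ _ < 0
      linarith
  · filter_upwards [hΛ (-conjVar σ ξ) ε hε] with i hi
    rw [flowCGF_neg_conjVar] at hi
    refine (prob_le_of_nonneg_exponent ?_ ((hS i).integrable_exp_tsum _) fun ω hω => ?_).trans hi.2
    · exact nullMeasurableSet_lt (hS i).aemeasurable_tsum aemeasurable_const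
    · exact mul_nonneg_of_nonpos_of_nonpos (by linarith [conjVar_pos hσ hξ])
        (le_of_lt hω)

/-- The mirror image of the negative case, with `ξ₁ < ξ`. -/
lemma logAsymp_flow_nonneg [l.IsCountablyGenerated] (hρ : 0 < ρ) (hσ : 0 < σ)
    (hy : HasFlatProfile ρ y) (hr0 : ∀ i, 0 < r i) (hr : Tendsto r l atTop)
    (hV : ∀ i, IsFreeNoise P (σ * r i) (V i)) {ξ : ℝ} (hξ : ξ < 0) :
    LogAsymp l r (fun i => P.real {ω | 0 ≤ flow (fun k => y k + V i k ω) (ξ * r i)})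
      (-ldf ρ σ ξ) := by
  obtain ⟨K, -, hK⟩ := hy.exists_isNearUniform hρ
  have hS := fun i => (hV i).isIndepSummable hρ (mul_pos hσ (hr0 i)) hK (ξ * r i)
  have hΛ := logAsymp_exp_flow hρ hσ hy hr0 hr hV ξ
  intro ε hε
  refine Eventually.and ?_ ?_
  · obtain ⟨ξ₁, h1, h2⟩ := ((eventually_tilt_rate ρ σ ξ (half_pos hε)).filter_mono
      nhdsWithin_le_nhds |>.and (self_mem_nhdsWithin : Iio ξ ∈ 𝓝[<] ξ)).exists
    have hm : 0 < ρ * (ξ - ξ₁) := mul_pos hρ (sub_pos.mpr h2)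
    have h3 := tilting_lower_bound hr (fun i => (hS i).aemeasurable_tsum)
      (fun i => (hS i).integrable_exp_tsum) hΛ (hasDerivAt_flowCGF hσ ρ ξ ξ₁)
      (abs_pos.mpr hm.ne') (half_pos hε)
    filter_upwards [h3] with i hi
    have hri := hr0 i
    refine le_trans ?_ (hi.trans (measureReal_mono fun ω hω => ?_))
    · rw [Real.exp_le_exp]
      exact mul_le_mul_of_nonneg_left (by linarith) hri.le
    · have h4 : |flow (fun k => y k + V i k ω) (ξ * r i) - r i * (ρ * (ξ - ξ₁))| <
          r i * |ρ * (ξ - ξ₁)| := hω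
      rw [abs_of_pos hm] at h4
      have h5 := (abs_lt.mp h4).1
      change 0 ≤ flow _ _
      linarith
  · filter_upwards [hΛ (-conjVar σ ξ) ε hε] with i hi
    rw [flowCGF_neg_conjVar] at hi
    refine (prob_le_of_nonneg_exponent ?_ ((hS i).integrable_exp_tsum _) fun ω hω => ?_).trans hi.2
    · exact nullMeasurableSet_le aemeasurable_const (hS i).aemeasurable_tsum
    · have := conjVar_pos hσ (neg_pos.mpr hξ)
      rw [conjVar_neg hσ] at this
      exact mul_nonneg this.le hω

end Tails

/-! ### Bounds that are uniform over the initial configuration -/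

section UniformUpper

variable {ρ K s x B : ℝ} {y : ℤ → ℝ}

lemma bernoulliCGF_mono (hB : B ≤ 0) : Monotone (bernoulliCGF B) := fun a b hab => by
  refine Real.log_le_log (bernoulliCGF_arg_pos B a) ?_
  have h1 := strictAnti_tailProb.antitone hab
  have h2 := Real.exp_le_one_iff.mpr hB
  nlinarith

lemma bernoulliCGF_le_exp (B : ℝ) {η u : ℝ} (h : u ≤ η) :
    bernoulliCGF B η ≤ 2 * Real.exp |B| * Real.exp (-u) := by
  refine (le_abs_self _).trans ((abs_bernoulliCGF_le B η).trans ?_)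
  have h1 := tailProb_le_exp η
  have h2 : Real.exp (-η) ≤ Real.exp (-u) := Real.exp_le_exp.mpr (neg_le_neg h)
  have h3 : tailProb η ≤ 2 * Real.exp (-u) := by linarith
  calc Real.exp |B| * tailProb η ≤ Real.exp |B| * (2 * Real.exp (-u)) :=
        mul_le_mul_of_nonneg_left h3 (Real.exp_pos _).le
    _ = _ := by ring

/-- An upper bound for the cumulant generating function of the flow, by comparison with the
rightmost configuration that is allowed. -/
lemma IsNearUniform.crossingCGF_le (hρ : 0 < ρ) (hs : 0 < s) (hK : 0 ≤ K)
    (hy : IsNearUniform ρ K y) (hB : B ≤ 0) (hx : 0 ≤ x) (k : ℤ) :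
    crossingCGF y s x B k ≤
      (if k ∈ Finset.Icc 1 ⌊2 * ρ / 3 * (x - K)⌋ then B else 0) +
      2 * Real.exp |B| * Real.exp (K / s) *
        (Real.exp (-(3 / (2 * ρ * s) * |(k : ℝ) - 2 * ρ / 3 * (x - K)|)) +
          Real.exp (-(1 / (2 * ρ * s) * |(k : ℝ) - 0|))) := by
  -- For `k ≥ 1` the particle starts at most at `3 k / (2 ρ) + K`, and this is to the left of `x`
  -- exactly for `k ≤ a`.
  set a := 2 * ρ / 3 * (x - K) with ha
  set E₁ := Real.exp (-(3 / (2 * ρ * s) * |(k : ℝ) - a|)) with hE₁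
  set E₂ := Real.exp (-(1 / (2 * ρ * s) * |(k : ℝ) - 0|)) with hE₂
  have hE₁0 : 0 < E₁ := Real.exp_pos _
  have hE₂0 : 0 < E₂ := Real.exp_pos _
  have hD : 0 < 2 * Real.exp |B| := by positivity
  have hKs : 1 ≤ Real.exp (K / s) := Real.one_le_exp (by positivity)
  have hb := abs_le.mp (hy k)
  have h2 : (k : ℝ) / ρ = 2 * (k / (2 * ρ)) := by field_simp
  have hbig : 2 * Real.exp |B| * E₁ ≤ 2 * Real.exp |B| * Real.exp (K / s) * (E₁ + E₂) := by
    have h3 : E₁ ≤ Real.exp (K / s) * (E₁ + E₂) := by nlinarith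
    rw [mul_assoc (2 * Real.exp |B|)]
    exact mul_le_mul_of_nonneg_left h3 hD.le
  unfold crossingCGF
  by_cases hk : 1 ≤ k
  · have hk0 : (0 : ℝ) < k := by exact_mod_cast hk
    rw [if_pos hk]
    rw [abs_of_pos hk0] at hb
    have hyk : (y k - x) / s ≤ 3 / (2 * ρ * s) * (k - a) := by
      have : 3 / (2 * ρ * s) * (k - a) = (3 * (k / (2 * ρ)) + K - x) / s := by
        rw [ha]
        field_simp
        ring
      rw [this]
      refine div_le_div_of_nonneg_right ?_ hs.le
      linarith [hb.2]
    have hmono := bernoulliCGF_mono hB hyk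
    by_cases hka : k ≤ ⌊a⌋
    · rw [if_pos (Finset.mem_Icc.mpr ⟨hk, hka⟩)]
      have hka' : (k : ℝ) ≤ a := Int.le_floor.mp hka
      -- A particle with `1 ≤ k ≤ a` is typically counted: by particle–hole symmetry its
      -- contribution is `B` up to an exponentially small term.
      have h4 := bernoulliCGF_neg B (3 / (2 * ρ * s) * (k - a))
      have h5 := bernoulliCGF_le_exp (-B) (le_refl (-(3 / (2 * ρ * s) * (k - a))))
      rw [abs_neg] at h5
      have e : Real.exp (- -(3 / (2 * ρ * s) * (k - a))) = E₁ := by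
        rw [hE₁, abs_of_nonpos (by linarith : (k : ℝ) - a ≤ 0), mul_neg]
      rw [e] at h5
      linarith
    · rw [if_neg fun h => hka (Finset.mem_Icc.mp h).2, zero_add]
      have hka' : a < k := Int.floor_lt.mp (not_le.mp hka)
      have h5 := bernoulliCGF_le_exp B (le_refl (3 / (2 * ρ * s) * (k - a)))
      have e : Real.exp (-(3 / (2 * ρ * s) * (k - a))) = E₁ := by
        rw [hE₁, abs_of_pos (by linarith : 0 < (k : ℝ) - a)]
      rw [e] at h5
      linarith
  · have hk0 : (k : ℝ) ≤ 0 := by exact_mod_cast (by omega : k ≤ 0)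
    rw [if_neg hk, if_neg fun h => hk (Finset.mem_Icc.mp h).1, zero_add]
    rw [abs_of_nonpos hk0] at hb
    have hyk : 1 / (2 * ρ * s) * |(k : ℝ) - 0| - K / s ≤ (x - y k) / s := by
      rw [sub_zero, abs_of_nonpos hk0, show 1 / (2 * ρ * s) * -(k : ℝ) - K / s =
        (-((k : ℝ) / (2 * ρ)) - K) / s by field_simp]
      refine div_le_div_of_nonneg_right ?_ hs.le
      have : -(k : ℝ) / (2 * ρ) = -(k / (2 * ρ)) := neg_div _ _
      linarith [hb.2]
    have h5 := bernoulliCGF_le_exp (-B) hyk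
    rw [abs_neg, neg_sub, sub_eq_add_neg (K / s), Real.exp_add] at h5
    refine h5.trans ?_
    rw [← mul_assoc]
    refine mul_le_mul_of_nonneg_left ?_ (by positivity)
    linarith

lemma IsNearUniform.tsum_crossingCGF_le (hρ : 0 < ρ) (hs : 0 < s) (hK : 0 ≤ K)
    (hy : IsNearUniform ρ K y) (hB : B ≤ 0) (hx : 0 ≤ x) :
    ∑' k, crossingCGF y s x B k ≤
      B * (2 * ρ / 3 * (x - K) - 1) + 2 * Real.exp |B| * Real.exp (K / s) *
        (Real.exp (3 / (2 * ρ * s)) * (2 / (3 / (2 * ρ * s))) +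
          Real.exp (1 / (2 * ρ * s)) * (2 / (1 / (2 * ρ * s)))) := by
  have hc1 : 0 < 3 / (2 * ρ * s) := by positivity
  have hc2 : 0 < 1 / (2 * ρ * s) := by positivity
  set a := 2 * ρ / 3 * (x - K) with ha
  have hs1 : Summable fun k : ℤ => if k ∈ Finset.Icc 1 ⌊a⌋ then B else 0 :=
    (hasSum_sum_of_ne_finset_zero (s := Finset.Icc 1 ⌊a⌋) (by simp +contextual)).summable
  have hs2 := summable_exp_neg_abs hc1 a
  have hs3 := summable_exp_neg_abs hc2 0
  have hs4 := (hs2.add hs3).mul_left (2 * Real.exp |B| * Real.exp (K / s))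
  refine ((hy.summable_crossingCGF hρ hs x B).tsum_le_tsum
    (hy.crossingCGF_le hρ hs hK hB hx) (hs1.add hs4)).trans ?_
  rw [hs1.tsum_add hs4, tsum_mul_left, hs2.tsum_add hs3]
  refine add_le_add ?_ (mul_le_mul_of_nonneg_left
    (add_le_add (tsum_exp_neg_abs_le hc1 a) (tsum_exp_neg_abs_le hc2 0)) (by positivity))
  rw [tsum_eq_sum (s := Finset.Icc 1 ⌊a⌋) (by simp +contextual),
    Finset.sum_congr rfl (fun k hk => if_pos hk), Finset.sum_const, Int.card_Icc, nsmul_eq_mul,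
    mul_comm]
  refine mul_le_mul_of_nonpos_left ?_ hB
  -- The interval has at least `a - 1` elements; if `a` is negative it is empty, and `toNat` gives
  -- `0 ≥ ⌊a⌋`.
  have h1 : (⌊a⌋ : ℝ) ≤ ((⌊a⌋ + 1 - 1).toNat : ℝ) := by
    rw [add_sub_cancel_right]
    exact_mod_cast Int.self_le_toNat _
  linarith [Int.lt_floor_add_one a]

/-- Reflection with `k ↦ 1 - k` exchanges the labels `k ≥ 1` and `k ≤ 0`, so one tail of the tracer
yields the other. The shift of labels costs `1 / ρ + 1 / (2 ρ)`, below the `2 / ρ` allowed. -/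
lemma IsNearUniform.reflect (hρ : 0 < ρ) (hy : IsNearUniform ρ K y) :
    IsNearUniform ρ (K + 2 / ρ) fun k => -y (1 - k) := by
  intro k
  have h1 := hy (1 - k)
  have h2 : |((1 - k : ℤ) : ℝ)| ≤ 1 + |(k : ℝ)| := by
    push_cast
    exact (abs_sub _ _).trans (by simp)
  have h3 : -y (1 - k) - k / ρ = -(y (1 - k) - ((1 - k : ℤ) : ℝ) / ρ) - 1 / ρ := by
    push_cast
    field_simp
    ring
  have h4 := div_le_div_of_nonneg_right h2 (by positivity : 0 ≤ 2 * ρ)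
  have h5 : (1 + |(k : ℝ)|) / (2 * ρ) = 1 / ρ / 2 + |(k : ℝ)| / (2 * ρ) := by field_simp
  have h6 : 2 / ρ = 2 * (1 / ρ) := by ring
  have h7 : 0 < 1 / ρ := by positivity
  rw [h3]
  refine (abs_sub _ _).trans ?_
  rw [abs_neg, abs_of_pos h7]
  linarith

lemma crossingCGF_reflect (y : ℤ → ℝ) (s x B : ℝ) (k : ℤ) :
    crossingCGF (fun k => -y (1 - k)) s (-x) (-B) (1 - k) = crossingCGF y s x B k := by
  unfold crossingCGF
  by_cases hk : 1 ≤ k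
  · rw [if_pos hk, if_neg (by omega)]
    simp only [neg_neg, sub_sub_cancel]
    congr 2
    ring
  · rw [if_neg hk, if_pos (by omega)]
    simp only [sub_sub_cancel]
    congr 2
    ring

lemma tsum_crossingCGF_reflect (y : ℤ → ℝ) (s x B : ℝ) :
    ∑' k, crossingCGF (fun k => -y (1 - k)) s (-x) (-B) k = ∑' k, crossingCGF y s x B k := by
  rw [← (Equiv.subLeft (1 : ℤ)).tsum_eq]
  exact tsum_congr fun k => crossingCGF_reflect y s x B k

variable {Ω : Type*} [MeasurableSpace Ω] {P : Measure Ω} [IsProbabilityMeasure P] {σ : ℝ}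

/-- Exponential tails of the tracer, uniform over the initial configuration. -/
lemma exists_uniform_tail_bound (hρ : 0 < ρ) (hσ : 0 < σ) (hK : 0 ≤ K) (b : ℝ) (hb : 0 ≤ b)
    {r₀ : ℝ} (hr₀ : 0 < r₀) :
    ∃ C, ∀ r, r₀ ≤ r → ∀ (y : ℤ → ℝ) (V : ℤ → Ω → ℝ), IsNearUniform ρ K y →
      IsFreeNoise P (σ * r) V → ∀ ξ, 0 ≤ ξ →
        P.real {ω | flow (fun k => y k + V k ω) (ξ * r) < 0} ≤ Real.exp (r * (C - b * ξ)) ∧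
        P.real {ω | 0 ≤ flow (fun k => y k + V k ω) (-ξ * r)} ≤ Real.exp (r * (C - b * ξ)) := by
  -- Large enough for both the configuration and its reflection.
  set K' := K + 2 / ρ with hK'
  have hK'0 : 0 ≤ K' := by positivity
  have hKK' : K ≤ K' := by rw [hK']; linarith [(by positivity : 0 ≤ 2 / ρ)]
  -- The linear term `B (2 ρ / 3) ξ r` of the bound becomes exactly `-b ξ r`.
  set B := -(3 / (2 * ρ) * b) with hB
  have hB0 : B ≤ 0 := neg_nonpos.mpr (by positivity)
  set F := 2 * Real.exp |B| * Real.exp (K' / (σ * r₀)) *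
        (Real.exp (3 / (2 * ρ * (σ * r₀))) * (4 * ρ * σ / 3) +
          Real.exp (1 / (2 * ρ * (σ * r₀))) * (4 * ρ * σ)) with hF
  have key : ∀ r, r₀ ≤ r → ∀ y, IsNearUniform ρ K' y → ∀ ξ, 0 ≤ ξ →
      ∑' k, crossingCGF y (σ * r) (ξ * r) B k ≤ r * ((b * K' - B) / r₀ + F - b * ξ) := by
    intro r hr y hy ξ hξ
    have hr0 : 0 < r := by linarith
    have h1 := hy.tsum_crossingCGF_le hρ (mul_pos hσ hr0) hK'0 hB0 (mul_nonneg hξ hr0.le)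
    have hsr : σ * r₀ ≤ σ * r := mul_le_mul_of_nonneg_left hr hσ.le
    have e1 : 2 / (3 / (2 * ρ * (σ * r))) = r * (4 * ρ * σ / 3) := by field_simp; ring
    have e2 : 2 / (1 / (2 * ρ * (σ * r))) = r * (4 * ρ * σ) := by field_simp; ring
    have h2 : 2 * Real.exp |B| * Real.exp (K' / (σ * r)) *
        (Real.exp (3 / (2 * ρ * (σ * r))) * (2 / (3 / (2 * ρ * (σ * r)))) +
          Real.exp (1 / (2 * ρ * (σ * r))) * (2 / (1 / (2 * ρ * (σ * r))))) ≤ r * F := by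
      rw [e1, e2]
      have e3 : r * F = 2 * Real.exp |B| * Real.exp (K' / (σ * r₀)) *
        (Real.exp (3 / (2 * ρ * (σ * r₀))) * (r * (4 * ρ * σ / 3)) +
          Real.exp (1 / (2 * ρ * (σ * r₀))) * (r * (4 * ρ * σ))) := by
        rw [hF]
        ring
      rw [e3]
      have := mul_pos hσ hr₀
      gcongr
    have h3 : B * (2 * ρ / 3 * (ξ * r - K') - 1) = b * K' - B - r * (b * ξ) := by
      rw [hB]
      field_simp
      ring
    have h4 : b * K' - B ≤ r * ((b * K' - B) / r₀) := by
      rw [mul_div_assoc', le_div_iff₀ hr₀, mul_comm]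
      exact mul_le_mul_of_nonneg_right hr (by nlinarith [mul_nonneg hb hK'0])
    nlinarith
  refine ⟨(b * K' - B) / r₀ + F, fun r hr y V hy hV ξ hξ => ⟨?_, ?_⟩⟩
  · have hr0 : 0 < r := by linarith
    have hS := hV.isIndepSummable hρ (mul_pos hσ hr0) hy (ξ * r)
    have h1 := prob_le_of_nonneg_exponent (nullMeasurableSet_lt hS.aemeasurable_tsum
      aemeasurable_const) (hS.integrable_exp_tsum B) fun ω (hω : _ < 0) =>
        mul_nonneg_of_nonpos_of_nonpos hB0 hω.le
    refine h1.trans ?_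
    rw [show ∫ ω, Real.exp (B * ∑' k, crossing (fun k => y k + V k ω) (ξ * r) k) ∂P = _ from
      hV.integral_exp_flow hρ (mul_pos hσ hr0) hy (ξ * r) B, Real.exp_le_exp]
    exact key r hr y (fun k => (hy k).trans (by linarith)) ξ hξ
  · have hr0 : 0 < r := by linarith
    have hS := hV.isIndepSummable hρ (mul_pos hσ hr0) hy (-ξ * r)
    have h1 := prob_le_of_nonneg_exponent (nullMeasurableSet_le aemeasurable_const
      hS.aemeasurable_tsum) (hS.integrable_exp_tsum (-B)) fun ω (hω : 0 ≤ _) =>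
        mul_nonneg (neg_nonneg.mpr hB0) hω
    refine h1.trans ?_
    rw [show ∫ ω, Real.exp (-B * ∑' k, crossing (fun k => y k + V k ω) (-ξ * r) k) ∂P = _ from
      hV.integral_exp_flow hρ (mul_pos hσ hr0) hy (-ξ * r) (-B), Real.exp_le_exp,
      ← tsum_crossingCGF_reflect, neg_neg, neg_mul, neg_neg]
    exact key r hr _ (hy.reflect hρ) ξ hξ

end UniformUpper

/-! ### Exponential moments from exponential tails -/

section ExponentialMoments

/-- Exponential tails on the lattice give exponential moments. -/
lemma exists_integral_exp_le_of_tail (b C : ℝ) (hb : 0 ≤ b) {r₀ : ℝ} (hr₀ : 0 < r₀) :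
    ∃ D, ∀ r, r₀ ≤ r → ∀ ν : Measure ℝ, IsProbabilityMeasure ν →
      (∀ n : ℕ, ν.real (Ioi (n : ℝ)) ≤ Real.exp (r * (C - (b + 1) * n)) ∧
        ν.real (Iic (-(n : ℝ))) ≤ Real.exp (r * (C - (b + 1) * n))) →
      ∀ c, |c| ≤ b → Integrable (fun x => Real.exp (c * r * x)) ν ∧
        ∫ x, Real.exp (c * r * x) ∂ν ≤ Real.exp (r * D) := by
  -- On the shell `n < |x| ≤ n + 1` the weight times the tail is of order `e^(r (b + C)) e^(-r n)`,
  -- a geometric sequence of ratio at most `q`; the factor `2` in `M` counts the two sides.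
  set q := Real.exp (-r₀) with hq
  have hq1 : q < 1 := Real.exp_lt_one_iff.mpr (neg_lt_zero.mpr hr₀)
  have hq0 : 0 < q := Real.exp_pos _
  set M := 2 * (1 - q)⁻¹ with hM
  have hM0 : 0 < M := mul_pos two_pos (inv_pos.mpr (sub_pos.mpr hq1))
  -- The second term absorbs the constant `1 + M` into the exponent, which is possible because `r ≥
  -- r₀`.
  refine ⟨|b + C| + Real.log (1 + M) / r₀, fun r hr ν _ hν c hc => ?_⟩
  have hr0 : 0 < r := by linarith
  have h1 : ∀ x : ℝ, ENNReal.ofReal (Real.exp (c * r * x)) ≤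
      1 + ∑' n : ℕ, ENNReal.ofReal (Real.exp (b * r * (n + 1))) *
        (Ioi (n : ℝ) ∪ Iic (-(n : ℝ))).indicator 1 x := by
    intro x
    have hcx : c * r * x ≤ b * r * |x| := by
      calc c * r * x ≤ |c * r * x| := le_abs_self _
        _ = |c| * r * |x| := by rw [abs_mul, abs_mul, abs_of_pos hr0]
        _ ≤ _ := by gcongr
    rcases eq_or_ne x 0 with rfl | hx
    · simp
    · have hx0 : 0 < |x| := abs_pos.mpr hx
      refine le_trans ?_ le_add_self
      set m := ⌈|x|⌉₊ - 1 with hm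
      have hpos : 0 < ⌈|x|⌉₊ := Nat.ceil_pos.mpr hx0
      have hm1 : (m : ℝ) + 1 = ⌈|x|⌉₊ := by
        rw [hm]
        exact_mod_cast Nat.sub_add_cancel hpos
      have hlt : (m : ℝ) < |x| := by
        have := Nat.ceil_lt_add_one hx0.le
        linarith
      have hle : |x| ≤ m + 1 := by
        rw [hm1]
        exact Nat.le_ceil _
      refine le_trans ?_ (ENNReal.le_tsum m)
      have hmem : x ∈ Ioi (m : ℝ) ∪ Iic (-(m : ℝ)) := by
        rcases lt_abs.mp hlt with h | h
        · exact Or.inl h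
        · exact Or.inr (mem_Iic.mpr (by linarith))
      rw [indicator_of_mem hmem, Pi.one_apply, mul_one]
      refine ENNReal.ofReal_le_ofReal (Real.exp_le_exp.mpr (hcx.trans ?_))
      gcongr
  have h2 : ∀ n : ℕ, ν (Ioi (n : ℝ) ∪ Iic (-(n : ℝ))) ≤
      ENNReal.ofReal (2 * Real.exp (r * (C - (b + 1) * n))) := by
    intro n
    refine (measure_union_le _ _).trans ?_
    rw [← ofReal_measureReal, ← ofReal_measureReal, ← ENNReal.ofReal_add (by positivity)
      (by positivity)]
    exact ENNReal.ofReal_le_ofReal (by linarith [(hν n).1, (hν n).2])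
  have h3 : ∀ n : ℕ, ENNReal.ofReal (Real.exp (b * r * (n + 1))) *
      ν (Ioi (n : ℝ) ∪ Iic (-(n : ℝ))) ≤
      ENNReal.ofReal (2 * Real.exp (r * (b + C)) * q ^ n) := by
    intro n
    refine (mul_le_mul_right (h2 n) _).trans ?_
    rw [← ENNReal.ofReal_mul (Real.exp_pos _).le]
    refine ENNReal.ofReal_le_ofReal ?_
    rw [hq, ← Real.exp_nat_mul, mul_left_comm, mul_assoc 2, ← Real.exp_add, ← Real.exp_add]
    refine mul_le_mul_of_nonneg_left (Real.exp_le_exp.mpr ?_) zero_le_two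
    have : r₀ * n ≤ r * n := by gcongr
    nlinarith
  have h4 : ∫⁻ x, ENNReal.ofReal (Real.exp (c * r * x)) ∂ν ≤
      ENNReal.ofReal (1 + Real.exp (r * (b + C)) * M) := by
    refine (lintegral_mono h1).trans ?_
    rw [lintegral_add_left measurable_const, lintegral_const, measure_univ, one_mul,
      lintegral_tsum fun n => ((measurable_one.indicator
        (measurableSet_Ioi.union measurableSet_Iic)).const_mul _).aemeasurable]
    have h5 : ∀ n : ℕ, ∫⁻ x, ENNReal.ofReal (Real.exp (b * r * (n + 1))) *
        (Ioi (n : ℝ) ∪ Iic (-(n : ℝ))).indicator 1 x ∂ν ≤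
        ENNReal.ofReal (2 * Real.exp (r * (b + C)) * q ^ n) := fun n => by
      rw [lintegral_const_mul _ (measurable_one.indicator
        (measurableSet_Ioi.union measurableSet_Iic)),
        lintegral_indicator_one (measurableSet_Ioi.union measurableSet_Iic)]
      exact h3 n
    have hgs := (hasSum_geometric_of_lt_one hq0.le hq1).mul_left (2 * Real.exp (r * (b + C)))
    refine (add_le_add le_rfl (ENNReal.tsum_le_tsum h5)).trans (le_of_eq ?_)
    rw [← ENNReal.ofReal_tsum_of_nonneg (fun n => by positivity) hgs.summable, hgs.tsum_eq,
      ← ENNReal.ofReal_one, ← ENNReal.ofReal_add zero_le_one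
        (mul_nonneg (by positivity) (inv_nonneg.mpr (sub_nonneg.mpr hq1.le)))]
    rw [hM]
    ring_nf
  have hmeas : AEStronglyMeasurable (fun x => Real.exp (c * r * x)) ν :=
    Measurable.aestronglyMeasurable (by fun_prop)
  refine ⟨⟨hmeas, ?_⟩, ?_⟩
  · rw [hasFiniteIntegral_iff_ofReal (ae_of_all _ fun x => (Real.exp_pos _).le)]
    exact h4.trans_lt ENNReal.ofReal_lt_top
  · rw [integral_eq_lintegral_of_nonneg_ae (ae_of_all _ fun x => (Real.exp_pos _).le) hmeas]
    refine (ENNReal.toReal_mono ENNReal.ofReal_ne_top h4).trans ?_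
    rw [ENNReal.toReal_ofReal (by positivity), mul_add r |b + C|, Real.exp_add]
    have h6 : 1 ≤ Real.exp (r * |b + C|) := Real.one_le_exp (by positivity)
    have h7 : Real.exp (r * (b + C)) ≤ Real.exp (r * |b + C|) :=
      Real.exp_le_exp.mpr (mul_le_mul_of_nonneg_left (le_abs_self _) hr0.le)
    have h8 : 1 + M ≤ Real.exp (r * (Real.log (1 + M) / r₀)) := by
      nth_rw 1 [← Real.exp_log (by linarith : 0 < 1 + M)]
      rw [Real.exp_le_exp, mul_div_assoc', le_div_iff₀ hr₀, mul_comm]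
      exact mul_le_mul_of_nonneg_right hr (Real.log_nonneg (by linarith))
    calc 1 + Real.exp (r * (b + C)) * M ≤ Real.exp (r * |b + C|) * (1 + M) := by nlinarith
      _ ≤ _ := mul_le_mul_of_nonneg_left h8 (Real.exp_pos _).le

/-- The exponential moments of opposite sign bound each other from below. -/
lemma one_le_integral_exp_mul {ν : Measure ℝ} [IsProbabilityMeasure ν] {c : ℝ}
    (h1 : Integrable (fun x => Real.exp (c * x)) ν)
    (h2 : Integrable (fun x => Real.exp (-c * x)) ν) :
    1 ≤ (∫ x, Real.exp (c * x) ∂ν) * ∫ x, Real.exp (-c * x) ∂ν := by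
  set A := ∫ x, Real.exp (-c * x) ∂ν with hA
  have hA0 : 0 < A := integral_exp_pos h2
  -- The pointwise arithmetic–geometric inequality; the weights `A` and `A⁻¹` make the second
  -- integral equal to `1`.
  have h3 : ∫ _, (2 : ℝ) ∂ν ≤ ∫ x, (A * Real.exp (c * x) + A⁻¹ * Real.exp (-c * x)) ∂ν := by
    refine integral_mono (integrable_const _) ((h1.const_mul _).add (h2.const_mul _)) fun x => ?_
    have e : Real.exp (c * x) * Real.exp (-c * x) = 1 := by rw [← Real.exp_add]; simp
    have e2 : A * A⁻¹ = 1 := mul_inv_cancel₀ hA0.ne'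
    have e3 : (A * Real.exp (c * x)) * (A⁻¹ * Real.exp (-c * x)) = 1 := by
      rw [mul_mul_mul_comm, e, e2, one_mul]
    have := mul_pos hA0 (Real.exp_pos (c * x))
    have := mul_pos (inv_pos.mpr hA0) (Real.exp_pos (-c * x))
    change (2 : ℝ) ≤ A * Real.exp (c * x) + A⁻¹ * Real.exp (-c * x)
    nlinarith [sq_nonneg (A * Real.exp (c * x) - A⁻¹ * Real.exp (-c * x))]
  rw [integral_add (h1.const_mul _) (h2.const_mul _), integral_const_mul, integral_const_mul,
    ← hA, inv_mul_cancel₀ hA0.ne', integral_const, probReal_univ, one_smul] at h3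
  linarith

end ExponentialMoments

/-! ### A lower bound that is uniform over the initial configuration -/

section UniformLower

variable {Ω : Type*} [MeasurableSpace Ω] {P : Measure Ω} [IsProbabilityMeasure P]
  {ρ σ K s : ℝ} {y : ℤ → ℝ} {V : ℤ → Ω → ℝ}

/-- Independent events with summable probabilities can be avoided simultaneously. -/
lemma IsFreeNoise.exp_le_prob_forall_notMem (hV : IsFreeNoise P s V) {S : ℤ → Set ℝ}
    (hS : ∀ k, MeasurableSet (S k)) {p : ℤ → ℝ} (hp : ∀ k, P.real {ω | V k ω ∈ S k} ≤ p k)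
    (hpsum : Summable p) {θ : ℝ} (hθ : θ < 1) (hpθ : ∀ k, P.real {ω | V k ω ∈ S k} ≤ θ) :
    Real.exp (-((∑' k, p k) / (1 - θ))) ≤ P.real {ω | ∀ k, V k ω ∉ S k} := by
  set p' : ℤ → ℝ := fun k => P.real {ω | V k ω ∈ S k} with hp'
  have hp'0 : ∀ k, 0 ≤ p' k := fun k => measureReal_nonneg
  have hp'sum : Summable p' := Summable.of_nonneg_of_le hp'0 hp hpsum
  set U : ℤ → Ω → ℝ := fun k ω => (S k).indicator 1 (V k ω) with hU
  have hUne : ∀ k ω, U k ω ≠ 0 ↔ V k ω ∈ S k := fun k ω => by simp [hU]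
  have hUS : IsIndepSummable P U :=
    { measurable := fun k => (measurable_one.indicator (hS k)).comp (hV.measurable k)
      indep := hV.indep.comp (fun k v => (S k).indicator 1 v) fun k =>
        measurable_one.indicator (hS k)
      abs_le_one := fun k ω => by
        by_cases h : V k ω ∈ S k <;> simp [hU, h]
      summable := by simpa only [hUne] using hp'sum }
  have hSm : ∀ k, MeasurableSet {ω | V k ω ∈ S k} := fun k => hV.measurable k (hS k)
  have hpos : ∀ (b : ℝ) k, 1 - p' k ≤ 1 + p' k * (Real.exp (-b) - 1) := fun b k => by
    nlinarith [hp'0 k, mul_nonneg (hp'0 k) (Real.exp_pos (-b)).le]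
  have h1p : ∀ k, 0 < 1 - p' k := fun k => by linarith [hpθ k]
  -- This is `ln (1 - p) ≥ -p / (1 - p)`; the bound `θ` keeps the denominator away from `0`
  -- uniformly.
  have hlow : ∀ (b : ℝ) k, -(p' k / (1 - θ)) ≤ Real.log (1 + p' k * (Real.exp (-b) - 1)) := by
    intro b k
    have h1 := Real.one_sub_inv_le_log_of_pos (h1p k)
    have h2 := Real.log_le_log (h1p k) (hpos b k)
    have h3 : 1 - (1 - p' k)⁻¹ = -(p' k / (1 - p' k)) := by
      have := (h1p k).ne'
      field_simp
      ring
    have h4 : p' k / (1 - p' k) ≤ p' k / (1 - θ) :=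
      div_le_div_of_nonneg_left (hp'0 k) (by linarith) (by linarith [hpθ k])
    linarith
  have hint : ∀ (b : ℝ) k, ∫ ω, Real.exp (-b * U k ω) ∂P =
      Real.exp (Real.log (1 + p' k * (Real.exp (-b) - 1))) := by
    intro b k
    rw [Real.exp_log ((h1p k).trans_le (hpos b k))]
    have h1 : ∀ ω, Real.exp (-b * U k ω) =
        1 + {ω | V k ω ∈ S k}.indicator (fun _ => Real.exp (-b) - 1) ω := by
      intro ω
      by_cases h : V k ω ∈ S k
      · simp [hU, h]
      · simp [hU, h]
    simp_rw [h1]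
    rw [integral_add (integrable_const _) ((integrable_const _).indicator (hSm k)),
      integral_indicator (hSm k), setIntegral_const]
    simp [hp']
  have hA : MeasurableSet {ω | ∀ k, V k ω ∉ S k} := by
    rw [ofPred_forall]
    exact MeasurableSet.iInter fun k => (hSm k).compl
  -- Each bad event is penalised by `e^(-b)`. The expectation factorises and is bounded below
  -- uniformly in `b`; as `b → ∞` only configurations without bad events remain.
  have key : ∀ b : ℝ, 0 ≤ b → Real.exp (-((∑' k, p k) / (1 - θ))) ≤
      P.real {ω | ∀ k, V k ω ∉ S k} + Real.exp (-b) := by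
    intro b hb
    have hsum : Summable fun k => Real.log (1 + p' k * (Real.exp (-b) - 1)) := by
      refine Summable.of_norm_bounded (hp'sum.mul_right (1 - θ)⁻¹) fun k => ?_
      rw [Real.norm_eq_abs, abs_of_nonpos]
      · have := hlow b k
        rw [div_eq_mul_inv] at this
        linarith
      · refine Real.log_nonpos ((h1p k).le.trans (hpos b k)) ?_
        have : Real.exp (-b) ≤ 1 := Real.exp_le_one_iff.mpr (by linarith)
        nlinarith [hp'0 k]
    have h1 := hUS.integral_exp_tsum (hint b) hsum
    have h2 : Real.exp (-((∑' k, p k) / (1 - θ))) ≤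
        Real.exp (∑' k, Real.log (1 + p' k * (Real.exp (-b) - 1))) := by
      rw [Real.exp_le_exp]
      have h3 := (hp'sum.div_const (1 - θ)).neg.tsum_le_tsum (hlow b) hsum
      rw [tsum_neg, tsum_div_const] at h3
      have h4 := div_le_div_of_nonneg_right (hp'sum.tsum_le_tsum hp hpsum)
        (by linarith : 0 ≤ 1 - θ)
      linarith
    rw [← h1] at h2
    refine h2.trans ?_
    have h5 : ∀ᵐ ω ∂P, Real.exp (-b * ∑' k, U k ω) ≤
        {ω | ∀ k, V k ω ∉ S k}.indicator (fun _ => (1 : ℝ)) ω + Real.exp (-b) := by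
      filter_upwards [hUS.ae_finite] with ω hω
      by_cases h : ω ∈ {ω | ∀ k, V k ω ∉ S k}
      · rw [indicator_of_mem h]
        have h0 : ∀ k, U k ω = 0 := fun k => not_not.mp fun hk => h k ((hUne k ω).mp hk)
        simp [h0, (Real.exp_pos (-b)).le]
      · rw [indicator_of_notMem h, zero_add, Real.exp_le_exp]
        simp only [mem_ofPred_eq, not_forall, not_not] at h
        obtain ⟨k, hk⟩ := h
        have hs : Summable fun k => U k ω := (hasSum_of_finite_support hω).summable
        have hUk : U k ω = 1 := by simp [hU, hk]
        have := hs.le_tsum k fun j _ =>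
          indicator_nonneg (fun _ _ => zero_le_one) _
        rw [hUk] at this
        nlinarith
    have h6 := integral_mono_ae (hUS.integrable_exp_tsum (-b))
      (((integrable_const (1 : ℝ)).indicator hA).add (integrable_const (Real.exp (-b)))) h5
    refine h6.trans (le_of_eq ?_)
    rw [integral_add' ((integrable_const (1 : ℝ)).indicator hA) (integrable_const _),
      integral_indicator hA, setIntegral_const]
    simp
  have hlim : Tendsto (fun b : ℝ => P.real {ω | ∀ k, V k ω ∉ S k} + Real.exp (-b)) atTop
      (𝓝 (P.real {ω | ∀ k, V k ω ∉ S k} + 0)) :=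
    tendsto_const_nhds.add (Real.tendsto_exp_neg_atTop_nhds_zero)
  rw [add_zero] at hlim
  exact ge_of_tendsto hlim ((eventually_ge_atTop 0).mono key)

lemma crossing_mono (z : ℤ → ℝ) {a b : ℝ} (hab : a ≤ b) (k : ℤ) :
    crossing z a k ≤ crossing z b k := by
  unfold crossing
  split_ifs <;> linarith

/-- The increments of the distribution function of the tracer are bounded from below uniformly
over the initial configuration. -/
lemma exists_uniform_lower_bound (hρ : 0 < ρ) (hσ : 0 < σ) (hK : 0 ≤ K) {a b : ℝ} (hab : a < b)
    {r₀ : ℝ} (hr₀ : 0 < r₀) :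
    ∃ C, ∀ r, r₀ ≤ r → ∀ (y : ℤ → ℝ) (V : ℤ → Ω → ℝ), IsNearUniform ρ K y → Monotone y → y 0 = 0 →
      IsFreeNoise P (σ * r) V →
        Real.exp (-(C * r)) ≤ P.real {ω | 0 ≤ flow (fun k => y k + V k ω) (b * r)} -
          P.real {ω | 0 ≤ flow (fun k => y k + V k ω) (a * r)} := by
  set m := max |a| |b| with hm
  set M := 2 * Real.exp (K / (σ * r₀) + m / σ) * (Real.exp (1 / (2 * ρ * (σ * r₀))) *
    (4 * ρ * σ)) with hM
  -- As `y k ≥ 0` for `k ≥ 1` and `y k ≤ 0` for `k < 0`, the bad probabilities are at most those of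
  -- a particle started at the origin; the last entry concerns the tracer's own label.
  set θ := max (max (tailProb (-b / σ)) (tailProb (a / σ)))
    (1 - (tailProb (a / σ) - tailProb (b / σ))) with hθ
  have hlt : tailProb (b / σ) < tailProb (a / σ) :=
    strictAnti_tailProb (div_lt_div_of_pos_right hab hσ)
  have hθ1 : θ < 1 := max_lt (max_lt (tailProb_lt_one _) (tailProb_lt_one _)) (by linarith)
  refine ⟨(1 / r₀ + M) / (1 - θ), fun r hr y V hy hmono hy0 hV => ?_⟩
  have hr0 : 0 < r := by linarith
  have hs : 0 < σ * r := mul_pos hσ hr0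
  have hsr : σ * r₀ ≤ σ * r := mul_le_mul_of_nonneg_left hr hσ.le
  have hm0 : 0 ≤ m := (abs_nonneg a).trans (le_max_left _ _)
  have hc : 0 < 1 / (2 * ρ * (σ * r)) := by positivity
  -- If no displacement is in its bad set, labels `k ≥ 1` stay beyond `b r`, labels `k < 0` stay
  -- below `a r`, and label `0` lands in `(a r, b r]`. The flow is then `-1` at `a r` and
  -- nonnegative at `b r`.
  set S : ℤ → Set ℝ := fun k => if 1 ≤ k then Iic (b * r - y k) else
    if k = 0 then (Ioc (a * r) (b * r))ᶜ else Ioi (a * r - y k) with hSdef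
  have hSm : ∀ k, MeasurableSet (S k) := fun k => by
    simp only [hSdef]
    split_ifs
    exacts [measurableSet_Iic, measurableSet_Ioc.compl, measurableSet_Ioi]
  set D := 2 * Real.exp (K / (σ * r₀) + m / σ) with hD
  have hcross : ∀ x, |x| ≤ m → ∀ k, crossProb y (σ * r) (x * r) k ≤
      D * Real.exp (-(1 / (2 * ρ * (σ * r)) * |(k : ℝ) - 0|)) := by
    intro x hx k
    refine (hy.crossProb_le hρ hs (x * r) k).trans ?_
    refine mul_le_mul_of_nonneg_right ?_ (Real.exp_pos _).le
    refine mul_le_mul_of_nonneg_left (Real.exp_le_exp.mpr ?_) zero_le_two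
    rw [add_div]
    refine add_le_add (div_le_div_of_nonneg_left hK (mul_pos hσ hr₀) hsr) ?_
    rw [abs_mul, abs_of_pos hr0, mul_div_mul_right _ _ hr0.ne']
    exact div_le_div_of_nonneg_right hx hσ.le
  -- Label `0` has no small probability of being bad; it is charged `1`, which is at most `r / r₀`.
  set p : ℤ → ℝ := fun k => (if k = 0 then 1 else 0) +
    D * Real.exp (-(1 / (2 * ρ * (σ * r)) * |(k : ℝ) - 0|)) with hp
  have hs1 : HasSum (fun k : ℤ => if k = 0 then (1 : ℝ) else 0) 1 := hasSum_ite_eq 0 1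
  have hs2 := (summable_exp_neg_abs hc 0).mul_left D
  have hpsum : Summable p := hs1.summable.add hs2
  have hsum : ∑' k, p k ≤ r * (1 / r₀ + M) := by
    rw [hp, hs1.summable.tsum_add hs2, hs1.tsum_eq, tsum_mul_left, mul_add]
    refine add_le_add ?_ ?_
    · rw [mul_one_div, one_le_div hr₀]
      exact hr
    · have h1 := tsum_exp_neg_abs_le hc 0
      have e1 : r * M = D * (Real.exp (1 / (2 * ρ * (σ * r₀))) *
          (2 / (1 / (2 * ρ * (σ * r))))) := by
        rw [hM, hD]
        field_simp
        ring
      rw [e1]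
      refine mul_le_mul_of_nonneg_left (h1.trans ?_) (by positivity)
      have := mul_pos hσ hr₀
      gcongr
  have hpk : ∀ k, P.real {ω | V k ω ∈ S k} ≤ p k ∧ P.real {ω | V k ω ∈ S k} ≤ θ := by
    intro k
    have hexp := mul_pos (by positivity : 0 < D)
      (Real.exp_pos (-(1 / (2 * ρ * (σ * r)) * |(k : ℝ) - 0|)))
    by_cases hk : 1 ≤ k
    · have e : P.real {ω | V k ω ∈ S k} = crossProb y (σ * r) (b * r) k := by
        simp only [hSdef, if_pos hk, mem_Iic]
        rw [hV.compl_tail, neg_sub, crossProb, if_pos hk]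
      have hyk : 0 ≤ y k := by
        rw [← hy0]
        exact hmono (by omega)
      refine ⟨?_, ?_⟩
      · rw [e]
        simp only [hp]
        rw [if_neg (by omega : k ≠ 0), zero_add]
        exact hcross b (le_max_right _ _) k
      · rw [e, crossProb, if_pos hk]
        refine le_trans (strictAnti_tailProb.antitone ?_) ((le_max_left _ _).trans (le_max_left _ _))
        rw [← mul_div_mul_right _ _ hr0.ne']
        refine div_le_div_of_nonneg_right ?_ hs.le
        linarith
    · by_cases hk0 : k = 0
      · have e : P.real {ω | V k ω ∈ S k} = 1 - (tailProb (a / σ) - tailProb (b / σ)) := by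
          simp only [hSdef, if_neg hk, if_pos hk0]
          have h1 : {ω | V k ω ∈ (Ioc (a * r) (b * r))ᶜ} =
              {ω | V k ω ≤ a * r} ∪ {ω | b * r < V k ω} := by
            ext ω
            simp only [mem_ofPred_eq, mem_compl_iff, mem_Ioc, mem_union]
            grind
          rw [h1, measureReal_union, hV.tail, hV.compl_tail, mul_div_mul_right _ _ hr0.ne',
            ← neg_mul, mul_div_mul_right _ _ hr0.ne', neg_div, tailProb_neg]
          · ring
          · rw [Set.disjoint_left]
            intro ω h2 h3
            have : a * r < b * r := mul_lt_mul_of_pos_right hab hr0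
            simp only [mem_ofPred_eq] at h2 h3
            linarith
          · exact measurableSet_lt measurable_const (hV.measurable k)
        refine ⟨?_, e.le.trans (le_max_right _ _)⟩
        rw [e]
        simp only [hp, if_pos hk0]
        linarith
      · have e : P.real {ω | V k ω ∈ S k} = crossProb y (σ * r) (a * r) k := by
          simp only [hSdef, if_neg hk, if_neg hk0, mem_Ioi]
          rw [hV.tail, crossProb, if_neg hk]
        have hyk : y k ≤ 0 := by
          rw [← hy0]
          exact hmono (by omega)
        refine ⟨?_, ?_⟩
        · rw [e]
          simp only [hp]
          rw [if_neg hk0, zero_add]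
          exact hcross a (le_max_left _ _) k
        · rw [e, crossProb, if_neg hk]
          refine le_trans (strictAnti_tailProb.antitone ?_)
            ((le_max_right _ _).trans (le_max_left _ _))
          rw [← mul_div_mul_right _ _ hr0.ne']
          refine div_le_div_of_nonneg_right ?_ hs.le
          linarith
  have hlow := hV.exp_le_prob_forall_notMem hSm (fun k => (hpk k).1) hpsum hθ1 fun k => (hpk k).2
  have hSa := hV.isIndepSummable hρ hs hy (a * r)
  have hSb := hV.isIndepSummable hρ hs hy (b * r)
  have hle : P.real {ω | 0 ≤ flow (fun k => y k + V k ω) (a * r)} +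
      P.real {ω | ∀ k, V k ω ∉ S k} ≤ P.real {ω | 0 ≤ flow (fun k => y k + V k ω) (b * r)} := by
    have hdisj : Disjoint {ω | 0 ≤ flow (fun k => y k + V k ω) (a * r)}
        {ω | ∀ k, V k ω ∉ S k} := by
      rw [Set.disjoint_left]
      intro ω h1 h2
      have h3 : flow (fun k => y k + V k ω) (a * r) = -1 := by
        rw [flow, tsum_eq_single 0]
        · have h0 := h2 0
          simp only [hSdef] at h0
          norm_num at h0
          simp [crossing, hy0, h0.1]
        · intro k hk0
          have h4 := h2 k
          simp only [hSdef] at h4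
          unfold crossing
          by_cases hk : 1 ≤ k
          · rw [if_pos hk] at h4 ⊢
            have : a * r < b * r := mul_lt_mul_of_pos_right hab hr0
            rw [if_neg]
            simp only [mem_Iic] at h4
            linarith
          · rw [if_neg hk, if_neg hk0] at h4
            rw [if_neg hk, if_neg]
            simp only [mem_Ioi] at h4
            linarith
      rw [mem_ofPred_eq, h3] at h1
      norm_num at h1
    have hA : MeasurableSet {ω | ∀ k, V k ω ∉ S k} := by
      rw [ofPred_forall]
      exact MeasurableSet.iInter fun k => (hV.measurable k (hSm k)).compl
    rw [← measureReal_union hdisj hA]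
    refine ENNReal.toReal_mono (measure_ne_top _ _) (measure_mono_ae ?_)
    filter_upwards [hSa.ae_finite, hSb.ae_finite] with ω ha hb hω
    rcases hω with h1 | h1
    · refine le_trans (mem_ofPred_eq.mp h1 : 0 ≤ flow _ _) ?_
      exact (hasSum_of_finite_support ha).summable.tsum_le_tsum
        (fun k => crossing_mono _ (mul_lt_mul_of_pos_right hab hr0).le k)
        (hasSum_of_finite_support hb).summable
    · refine tsum_nonneg fun k => ?_
      have h4 := h1 k
      simp only [hSdef] at h4
      unfold crossing
      by_cases hk : 1 ≤ k
      · rw [if_pos hk]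
        split_ifs <;> simp
      · rw [if_neg hk] at h4 ⊢
        rw [if_neg]
        split_ifs at h4 with hk0
        · simp only [mem_compl_iff, not_not, mem_Ioc] at h4
          subst hk0
          simp only [hy0, zero_add, not_lt]
          exact h4.2
        · have : a * r < b * r := mul_lt_mul_of_pos_right hab hr0
          simp only [mem_Ioi] at h4
          linarith
  have h7 : Real.exp (-((1 / r₀ + M) / (1 - θ) * r)) ≤ Real.exp (-((∑' k, p k) / (1 - θ))) := by
    rw [Real.exp_le_exp, neg_le_neg_iff, div_mul_eq_mul_div, mul_comm]
    exact div_le_div_of_nonneg_right hsum (by linarith)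
  linarith

end UniformLower

/-! ### The tracer and the flow -/

section Pathwise

/-- All but the `2 N + 1` central particles are at distance more than `M`, on the correct side. -/
def IsSpread (N : ℕ) (M : ℝ) (z : ℤ → ℝ) : Prop :=
  ∀ k : ℤ, ((N : ℤ) < k → M < z k) ∧ (k < -(N : ℤ) → z k < -M)

/-- The contribution of particle `k` to the mass transported through the step `h`. -/
def stepCharge (h : ℝ → ℝ) (z : ℤ → ℝ) (k : ℤ) : ℝ := h (z k) - if 1 ≤ k then 0 else 1

lemma crossing_eq_stepCharge (z : ℤ → ℝ) (x : ℝ) :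
    crossing z x = stepCharge (fun v => if v ≤ x then 1 else 0) z := by
  funext k
  unfold crossing stepCharge
  by_cases hk : 1 ≤ k <;> by_cases hz : z k ≤ x <;> simp [hk, hz, ← not_le]

variable {N : ℕ} {M : ℝ} {z : ℤ → ℝ} {h : ℝ → ℝ}

lemma IsSpread.stepCharge_eq_zero (hz : IsSpread N M z) (h1 : ∀ v, v < -M → h v = 1)
    (h0 : ∀ v, M < v → h v = 0) {k : ℤ} (hk : k ∉ Finset.Icc (-(N : ℤ)) N) :
    stepCharge h z k = 0 := by
  rw [Finset.mem_Icc, not_and_or, not_le, not_le] at hk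
  unfold stepCharge
  rcases hk with hk | hk
  · rw [h1 _ ((hz k).2 hk), if_neg (by omega), sub_self]
  · rw [h0 _ ((hz k).1 hk), if_pos (by omega), sub_self]

lemma IsSpread.tsum_stepCharge (hz : IsSpread N M z) (h1 : ∀ v, v < -M → h v = 1)
    (h0 : ∀ v, M < v → h v = 0) :
    ∑' k, stepCharge h z k = ∑ k ∈ Finset.Icc (-(N : ℤ)) N, stepCharge h z k :=
  tsum_eq_sum fun _ hk => hz.stepCharge_eq_zero h1 h0 hk

/-- A relabelling of the particles changes the transported mass by an integer which does not depend
on the shape of the step. -/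
lemma IsSpread.exists_charge (hz : IsSpread N M z) (π : Equiv.Perm ℤ)
    (hX : IsSpread N M fun j => z (π j)) :
    ∃ n : ℤ, ∀ h : ℝ → ℝ, (∀ v, v < -M → h v = 1) → (∀ v, M < v → h v = 0) →
      ∑' k, stepCharge h (fun j => z (π j)) k - ∑' k, stepCharge h z k = n := by
  -- Contains every index that contributes to either sum, the second one being reindexed by `π`.
  -- Over this set the values of `h` cancel and only label counts remain.
  set S : Finset ℤ := Finset.Icc (-(N : ℤ)) N ∪ (Finset.Icc (-(N : ℤ)) N).image π.symm with hS
  refine ⟨∑ j ∈ S, ((if 1 ≤ π j then 0 else 1) - if 1 ≤ j then 0 else 1), fun h h1 h0 => ?_⟩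
  have e1 : ∑' k, stepCharge h (fun j => z (π j)) k =
      ∑ k ∈ S, stepCharge h (fun j => z (π j)) k := tsum_eq_sum fun k hk =>
    hX.stepCharge_eq_zero h1 h0 fun h => hk (Finset.mem_union_left _ h)
  have e2 : ∑' k, stepCharge h z k = ∑ k ∈ S, stepCharge h z (π k) := by
    rw [← π.tsum_eq]
    refine tsum_eq_sum fun k hk => hz.stepCharge_eq_zero h1 h0 fun h => hk ?_
    exact Finset.mem_union_right _ (Finset.mem_image.mpr ⟨π k, h, π.symm_apply_apply k⟩)
  rw [e1, e2, ← Finset.sum_sub_distrib]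
  push_cast
  refine Finset.sum_congr rfl fun k _ => ?_
  unfold stepCharge
  ring

/-- An ordered relabelling of a spread configuration is spread. -/
lemma IsSpread.of_monotone {m : ℝ} (hz : IsSpread N (max M m) z) (π : Equiv.Perm ℤ)
    (hmono : Monotone fun j => z (π j)) (h1 : -m ≤ z (π 1)) (h0 : z (π 0) ≤ m) :
    IsSpread (2 * N + 1) M fun j => z (π j) := by
  have hM : M ≤ max M m := le_max_left _ _
  have hm : m ≤ max M m := le_max_right _ _
  -- At most `2 N + 1` particles of the spread configuration are in the central window. If a far
  -- ordered label were on the wrong side, monotonicity would trap all labels between it and `0` or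
  -- `1` in that window, which is too many.
  have key : ∀ I : Finset ℤ, (∀ j ∈ I, -max M m ≤ z (π j) ∧ z (π j) ≤ max M m) →
      I.card ≤ 2 * N + 1 := by
    intro I hI
    have h2 : I.image π ⊆ Finset.Icc (-(N : ℤ)) N := by
      intro k hk
      obtain ⟨j, hj, rfl⟩ := Finset.mem_image.mp hk
      rw [Finset.mem_Icc]
      constructor
      · by_contra! hlt
        linarith [(hz _).2 hlt, (hI j hj).1]
      · by_contra! hlt
        linarith [(hz _).1 hlt, (hI j hj).2]
    have h3 := Finset.card_le_card h2
    rw [Finset.card_image_of_injective _ π.injective, Int.card_Icc] at h3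
    omega
  intro j
  constructor
  · intro hj
    by_contra! hle
    have := key (Finset.Icc 1 j) fun i hi => by
      rw [Finset.mem_Icc] at hi
      exact ⟨by linarith [hmono hi.1], by linarith [hmono hi.2]⟩
    rw [Int.card_Icc] at this
    omega
  · intro hj
    by_contra! hle
    have := key (Finset.Icc j 0) fun i hi => by
      rw [Finset.mem_Icc] at hi
      exact ⟨by linarith [hmono hi.1], by linarith [hmono hi.2]⟩
    rw [Int.card_Icc] at this
    omega

lemma IsSpread.mono {N' : ℕ} {M' : ℝ} (hz : IsSpread N M z) (hN : N ≤ N') (hM : M' ≤ M) :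
    IsSpread N' M' z := fun k =>
  ⟨fun hk => hM.trans_lt ((hz k).1 (by omega)), fun hk => by
    have := (hz k).2 (by omega)
    linarith⟩

lemma IsSpread.finite_crossing (hz : IsSpread N M z) {x : ℝ} (hx : |x| ≤ M) :
    {k | crossing z x k ≠ 0}.Finite := by
  refine (Finset.finite_toSet (Finset.Icc (-(N : ℤ)) N)).subset fun k hk => ?_
  by_contra hk'
  refine hk ?_
  rw [crossing_eq_stepCharge]
  refine hz.stepCharge_eq_zero (fun v hv => if_pos ?_) (fun v hv => if_neg ?_) hk'
  · linarith [neg_abs_le x]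
  · linarith [le_abs_self x]

variable {X Z : ℤ → ℝ≥0 → ℝ}

/-- Continuity bounds the ordered particles `0` and `1` on the compact time interval. This pins the
ordered labels, so that one `N` works for both systems up to time `T`. -/
lemma exists_isSpread_pair (hX : ∀ j, Continuous (X j)) (hmono : ∀ s, Monotone fun j => X j s)
    (hperm : ∀ s, ∃ π : Equiv.Perm ℤ, ∀ j, X j s = Z (π j) s)
    (hspread : ∀ (T : ℝ≥0) (M : ℝ), ∃ N, ∀ s ≤ T, IsSpread N M fun k => Z k s) (T : ℝ≥0) (M : ℝ) :
    ∃ N, ∀ s ≤ T, IsSpread N M (fun k => Z k s) ∧ IsSpread N M fun k => X k s := by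
  obtain ⟨m₀, hm₀⟩ := (isCompact_Icc (a := 0) (b := T)).exists_bound_of_continuousOn
    (hX 0).continuousOn
  obtain ⟨m₁, hm₁⟩ := (isCompact_Icc (a := 0) (b := T)).exists_bound_of_continuousOn
    (hX 1).continuousOn
  obtain ⟨N, hN⟩ := hspread T (max M (max m₀ m₁))
  refine ⟨2 * N + 1, fun s hs => ⟨(hN s hs).mono (by omega) (le_max_left _ _), ?_⟩⟩
  obtain ⟨π, hπ⟩ := hperm s
  have hm := hmono s
  have h0 := hm₀ s ⟨zero_le, hs⟩
  have h1 := hm₁ s ⟨zero_le, hs⟩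
  rw [Real.norm_eq_abs, abs_le] at h0 h1
  simp only [hπ] at hm h0 h1 ⊢
  refine (hN s hs).of_monotone π hm ?_ ?_
  · linarith [h1.1, le_max_right m₀ m₁]
  · linarith [h0.2, le_max_left m₀ m₁]

lemma exists_tsum_stepCharge_sub_eq (hX : ∀ j, Continuous (X j))
    (hmono : ∀ s, Monotone fun j => X j s)
    (hperm : ∀ s, ∃ π : Equiv.Perm ℤ, ∀ j, X j s = Z (π j) s)
    (hspread : ∀ (T : ℝ≥0) (M : ℝ), ∃ N, ∀ s ≤ T, IsSpread N M fun k => Z k s) (s : ℝ≥0) (M : ℝ) :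
    ∃ n : ℤ, ∀ h : ℝ → ℝ, (∀ v, v < -M → h v = 1) → (∀ v, M < v → h v = 0) →
      ∑' k, stepCharge h (fun k => X k s) k - ∑' k, stepCharge h (fun k => Z k s) k = n := by
  obtain ⟨N, hN⟩ := exists_isSpread_pair hX hmono hperm hspread s M
  obtain ⟨π, hπ⟩ := hperm s
  have h1 := hN s le_rfl
  simp only [hπ] at h1 ⊢
  exact h1.1.exists_charge π h1.2

/-- No mass is transported from the free particles to the ordered ones. -/
lemma tsum_stepCharge_eq (hX : ∀ j, Continuous (X j)) (hZ : ∀ j, Continuous (Z j))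
    (hmono : ∀ s, Monotone fun j => X j s)
    (hperm : ∀ s, ∃ π : Equiv.Perm ℤ, ∀ j, X j s = Z (π j) s) (hstart : ∀ j, X j 0 = Z j 0)
    (hspread : ∀ (T : ℝ≥0) (M : ℝ), ∃ N, ∀ s ≤ T, IsSpread N M fun k => Z k s)
    (h : ℝ → ℝ) (M : ℝ) (h1 : ∀ v, v < -M → h v = 1) (h0 : ∀ v, M < v → h v = 0) (s : ℝ≥0) :
    ∑' k, stepCharge h (fun k => X k s) k = ∑' k, stepCharge h (fun k => Z k s) k := by
  -- A continuous step, so that the discrepancy `D` is continuous in time; the indicator needed in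
  -- the end is not.
  set f : ℝ → ℝ := fun v => max 0 (min 1 (-v)) with hf
  have hfc : Continuous f := by fun_prop
  have hf1 : ∀ M, 1 ≤ M → ∀ v, v < -M → f v = 1 := fun M hM v hv => by
    simp only [hf]
    rw [min_eq_left (by linarith), max_eq_right zero_le_one]
  have hf0 : ∀ M, 1 ≤ M → ∀ v, M < v → f v = 0 := fun M hM v hv => by
    simp only [hf]
    rw [min_eq_right (by linarith), max_eq_left (by linarith)]
  set D : ℝ≥0 → ℝ := fun s =>
    ∑' k, stepCharge f (fun k => X k s) k - ∑' k, stepCharge f (fun k => Z k s) k with hD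
  have hDint : ∀ s, ∃ n : ℤ, D s = n := fun s => by
    obtain ⟨n, hn⟩ := exists_tsum_stepCharge_sub_eq hX hmono hperm hspread s 1
    exact ⟨n, hn f (hf1 1 le_rfl) (hf0 1 le_rfl)⟩
  have hDc : Continuous D := by
    rw [continuous_iff_continuousAt]
    intro t
    -- Near `t` both series reduce to the same finite set of labels, and finite sums of continuous
    -- functions are continuous.
    obtain ⟨N, hN⟩ := exists_isSpread_pair hX hmono hperm hspread (t + 1) 1
    have hc : Continuous fun s => ∑ k ∈ Finset.Icc (-(N : ℤ)) N, stepCharge f (fun k => X k s) k -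
        ∑ k ∈ Finset.Icc (-(N : ℤ)) N, stepCharge f (fun k => Z k s) k := by
      unfold stepCharge
      refine Continuous.sub (continuous_finsetSum _ fun k _ => ?_)
        (continuous_finsetSum _ fun k _ => ?_)
      · exact (hfc.comp (hX k)).sub continuous_const
      · exact (hfc.comp (hZ k)).sub continuous_const
    refine hc.continuousAt.congr ?_
    filter_upwards [Iic_mem_nhds (lt_add_one t)] with s hs
    have h2 := hN s hs
    rw [← h2.1.tsum_stepCharge (hf1 1 le_rfl) (hf0 1 le_rfl),
      ← h2.2.tsum_stepCharge (hf1 1 le_rfl) (hf0 1 le_rfl)]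
  choose n hn using hDint
  have hnc : Continuous n := by
    rw [Int.isClosedEmbedding_coe_real.isEmbedding.continuous_iff]
    exact hDc.congr hn
  have hD0 : D 0 = 0 := by
    simp only [hD, hstart, sub_self]
  have hDs : D s = 0 := by
    -- A continuous integer-valued function of time is constant; the time half-line is parametrised
    -- by the connected real line.
    have h2 : Continuous fun r : ℝ => n r.toNNReal := hnc.comp continuous_real_toNNReal
    have h3 := PreconnectedSpace.constant inferInstance h2 (x := (s : ℝ)) (y := 0)
    simp only [Real.toNNReal_coe, Real.toNNReal_zero] at h3
    rw [hn, h3, ← hn, hD0]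
  -- The integer `m` is common to all steps, so its vanishing for `f` transfers to the possibly
  -- discontinuous `h`.
  obtain ⟨m, hm⟩ := exists_tsum_stepCharge_sub_eq hX hmono hperm hspread s (max M 1)
  have hm0 := hm f (hf1 _ (le_max_right _ _)) (hf0 _ (le_max_right _ _))
  have hmh := hm h (fun v hv => h1 v (by linarith [le_max_left M 1]))
    (fun v hv => h0 v (by linarith [le_max_left M 1]))
  rw [← hm0] at hmh
  linarith [hmh, hDs]

/-- The tracer is to the left of `x` if and only if the net flow of the free particles through `x`
is nonnegative. -/
lemma tracer_le_iff (hX : ∀ j, Continuous (X j)) (hZ : ∀ j, Continuous (Z j))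
    (hmono : ∀ s, Monotone fun j => X j s)
    (hperm : ∀ s, ∃ π : Equiv.Perm ℤ, ∀ j, X j s = Z (π j) s) (hstart : ∀ j, X j 0 = Z j 0)
    (hspread : ∀ (T : ℝ≥0) (M : ℝ), ∃ N, ∀ s ≤ T, IsSpread N M fun k => Z k s) (s : ℝ≥0) (x : ℝ) :
    X 0 s ≤ x ↔ 0 ≤ flow (fun k => Z k s) x := by
  have h1 : flow (fun k => Z k s) x = ∑' k, crossing (fun k => X k s) x k := by
    rw [flow, crossing_eq_stepCharge, crossing_eq_stepCharge]
    refine (tsum_stepCharge_eq hX hZ hmono hperm hstart hspread _ |x| (fun v hv => if_pos ?_)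
      (fun v hv => if_neg ?_) s).symm
    · linarith [neg_abs_le x]
    · linarith [le_abs_self x]
  obtain ⟨N, hN⟩ := exists_isSpread_pair hX hmono hperm hspread s |x|
  have hfin := (hN s le_rfl).2.finite_crossing le_rfl
  rw [h1]
  -- For an ordered configuration the flow has a sign: if `X 0 s ≤ x`, no label `k ≤ 0` contributes
  -- `-1`; if `X 0 s > x`, no label `k ≥ 1` contributes and label `0` gives `-1`.
  constructor
  · intro hx
    refine tsum_nonneg fun k => ?_
    unfold crossing
    split_ifs with hk h2 h3
    · exact zero_le_one
    · exact le_rfl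
    · have := hmono s (by omega : k ≤ 0)
      simp only at this h3
      linarith
    · exact le_rfl
  · intro h2
    by_contra! hx
    have h3 : ∀ k, crossing (fun k => X k s) x k ≤ 0 := by
      intro k
      unfold crossing
      split_ifs with hk h4
      · have := hmono s (by omega : 0 ≤ k)
        simp only at this h4
        linarith
      · exact le_rfl
      · norm_num
      · exact le_rfl
    have h4 : crossing (fun k => X k s) x 0 = -1 := by simp [crossing, hx]
    have h5 := (hasSum_of_finite_support hfin).summable.neg.le_tsum 0 fun j _ =>
      neg_nonneg.mpr (h3 j)
    rw [h4, tsum_neg] at h5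
    linarith

end Pathwise

/-! ### Brownian paths -/

section Brownian

variable {Ω : Type*} [MeasurableSpace Ω] {P : Measure Ω}

/-- From `e^η ≥ η⁴ / 4!`. The fourth power makes increment probabilities quadratic in the time step,
which beats the number of dyadic intervals; the constant is `2 · 4!`. -/
lemma tailProb_le_inv_pow {η : ℝ} (hη : 0 < η) : tailProb η ≤ 48 / η ^ 4 := by
  refine (tailProb_le_exp η).trans ?_
  have h1 := Real.pow_div_factorial_le_exp η hη.le 4
  rw [Real.exp_neg, ← div_eq_mul_inv, div_le_div_iff₀ (Real.exp_pos _) (by positivity)]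
  norm_num [Nat.factorial] at h1
  linarith

lemma prob_lt_abs_sub_le {B : ℝ≥0 → Ω → ℝ} (hB : IsBrownianReal B P) {s t : ℝ≥0} (hst : s < t)
    {u : ℝ} (hu : 0 < u) :
    P {ω | u < |B t ω - B s ω|} ≤ ENNReal.ofReal (384 * ((t : ℝ) - s) ^ 2 / u ^ 4) := by
  set v : ℝ≥0 := t - s with hv
  have hv0 : v ≠ 0 := (tsub_pos_of_lt hst).ne'
  have hvr : (v : ℝ) = t - s := NNReal.coe_sub hst.le
  have hvpos : (0 : ℝ) < v := by positivity
  have hlaw : HasLaw (B t - B s) (gaussianReal 0 v) P := by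
    have h := hB.hasLaw_sub t s
    have e : nndist t.1 s.1 = v := by
      rw [← NNReal.coe_inj, coe_nndist, Real.dist_eq, hvr]
      exact abs_of_pos (sub_pos.mpr (NNReal.coe_lt_coe.mpr hst))
    rwa [e] at h
  have hlaw' : HasLaw (-(B t - B s)) (gaussianReal 0 v) P := by
    simpa using gaussianReal_neg hlaw
  have hgauss : gaussianReal 0 v (Ioi u) ≤ ENNReal.ofReal (192 * (v : ℝ) ^ 2 / u ^ 4) := by
    rw [← ofReal_measureReal, gaussianReal_real_Ioi hv0]
    refine ENNReal.ofReal_le_ofReal ((tailProb_le_inv_pow (by positivity)).trans (le_of_eq ?_))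
    rw [div_pow, show √(2 * (v : ℝ)) ^ 4 = (√(2 * (v : ℝ)) ^ 2) ^ 2 by ring,
      Real.sq_sqrt (by positivity)]
    field_simp
    norm_num
  have hsub : {ω | u < |B t ω - B s ω|} ⊆ (B t - B s) ⁻¹' Ioi u ∪ (-(B t - B s)) ⁻¹' Ioi u := by
    intro ω hω
    rcases lt_abs.mp (mem_ofPred_eq.mp hω : u < |B t ω - B s ω|) with h | h
    · exact Or.inl h
    · exact Or.inr h
  refine (measure_mono hsub).trans ((measure_union_le _ _).trans ?_)
  rw [← Measure.map_apply_of_aemeasurable hlaw.aemeasurable measurableSet_Ioi, hlaw.map_eq,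
    ← Measure.map_apply_of_aemeasurable hlaw'.aemeasurable measurableSet_Ioi, hlaw'.map_eq, ← hvr]
  refine (add_le_add hgauss hgauss).trans ?_
  rw [← ENNReal.ofReal_add (by positivity) (by positivity)]
  exact ENNReal.ofReal_le_ofReal (le_of_eq (by ring))

/-- The dyadic points of order `n` of `[0, T]`. -/
def dyadic (T : ℝ≥0) (n j : ℕ) : ℝ≥0 := T * (j / 2 ^ n)

lemma dyadic_succ_two_mul (T : ℝ≥0) (n j : ℕ) : dyadic T (n + 1) (2 * j) = dyadic T n j := by
  unfold dyadic
  congr 1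
  push_cast
  rw [pow_succ']
  exact mul_div_mul_left _ _ two_ne_zero

/-- The chaining argument. -/
lemma abs_le_tsum_of_dyadic {f : ℝ≥0 → ℝ} (hf : Continuous f) (hf0 : f 0 = 0) {T : ℝ≥0}
    (hT : 0 < T) {r : ℕ → ℝ} (hr : Summable r) (hr0 : ∀ n, 0 ≤ r n)
    (h : ∀ n j, j < 2 ^ n → |f (dyadic T n (j + 1)) - f (dyadic T n j)| ≤ r n) {s : ℝ≥0}
    (hs : s ≤ T) : |f s| ≤ ∑' n, r n := by
  -- An even dyadic point belongs to the previous generation, and an odd one is a single increment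
  -- away from such a point.
  have key : ∀ n j, j ≤ 2 ^ n → |f (dyadic T n j)| ≤ ∑ i ∈ Finset.range (n + 1), r i := by
    intro n
    induction n with
    | zero =>
      intro j hj
      rw [zero_add, Finset.sum_range_one]
      have h00 : f (dyadic T 0 0) = 0 := by simp [dyadic, hf0]
      rcases Nat.le_one_iff_eq_zero_or_eq_one.mp hj with rfl | rfl
      · rw [h00, abs_zero]
        exact hr0 0
      · have := h 0 0 (by norm_num)
        rwa [h00, sub_zero] at this
    | succ n ih =>
      intro j hj
      rw [Finset.sum_range_succ]
      rcases Nat.even_or_odd' j with ⟨i, rfl | rfl⟩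
      · rw [dyadic_succ_two_mul]
        have := ih i (by rw [pow_succ'] at hj; omega)
        linarith [hr0 (n + 1)]
      · have h1 := ih i (by rw [pow_succ'] at hj; omega)
        have h2 := h (n + 1) (2 * i) (by omega)
        rw [dyadic_succ_two_mul] at h2
        have h3 := abs_sub_abs_le_abs_sub (f (dyadic T (n + 1) (2 * i + 1))) (f (dyadic T n i))
        linarith
  have hlim : Tendsto (fun n : ℕ => dyadic T n ⌊(s / T : ℝ) * 2 ^ n⌋₊) atTop (𝓝 s) := by
    rw [← NNReal.tendsto_coe]
    have h1 := (tendsto_nat_floor_mul_div_atTop (R := ℝ) (a := s / T) (by positivity)).comp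
      (tendsto_pow_atTop_atTop_of_one_lt (one_lt_two (α := ℝ)))
    have h2 := h1.const_mul (T : ℝ)
    have hT' : (T : ℝ) ≠ 0 := by exact_mod_cast hT.ne'
    rw [mul_div_cancel₀ _ hT'] at h2
    refine h2.congr fun n => ?_
    simp [dyadic]
  have hlim2 := ((hf.tendsto s).comp hlim).abs
  refine le_of_tendsto hlim2 (Eventually.of_forall fun n => ?_)
  refine (key n _ ?_).trans (hr.sum_le_tsum _ fun i _ => hr0 i)
  have h1 : (s / T : ℝ) * 2 ^ n ≤ ((2 ^ n : ℕ) : ℝ) := by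
    push_cast
    refine mul_le_of_le_one_left (by positivity) ?_
    rw [div_le_one (by exact_mod_cast hT)]
    exact_mod_cast hs
  exact Nat.floor_le_of_le h1

/-- A maximal inequality. -/
lemma exists_prob_sup_abs_le {T : ℝ≥0} (hT : 0 < T) :
    ∃ C : ℝ, ∀ B : ℝ≥0 → Ω → ℝ, IsBrownianReal B P → ∀ a : ℝ, 0 < a →
      ∃ E : Set Ω, P E ≤ ENNReal.ofReal (C / a ^ 4) ∧
        ∀ᵐ ω ∂P, ω ∉ E → ∀ s ≤ T, |B s ω| ≤ 10 * a := by
  have hTr : (0 : ℝ) < T := by exact_mod_cast hT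
  -- Generation `n` has `2 ^ n` increments of duration `T / 2 ^ n` and threshold `a (9/10) ^ n`, so
  -- the union bound has ratio `q`, less than `1` because `(9/10)⁴ > 1/2`. The thresholds sum to `10
  -- a`.
  set q : ℝ := 1 / (2 * (9 / 10) ^ 4) with hq
  have hq0 : 0 ≤ q := by positivity
  have hq1 : q < 1 := by rw [hq]; norm_num
  refine ⟨384 * T ^ 2 * (1 - q)⁻¹, fun B hB a ha => ?_⟩
  refine ⟨⋃ n : ℕ, ⋃ j ∈ Finset.range (2 ^ n),
    {ω | a * (9 / 10) ^ n < |B (dyadic T n (j + 1)) ω - B (dyadic T n j) ω|}, ?_, ?_⟩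
  · have h1 : ∀ n : ℕ, P (⋃ j ∈ Finset.range (2 ^ n),
        {ω | a * (9 / 10) ^ n < |B (dyadic T n (j + 1)) ω - B (dyadic T n j) ω|}) ≤
        ENNReal.ofReal (384 * T ^ 2 / a ^ 4 * q ^ n) := by
      intro n
      refine (measure_biUnion_finset_le _ _).trans ?_
      have h2 : ∀ j ∈ Finset.range (2 ^ n),
          P {ω | a * (9 / 10) ^ n < |B (dyadic T n (j + 1)) ω - B (dyadic T n j) ω|} ≤
          ENNReal.ofReal (384 * (T / 2 ^ n) ^ 2 / (a * (9 / 10) ^ n) ^ 4) := by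
        intro j _
        have h3 : dyadic T n j < dyadic T n (j + 1) := by
          unfold dyadic
          gcongr
          linarith
        have h4 := prob_lt_abs_sub_le hB h3 (by positivity : 0 < a * (9 / 10) ^ n)
        have h5 : ((dyadic T n (j + 1) : ℝ≥0) : ℝ) - dyadic T n j = T / 2 ^ n := by
          simp only [dyadic]
          push_cast
          field_simp
          ring
        rwa [h5] at h4
      refine (Finset.sum_le_sum h2).trans (le_of_eq ?_)
      rw [Finset.sum_const, Finset.card_range, nsmul_eq_mul, ← ENNReal.ofReal_natCast,
        ← ENNReal.ofReal_mul (by positivity)]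
      congr 1
      rw [hq, one_div, inv_pow, mul_pow 2, mul_pow a, ← pow_mul, ← pow_mul, mul_comm n 4]
      push_cast
      field_simp
    have hgs := (hasSum_geometric_of_lt_one hq0 hq1).mul_left (384 * T ^ 2 / a ^ 4 : ℝ)
    refine (measure_iUnion_le _).trans ((ENNReal.tsum_le_tsum h1).trans (le_of_eq ?_))
    rw [← ENNReal.ofReal_tsum_of_nonneg (fun n => by positivity) hgs.summable, hgs.tsum_eq]
    congr 1
    ring
  · filter_upwards [hB.cont, hB.eval_zero_ae_eq_zero] with ω hc h0 hE s hs
    have hgs := (hasSum_geometric_of_lt_one (r := (9 / 10 : ℝ)) (by norm_num)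
      (by norm_num)).mul_left a
    have h1 := abs_le_tsum_of_dyadic hc h0 hT hgs.summable (fun n => by positivity)
      (fun n j hj => ?_) hs
    · rw [hgs.tsum_eq] at h1
      norm_num at h1
      linarith
    · by_contra! hlt
      exact hE (mem_iUnion.mpr ⟨n, mem_iUnion₂.mpr ⟨j, Finset.mem_range.mpr hj, hlt⟩⟩)

lemma summable_inv_abs_add_one_pow_four : Summable fun k : ℤ => 1 / (|(k : ℝ)| + 1) ^ 4 := by
  have h : Summable fun n : ℕ => 1 / ((n : ℝ) + 1) ^ 4 := by
    have := (summable_nat_add_iff 1).mpr (Real.summable_one_div_nat_pow.mpr (by norm_num : 1 < 4))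
    simpa using this
  refine Summable.of_nat_of_neg ?_ ?_
  · simpa using h
  · simpa using h

/-- Infinitely many Brownian paths grow sublinearly with the label, uniformly on bounded time
intervals. -/
lemma ae_exists_abs_le_of_brownian {W : ℤ → ℝ≥0 → Ω → ℝ} (hW : ∀ k, IsBrownianReal (W k) P)
    {ε : ℝ} (hε : 0 < ε) {T : ℝ≥0} (hT : 0 < T) :
    ∀ᵐ ω ∂P, ∃ C, ∀ k, ∀ s ≤ T, |W k s ω| ≤ ε * |(k : ℝ)| + C := by
  obtain ⟨C, hC⟩ := exists_prob_sup_abs_le (P := P) hT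
  -- The threshold grows linearly in `|k|`, so the exceptional probabilities are of order `|k|^(-4)`
  -- and Borel–Cantelli applies.
  choose E hE1 hE2 using fun k : ℤ => hC (W k) (hW k) (ε / 10 * (|(k : ℝ)| + 1)) (by positivity)
  have hsum : ∑' k, P (E k) ≠ ⊤ := by
    have h1 : ∀ k, P (E k) ≤ ENNReal.ofReal (|C| / (ε / 10) ^ 4 * (1 / (|(k : ℝ)| + 1) ^ 4)) := by
      intro k
      refine (hE1 k).trans (ENNReal.ofReal_le_ofReal ?_)
      rw [mul_pow, div_mul_div_comm, mul_one]
      exact div_le_div_of_nonneg_right (le_abs_self C) (by positivity)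
    exact ne_top_of_le_ne_top (summable_inv_abs_add_one_pow_four.mul_left _).tsum_ofReal_ne_top
      (ENNReal.tsum_le_tsum h1)
  filter_upwards [ae_finite_setOfPred_mem hsum, ae_all_iff.mpr hE2,
    ae_all_iff.mpr fun k => (hW k).cont] with ω hfin hgood hcont
  have hb : ∀ k, ∃ c, ∀ s ∈ Icc 0 T, ‖W k s ω‖ ≤ c := fun k =>
    isCompact_Icc.exists_bound_of_continuousOn (hcont k).continuousOn
  choose c hc using hb
  -- The finitely many exceptional paths are bounded on `[0, T]` by continuity; their bounds are
  -- added to the constant.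
  refine ⟨ε + ∑ k ∈ hfin.toFinset, |c k|, fun k s hs => ?_⟩
  have hsum0 : 0 ≤ ∑ k ∈ hfin.toFinset, |c k| := Finset.sum_nonneg fun _ _ => abs_nonneg _
  have hk0 : 0 ≤ ε * |(k : ℝ)| := by positivity
  by_cases hk : ω ∈ E k
  · have h1 := hc k s ⟨zero_le, hs⟩
    rw [Real.norm_eq_abs] at h1
    have h2 := Finset.single_le_sum (f := fun k => |c k|) (fun _ _ => abs_nonneg _)
      (hfin.mem_toFinset.mpr hk)
    linarith [le_abs_self (c k)]
  · have h1 := hgood k hk s hs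
    linarith

end Brownian

/-! ### The path-by-path comparison for the single file -/

section SingleFilePaths

variable {Ω : Type*} [MeasurableSpace Ω] {P : Measure Ω} {ρ σ : ℝ} {y : Ω → ℤ → ℝ}
  {W X : ℤ → ℝ≥0 → Ω → ℝ}

lemma isSpread_of_growth (hρ : 0 < ρ) {z : ℤ → ℝ} {K : ℝ}
    (hz : ∀ k : ℤ, |z k - k / ρ| ≤ |(k : ℝ)| / (2 * ρ) + K) {N : ℕ} {M : ℝ}
    (hN : 2 * ρ * (M + K) ≤ N) : IsSpread N M z := by
  intro k
  have h1 := abs_le.mp (hz k)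
  have h2 : (k : ℝ) / ρ = 2 * (k / (2 * ρ)) := by field_simp
  have h3 : M + K ≤ N / (2 * ρ) := by
    rw [le_div_iff₀ (by positivity)]
    linarith
  constructor
  · intro hk
    have hk' : (N : ℝ) < k := by exact_mod_cast hk
    have hk0 : (0 : ℝ) < k := (Nat.cast_nonneg N).trans_lt hk'
    rw [abs_of_pos hk0] at h1
    have h4 : (N : ℝ) / (2 * ρ) < k / (2 * ρ) := div_lt_div_of_pos_right hk' (by positivity)
    linarith [h1.1]
  · intro hk
    have hk' : (k : ℝ) < -N := by exact_mod_cast hk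
    have hk0 : (k : ℝ) < 0 := by linarith [(Nat.cast_nonneg N : (0 : ℝ) ≤ N)]
    rw [abs_of_neg hk0, neg_div] at h1
    have h4 : (k : ℝ) / (2 * ρ) < -N / (2 * ρ) := div_lt_div_of_pos_right hk' (by positivity)
    rw [neg_div] at h4
    linarith [h1.2]

/-- Almost surely, at all times, the tracer is to the left of `x` if and only if the net flow of
the free particles through `x` is nonnegative. -/
lemma ae_tracer_le_iff (hρ : 0 < ρ) (hσ : 0 < σ) (hy : IsQuenchedUniform P ρ y)
    (hmono : ∀ᵐ ω ∂P, ∀ s, Monotone fun j => X j s ω)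
    (hcont : ∀ᵐ ω ∂P, ∀ j, Continuous fun s => X j s ω)
    (hstart : ∀ᵐ ω ∂P, ∀ j, X j 0 ω = y ω j) (hW : IsDrivingNoise P y W)
    (hcoll : ∀ᵐ ω ∂P, ∀ s, ∃ π : Equiv.Perm ℤ, ∀ j,
      X j s ω = y ω (π j) + σ / √2 * W (π j) s ω) :
    ∀ᵐ ω ∂P, ∀ s x, X 0 s ω ≤ x ↔ 0 ≤ flow (fun k => y ω k + σ / √2 * W k s ω) x := by
  have hc : 0 < σ / √2 := by positivity
  have hε : 0 < 1 / (4 * ρ) / (σ / √2) := by positivity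
  -- The allowed slope `1 / (2 ρ)` is shared equally between the initial positions and the Brownian
  -- displacements.
  obtain ⟨K, hK⟩ := hy.density (1 / (4 * ρ)) (by positivity)
  -- Natural numbers `T` suffice and keep the number of null sets countable, so the conclusion holds
  -- at all times simultaneously.
  have hgrowth : ∀ᵐ ω ∂P, ∀ T : ℕ, ∃ C, ∀ k, ∀ s ≤ ((T : ℝ≥0) + 1),
      |W k s ω| ≤ 1 / (4 * ρ) / (σ / √2) * |(k : ℝ)| + C :=
    ae_all_iff.mpr fun T => ae_exists_abs_le_of_brownian hW.brownian hε (by positivity)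
  filter_upwards [hmono, hcont, hstart, hcoll, hK, hgrowth, ae_all_iff.mpr fun k =>
    (hW.brownian k).cont, ae_all_iff.mpr fun k => (hW.brownian k).eval_zero_ae_eq_zero]
    with ω hmono hcont hstart hcoll hK hgrowth hWc hW0
  refine tracer_le_iff (X := fun j s => X j s ω) (Z := fun k s => y ω k + σ / √2 * W k s ω) hcont
    (fun k => ?_) hmono hcoll (fun j => ?_) fun T M => ?_
  · have := hWc k
    fun_prop
  · simp [hstart, hW0]
  · obtain ⟨n, hn⟩ := exists_nat_ge (T : ℝ≥0)
    obtain ⟨C, hC⟩ := hgrowth n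
    obtain ⟨N, hN⟩ := exists_nat_ge (2 * ρ * (M + (K + σ / √2 * C)))
    refine ⟨N, fun s hs => isSpread_of_growth hρ (fun k => ?_) hN⟩
    have h1 := hC k s (hs.trans (hn.trans (by simp)))
    have h2 := mul_le_mul_of_nonneg_left h1 hc.le
    rw [← abs_of_pos hc, ← abs_mul, abs_of_pos hc] at h2
    have h3 := abs_add_le (y ω k - k / ρ) (σ / √2 * W k s ω)
    rw [show y ω k - k / ρ + σ / √2 * W k s ω = y ω k + σ / √2 * W k s ω - k / ρ by ring] at h3
    have h4 : σ / √2 * (1 / (4 * ρ) / (σ / √2) * |(k : ℝ)| + C) =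
        1 / (4 * ρ) * |(k : ℝ)| + σ / √2 * C := by field_simp
    have h5 : |(k : ℝ)| / (2 * ρ) = 1 / (4 * ρ) * |(k : ℝ)| + 1 / (4 * ρ) * |(k : ℝ)| := by
      field_simp
      ring
    rw [h4] at h2
    linarith [hK k]

end SingleFilePaths

/-! ### The conditional law of the tracer -/

section ConditionalLaw

variable {Ω : Type*} [MeasurableSpace Ω] {P : Measure Ω} {ρ σ : ℝ} {y : Ω → ℤ → ℝ}
  {W X : ℤ → ℝ≥0 → Ω → ℝ}

/-- As a parametric integral the flow is measurable in the whole configuration, including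
configurations for which the series diverges. -/
lemma flow_eq_integral_count (z : ℤ → ℝ) (x : ℝ) :
    flow z x = ∫ k, crossing z x k ∂Measure.count := by
  by_cases h : Summable (crossing z x)
  · have h2 := integral_countable (integrable_count_iff.mpr (summable_norm_iff.mpr h))
    simp only [measureReal_def, Measure.count_singleton, ENNReal.toReal_one, one_smul] at h2
    exact h2.symm
  · rw [flow, tsum_eq_zero_of_not_summable h, integral_undef]
    rwa [integrable_count_iff, summable_norm_iff]

lemma measurable_flow (x : ℝ) : Measurable fun z : ℤ → ℝ => flow z x := by
  simp_rw [flow_eq_integral_count]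
  have h : Measurable fun p : (ℤ → ℝ) × ℤ => crossing p.1 x p.2 :=
    measurable_from_prod_countable_left fun k =>
      measurable_crossing (z := fun k (z : ℤ → ℝ) => z k) (measurable_pi_apply k) x
  exact h.stronglyMeasurable.integral_prod_right.measurable

lemma IsDrivingNoise.isFreeNoise (hσ : 0 < σ) (hW : IsDrivingNoise P y W) {t : ℝ≥0} (ht : 0 < t) :
    IsFreeNoise P (σ * √(t : ℝ)) fun k ω => σ / √2 * W k t ω where
  measurable k := (hW.measurable k t).const_mul _
  indep := hW.indep.comp (fun _ w => σ / √2 * w t) fun _ => (measurable_pi_apply t).const_mul _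
  tail k a := by
    have hc : 0 < σ / √2 := by positivity
    have htr : (0 : ℝ) < t := by exact_mod_cast ht
    have hlaw := (hW.brownian k).hasLaw_eval t
    have h1 : {ω | a < σ / √2 * W k t ω} = W k t ⁻¹' Ioi (a / (σ / √2)) := by
      ext ω
      simp only [mem_ofPred_eq, mem_preimage, mem_Ioi]
      rw [div_lt_iff₀' hc]
    rw [h1, ← map_measureReal_apply (hW.measurable k t) measurableSet_Ioi, hlaw.map_eq,
      gaussianReal_real_Ioi ht.ne', Real.sqrt_mul zero_le_two]
    congr 1
    have : 0 < √(t : ℝ) := Real.sqrt_pos.mpr htr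
    field_simp

lemma IsQuenchedUniform.exists_isNearUniform (hρ : 0 < ρ) (hy : IsQuenchedUniform P ρ y) :
    ∃ K, 0 ≤ K ∧ ∀ᵐ ω ∂P, IsNearUniform ρ K (y ω) := by
  obtain ⟨K, hK⟩ := hy.density (1 / (2 * ρ)) (by positivity)
  refine ⟨|K|, abs_nonneg K, ?_⟩
  filter_upwards [hK] with ω hω k
  refine (hω k).trans ?_
  rw [div_mul_eq_mul_div, one_mul]
  linarith [le_abs_self K]

/-- The null set may depend on `ε`; countably many values `1 / (n + 1)` are enough. -/
lemma IsQuenchedUniform.hasFlatProfile (hy : IsQuenchedUniform P ρ y) :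
    ∀ᵐ ω ∂P, HasFlatProfile ρ (y ω) := by
  have h : ∀ᵐ ω ∂P, ∀ n : ℕ, ∃ K : ℝ, ∀ j : ℤ,
      |y ω j - j / ρ| ≤ 1 / ((n : ℝ) + 1) * |(j : ℝ)| + K := by
    refine ae_all_iff.mpr fun n => ?_
    obtain ⟨K, hK⟩ := hy.density (1 / ((n : ℝ) + 1)) (by positivity)
    filter_upwards [hK] with ω hω
    exact ⟨K, hω⟩
  filter_upwards [h] with ω hω ε hε
  obtain ⟨n, hn⟩ := exists_nat_one_div_lt hε
  obtain ⟨K, hK⟩ := hω n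
  refine ⟨K, fun k => (hK k).trans ?_⟩
  gcongr

variable [IsProbabilityMeasure P]

lemma condDistrib_ae_eq_const {α β : Type*} [MeasurableSpace α] [MeasurableSpace β]
    [StandardBorelSpace β] [Nonempty β] {Y : Ω → α} {V : Ω → β} (hY : Measurable Y)
    (hV : Measurable V) (h : IndepFun Y V P) :
    condDistrib V Y P =ᵐ[P.map Y] Kernel.const α (P.map V) := by
  have := Measure.isProbabilityMeasure_map (μ := P) hV.aemeasurable
  refine condDistrib_ae_eq_of_measure_eq_compProd Y hV.aemeasurable ?_
  rw [Measure.compProd_const]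
  exact (indepFun_iff_map_prod_eq_prod_map_map hY.aemeasurable hV.aemeasurable).mp h

/-- Freezing: the event is a function of `y` and of the noise, and the noise is independent of `y`.
Conditioning therefore fixes `y` and averages over the noise alone. -/
lemma condDistrib_real_Iic_eq {N : Ω → ℝ} {V : ℤ → Ω → ℝ} (hy : Measurable y)
    (hN : Measurable N) (hV : ∀ k, Measurable (V k)) (hind : IndepFun y (fun ω k => V k ω) P)
    {c x : ℝ} (h : ∀ᵐ ω ∂P, N ω ≤ c ↔ 0 ≤ flow (fun k => y ω k + V k ω) x) :
    ∀ᵐ ω ∂P, (condDistrib N y P (y ω)).real (Iic c) =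
      P.real {ω' | 0 ≤ flow (fun k => y ω k + V k ω') x} := by
  have hVm : Measurable fun ω k => V k ω := measurable_pi_lambda _ hV
  have hF : Measurable fun p : (ℤ → ℝ) × (ℤ → ℝ) => flow (fun k => p.1 k + p.2 k) x :=
    (measurable_flow x).comp (by fun_prop)
  set A : Set ((ℤ → ℝ) × (ℤ → ℝ)) := {p | 0 ≤ flow (fun k => p.1 k + p.2 k) x} with hA
  have hAm : MeasurableSet A := measurableSet_le measurable_const hF
  have h1 := condDistrib_ae_eq_condExp (μ := P) hy hN (measurableSet_Iic (a := c))
  have h2 := condExp_prod_ae_eq_integral_condDistrib (μ := P) (f := A.indicator fun _ => (1 : ℝ))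
    hy hVm.aemeasurable (stronglyMeasurable_const.indicator hAm)
    ((integrable_const (1 : ℝ)).indicator (hy.prodMk hVm hAm))
  have h3 : P⟦N ⁻¹' Iic c | MeasurableSpace.comap y inferInstance⟧ =ᵐ[P]
      P[fun ω => A.indicator (fun _ => (1 : ℝ)) (y ω, fun k => V k ω) |
        MeasurableSpace.comap y inferInstance] := by
    refine condExp_congr_ae ?_
    filter_upwards [h] with ω hω
    by_cases h0 : N ω ≤ c
    · have h0' : (y ω, fun k => V k ω) ∈ A := hω.mp h0
      rw [indicator_of_mem h0', indicator_of_mem (by exact h0)]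
    · have h0' : (y ω, fun k => V k ω) ∉ A := fun h => h0 (hω.mpr h)
      rw [indicator_of_notMem h0', indicator_of_notMem (by exact h0)]
  have h4 := ae_of_ae_map hy.aemeasurable (condDistrib_ae_eq_const hy hVm hind)
  filter_upwards [h1, h2, h3, h4] with ω h1 h2 h3 h4
  have hsm : StronglyMeasurable fun v : ℤ → ℝ => A.indicator (fun _ => (1 : ℝ)) (y ω, v) :=
    (stronglyMeasurable_const.indicator hAm).comp_measurable measurable_prodMk_left
  rw [h1, h3, h2, h4, Kernel.const_apply, integral_map hVm.aemeasurable hsm.aestronglyMeasurable]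
  have hB : MeasurableSet {ω' | 0 ≤ flow (fun k => y ω k + V k ω') x} :=
    (measurable_prodMk_left.comp hVm : Measurable fun ω' => (y ω, fun k => V k ω')) hAm
  rw [← integral_indicator_one hB]
  rfl

/-- The conditional law of the rescaled tracer, given the initial configuration. -/
def tracerLaw (P : Measure Ω) [IsProbabilityMeasure P] (y : Ω → ℤ → ℝ) (X : ℤ → ℝ≥0 → Ω → ℝ)
    (t : ℝ≥0) : Kernel (ℤ → ℝ) ℝ :=
  condDistrib (fun ω => X 0 t ω / √(t : ℝ)) y P

instance (t : ℝ≥0) : IsMarkovKernel (tracerLaw P y X t) := by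
  unfold tracerLaw
  infer_instance

/-- Each `ξ` has its own null set, hence the restriction to rational `ξ`. The noise `V` does not
depend on the configuration, so all estimates for a deterministic `y` become available. -/
lemma exists_isFreeNoise_tracerLaw (hρ : 0 < ρ) (hσ : 0 < σ) (hy : IsQuenchedUniform P ρ y)
    (hX : IsSingleFile P σ y X) : ∃ V : ℝ≥0 → ℤ → Ω → ℝ, ∀ t : ℝ≥0, 0 < t →
      IsFreeNoise P (σ * √(t : ℝ)) (V t) ∧ ∀ᵐ ω ∂P, ∀ ξ : ℚ,
        (tracerLaw P y X t (y ω)).real (Iic (ξ : ℝ)) =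
          P.real {ω' | 0 ≤ flow (fun k => y ω k + V t k ω') (ξ * √(t : ℝ))} ∧
        (tracerLaw P y X t (y ω)).real (Ioi (ξ : ℝ)) =
          P.real {ω' | flow (fun k => y ω k + V t k ω') (ξ * √(t : ℝ)) < 0} := by
  obtain ⟨W, hW, hcoll⟩ := hX.collisions
  have hiff := ae_tracer_le_iff hρ hσ hy hX.ordered hX.continuous hX.start hW hcoll
  refine ⟨fun t k ω => σ / √2 * W k t ω, fun t ht => ?_⟩
  have hV := hW.isFreeNoise hσ ht
  have htr : (0 : ℝ) < √(t : ℝ) := Real.sqrt_pos.mpr (by exact_mod_cast ht)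
  refine ⟨hV, ?_⟩
  have hind : IndepFun y (fun ω k => σ / √2 * W k t ω) P :=
    hW.indep_initial.comp (φ := id) (ψ := fun (w : ℤ → ℝ≥0 → ℝ) k => σ / √2 * w k t)
      measurable_id (by fun_prop)
  have h1 : ∀ᵐ ω ∂P, ∀ ξ : ℚ, (tracerLaw P y X t (y ω)).real (Iic (ξ : ℝ)) =
      P.real {ω' | 0 ≤ flow (fun k => y ω k + σ / √2 * W k t ω') (ξ * √(t : ℝ))} := by
    refine ae_all_iff.mpr fun ξ => condDistrib_real_Iic_eq hy.measurable
      ((hX.measurable 0 t).div_const _) hV.measurable hind ?_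
    filter_upwards [hiff] with ω hω
    rw [← hω, div_le_iff₀ htr]
  filter_upwards [h1] with ω hω ξ
  refine ⟨hω ξ, ?_⟩
  have hm : MeasurableSet {ω' | 0 ≤ flow (fun k => y ω k + σ / √2 * W k t ω') (ξ * √(t : ℝ))} :=
    measurableSet_le measurable_const ((measurable_flow _).comp (measurable_pi_lambda _ fun k => by
      have := hV.measurable k
      fun_prop))
  have e1 : Ioi (ξ : ℝ) = (Iic (ξ : ℝ))ᶜ := compl_Iic.symm
  have e2 : {ω' | flow (fun k => y ω k + σ / √2 * W k t ω') (ξ * √(t : ℝ)) < 0} =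
      {ω' | 0 ≤ flow (fun k => y ω k + σ / √2 * W k t ω') (ξ * √(t : ℝ))}ᶜ := by
    ext
    simp
  rw [e1, e2, probReal_compl_eq_one_sub measurableSet_Iic, probReal_compl_eq_one_sub hm, hω]

/-- The upper bound comes from the uniform tails; the lower one from the moment of opposite sign.
Both are needed to dominate the logarithm. -/
lemma exists_uniform_moment_bound (hρ : 0 < ρ) (hσ : 0 < σ) (hy : IsQuenchedUniform P ρ y)
    (hX : IsSingleFile P σ y X) {r₀ : ℝ} (hr₀ : 0 < r₀) (b : ℕ) :
    ∃ D : ℝ, ∀ t : ℝ≥0, r₀ ≤ √(t : ℝ) → ∀ᵐ ω ∂P, ∀ c : ℝ, |c| ≤ b →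
      Integrable (fun x => Real.exp (c * √(t : ℝ) * x)) (tracerLaw P y X t (y ω)) ∧
      ∫ x, Real.exp (c * √(t : ℝ) * x) ∂(tracerLaw P y X t (y ω)) ≤ Real.exp (√(t : ℝ) * D) ∧
      Real.exp (-(√(t : ℝ) * D)) ≤
        ∫ x, Real.exp (c * √(t : ℝ) * x) ∂(tracerLaw P y X t (y ω)) := by
  obtain ⟨V, hV⟩ := exists_isFreeNoise_tracerLaw hρ hσ hy hX
  obtain ⟨K, hK0, hK⟩ := hy.exists_isNearUniform hρ
  obtain ⟨C, hC⟩ := exists_uniform_tail_bound (P := P) hρ hσ hK0 ((b : ℝ) + 1) (by positivity) hr₀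
  obtain ⟨D, hD⟩ := exists_integral_exp_le_of_tail (b : ℝ) C (by positivity) hr₀
  refine ⟨D, fun t ht => ?_⟩
  have ht0 : 0 < t := by
    have : (0 : ℝ) < t := Real.sqrt_pos.mp (hr₀.trans_le ht)
    exact_mod_cast this
  obtain ⟨hV1, hV2⟩ := hV t ht0
  filter_upwards [hK, hV2] with ω hKω hVω
  have h1 := hD (√(t : ℝ)) ht (tracerLaw P y X t (y ω)) inferInstance fun n => by
    have h2 := hC (√(t : ℝ)) ht (y ω) (V t) hKω hV1 n (by positivity)
    have h3 := (hVω n).2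
    have h4 := (hVω (-(n : ℚ))).1
    push_cast at h3 h4
    rw [h3, h4]
    exact h2
  intro c hc
  have h5 := h1 c hc
  have h6 := h1 (-c) (by rwa [abs_neg])
  refine ⟨h5.1, h5.2, ?_⟩
  have h7 := one_le_integral_exp_mul h5.1 (by simpa only [neg_mul] using h6.1)
  simp only [neg_mul] at h6 h7
  have h8 : 0 < ∫ x, Real.exp (c * √(t : ℝ) * x) ∂(tracerLaw P y X t (y ω)) :=
    integral_exp_pos h5.1
  have h9 := mul_le_mul_of_nonneg_left h6.2 h8.le
  rw [Real.exp_neg, inv_le_iff_one_le_mul₀ (Real.exp_pos _)]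
  exact h7.trans h9

lemma exists_uniform_open_bound (hρ : 0 < ρ) (hσ : 0 < σ) (hy : IsQuenchedUniform P ρ y)
    (hX : IsSingleFile P σ y X) {G : Set ℝ} (hG : IsOpen G) (hne : G.Nonempty) {r₀ : ℝ}
    (hr₀ : 0 < r₀) : ∃ C : ℝ, ∀ t : ℝ≥0, r₀ ≤ √(t : ℝ) → ∀ᵐ ω ∂P,
      Real.exp (-(C * √(t : ℝ))) ≤ (tracerLaw P y X t (y ω)).real G := by
  obtain ⟨V, hV⟩ := exists_isFreeNoise_tracerLaw hρ hσ hy hX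
  obtain ⟨K, hK0, hK⟩ := hy.exists_isNearUniform hρ
  obtain ⟨g, hg⟩ := hne
  obtain ⟨d, hd, hdG⟩ := Metric.isOpen_iff.mp hG g hg
  obtain ⟨b, hb1, hb2⟩ := exists_rat_btwn (show g < g + d by linarith)
  obtain ⟨a, ha1, ha2⟩ := exists_rat_btwn hb1
  obtain ⟨C, hC⟩ := exists_uniform_lower_bound (P := P) hρ hσ hK0 ha2 hr₀
  refine ⟨C, fun t ht => ?_⟩
  have ht0 : 0 < t := by
    have : (0 : ℝ) < t := Real.sqrt_pos.mp (hr₀.trans_le ht)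
    exact_mod_cast this
  obtain ⟨hV1, hV2⟩ := hV t ht0
  filter_upwards [hK, hV2, hy.strictMono, hy.origin] with ω hKω hVω hmono h0
  refine (hC (√(t : ℝ)) ht (y ω) (V t) hKω hmono.monotone h0 hV1).trans ?_
  rw [← (hVω a).1, ← (hVω b).1, ← measureReal_sdiff (Iic_subset_Iic.mpr ha2.le) measurableSet_Iic]
  refine measureReal_mono fun u hu => hdG ?_
  rw [Real.ball_eq_Ioo]
  simp only [Set.mem_sdiff, mem_Iic, not_le] at hu
  exact ⟨by linarith [hu.2], by linarith [hu.1]⟩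

lemma isEvenRate_ldf (hρ : 0 < ρ) (hσ : 0 < σ) : IsEvenRate (ldf ρ σ) where
  continuous := continuous_ldf ρ σ
  zero := ldf_zero hσ
  even := ldf_abs hσ
  strictMonoOn := ldf_strictMonoOn hρ hσ

/-- A sequence of times is used because each time has its own null set of initial configurations. -/
lemma ae_hasTailRates (hρ : 0 < ρ) (hσ : 0 < σ) (hy : IsQuenchedUniform P ρ y)
    (hX : IsSingleFile P σ y X) {u : ℕ → ℝ≥0} (hu0 : ∀ n, 0 < u n) (hu : Tendsto u atTop atTop) :
    ∀ᵐ ω ∂P, HasTailRates atTop (fun n => √(u n : ℝ)) (fun n => tracerLaw P y X (u n) (y ω))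
      (ldf ρ σ) := by
  obtain ⟨V, hV⟩ := exists_isFreeNoise_tracerLaw hρ hσ hy hX
  have hr : Tendsto (fun n => √(u n : ℝ)) atTop atTop :=
    Real.tendsto_sqrt_atTop.comp (NNReal.tendsto_coe_atTop.mpr hu)
  have hr0 : ∀ n, 0 < √(u n : ℝ) := fun n => Real.sqrt_pos.mpr (by exact_mod_cast hu0 n)
  filter_upwards [hy.hasFlatProfile, ae_all_iff.mpr fun n => (hV (u n) (hu0 n)).2] with ω hflat hω
  constructor
  · intro ξ hξ
    simp_rw [fun n => (hω n ξ).2]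
    exact logAsymp_flow_neg hρ hσ hflat hr0 hr (fun n => (hV (u n) (hu0 n)).1)
      (by exact_mod_cast hξ)
  · intro ξ hξ
    simp_rw [fun n => (hω n ξ).1]
    exact logAsymp_flow_nonneg hρ hσ hflat hr0 hr (fun n => (hV (u n) (hu0 n)).1)
      (by exact_mod_cast hξ)

end ConditionalLaw

/-! ### Averages over the initial configuration -/

section QuenchedAverages

/-- Reduces to sequences, where countably many null sets can be discarded; times at least `1` make
the uniform bounds applicable with `r₀ = 1`. -/
lemma tendsto_of_seq_one_le {f : ℝ≥0 → ℝ} {a : ℝ}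
    (h : ∀ u : ℕ → ℝ≥0, (∀ n, 1 ≤ u n) → Tendsto u atTop atTop →
      Tendsto (fun n => f (u n)) atTop (𝓝 a)) : Tendsto f atTop (𝓝 a) := by
  refine tendsto_of_seq_tendsto fun u hu => ?_
  obtain ⟨N, hN⟩ := eventually_atTop.mp (hu.eventually_ge_atTop 1)
  rw [← tendsto_add_atTop_iff_nat N]
  exact h (fun n => u (n + N)) (fun n => hN _ (by omega)) ((tendsto_add_atTop_iff_nat N).mpr hu)

lemma exp_tracer_eq {Ω : Type*} (X : ℤ → ℝ≥0 → Ω → ℝ) {t : ℝ≥0} (ht : 0 < t) (l : ℝ) (ω : Ω) :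
    Real.exp (l * X 0 t ω) = Real.exp (l * √(t : ℝ) * (X 0 t ω / √(t : ℝ))) := by
  have : 0 < √(t : ℝ) := Real.sqrt_pos.mpr (by exact_mod_cast ht)
  congr 1
  field_simp

variable {Ω : Type*} [MeasurableSpace Ω] {P : Measure Ω} {ρ σ : ℝ}
  {y : Ω → ℤ → ℝ} {X : ℤ → ℝ≥0 → Ω → ℝ}

lemma evolutionAvg_congr {f g : Ω → ℝ} (h : f =ᵐ[P] g) :
    evolutionAvg P y f =ᵐ[P] evolutionAvg P y g := condExp_congr_ae h

lemma aestronglyMeasurable_log_evolutionAvg (hy : Measurable y) (f : Ω → ℝ) :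
    AEStronglyMeasurable (fun ω => Real.log (evolutionAvg P y f ω)) P :=
  (Real.measurable_log.comp (stronglyMeasurable_condExp.measurable.mono hy.comap_le
    le_rfl)).aestronglyMeasurable

lemma tracer_zero_ae_eq (hy : IsQuenchedUniform P ρ y) (hX : IsSingleFile P σ y X) :
    ∀ᵐ ω ∂P, X 0 0 ω = 0 := by
  filter_upwards [hX.start, hy.origin] with ω h1 h2
  rw [h1, h2]

variable [IsProbabilityMeasure P]

/-- The bound on the conditional moments is uniform over configurations, so disintegration gives
integrability without conditioning. This must precede the use of the conditional expectation as an
integral. -/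
lemma integrable_exp_tracer (hρ : 0 < ρ) (hσ : 0 < σ) (hy : IsQuenchedUniform P ρ y)
    (hX : IsSingleFile P σ y X) {t : ℝ≥0} (ht : 0 < t) (l : ℝ) :
    Integrable (fun ω => Real.exp (l * X 0 t ω)) P := by
  have htr : 0 < √(t : ℝ) := Real.sqrt_pos.mpr (by exact_mod_cast ht)
  obtain ⟨b, hb⟩ := exists_nat_ge |l|
  obtain ⟨D, hD⟩ := exists_uniform_moment_bound hρ hσ hy hX htr b
  have h := hD t le_rfl
  have hN : AEMeasurable (fun ω => X 0 t ω / √(t : ℝ)) P :=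
    ((hX.measurable 0 t).div_const _).aemeasurable
  set f : (ℤ → ℝ) × ℝ → ℝ := fun p => Real.exp (l * √(t : ℝ) * p.2) with hf
  have hfm : StronglyMeasurable f := Measurable.stronglyMeasurable (by fun_prop)
  have hint : Integrable f (P.map fun ω => (y ω, X 0 t ω / √(t : ℝ))) := by
    rw [← hfm.aestronglyMeasurable.ae_integrable_condDistrib_map_iff hN]
    have hnorm : StronglyMeasurable fun a => ∫ u, ‖f (a, u)‖
        ∂(condDistrib (fun ω => X 0 t ω / √(t : ℝ)) y P a) := hfm.norm.integral_condDistrib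
    constructor
    · rw [ae_map_iff hy.measurable.aemeasurable 
        (measurableSet_kernel_integrable (f := fun a u => f (a, u)) hfm)]
      filter_upwards [h] with ω hω
      exact (hω l hb).1
    · rw [integrable_map_measure hnorm.aestronglyMeasurable hy.measurable.aemeasurable]
      refine Integrable.of_bound (C := Real.exp (√(t : ℝ) * D))
        (hnorm.comp_measurable hy.measurable).aestronglyMeasurable ?_
      filter_upwards [h] with ω hω
      rw [Function.comp_apply, Real.norm_of_nonneg (integral_nonneg fun _ => norm_nonneg _)]
      refine le_trans (le_of_eq ?_) (hω l hb).2.1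
      refine integral_congr_ae (ae_of_all _ fun u => ?_)
      exact Real.norm_of_nonneg (Real.exp_pos _).le
  rw [integrable_map_measure hfm.aestronglyMeasurable
    (hy.measurable.aemeasurable.prodMk hN)] at hint
  simp_rw [exp_tracer_eq X ht l]
  exact hint

lemma evolutionAvg_exp_ae_eq (hρ : 0 < ρ) (hσ : 0 < σ) (hy : IsQuenchedUniform P ρ y)
    (hX : IsSingleFile P σ y X) {t : ℝ≥0} (ht : 0 < t) (l : ℝ) :
    evolutionAvg P y (fun ω => Real.exp (l * X 0 t ω)) =ᵐ[P]
      fun ω => ∫ u, Real.exp (l * √(t : ℝ) * u) ∂(tracerLaw P y X t (y ω)) := by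
  have hint := integrable_exp_tracer hρ hσ hy hX ht l
  simp_rw [exp_tracer_eq X ht l] at hint ⊢
  exact condExp_ae_eq_integral_condDistrib (f := fun u => Real.exp (l * √(t : ℝ) * u))
    hy.measurable ((hX.measurable 0 t).div_const _).aemeasurable
    (Measurable.stronglyMeasurable (by fun_prop)) hint

lemma exists_abs_log_evolutionAvg_le (hρ : 0 < ρ) (hσ : 0 < σ) (hy : IsQuenchedUniform P ρ y)
    (hX : IsSingleFile P σ y X) {r₀ : ℝ} (hr₀ : 0 < r₀) (l : ℝ) :
    ∃ D : ℝ, ∀ t : ℝ≥0, r₀ ≤ √(t : ℝ) → ∀ᵐ ω ∂P,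
      |Real.log (evolutionAvg P y (fun ω => Real.exp (l * X 0 t ω)) ω)| ≤ √(t : ℝ) * D := by
  obtain ⟨b, hb⟩ := exists_nat_ge |l|
  obtain ⟨D, hD⟩ := exists_uniform_moment_bound hρ hσ hy hX hr₀ b
  refine ⟨D, fun t ht => ?_⟩
  have ht0 : 0 < t := by
    have : (0 : ℝ) < t := Real.sqrt_pos.mp (hr₀.trans_le ht)
    exact_mod_cast this
  filter_upwards [evolutionAvg_exp_ae_eq hρ hσ hy hX ht0 l, hD t ht] with ω h1 h2
  rw [h1]
  obtain ⟨h3, h4, h5⟩ := h2 l hb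
  have h6 := integral_exp_pos h3
  rw [abs_le, Real.le_log_iff_exp_le h6, Real.log_le_iff_le_exp h6]
  exact ⟨h5, h4⟩

lemma integrable_exp_and_log (hρ : 0 < ρ) (hσ : 0 < σ) (hy : IsQuenchedUniform P ρ y)
    (hX : IsSingleFile P σ y X) (l : ℝ) (t : ℝ≥0) :
    Integrable (fun ω => Real.exp (l * X 0 t ω)) P ∧
      Integrable (fun ω => Real.log
        (evolutionAvg P y (fun ω' => Real.exp (l * X 0 t ω')) ω)) P := by
  -- At time `0` rescaling by `√t` is meaningless, but the tracer is at the origin and the logarithm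
  -- is `0`.
  rcases eq_zero_or_pos t with rfl | ht
  · have h1 : (fun ω => Real.exp (l * X 0 0 ω)) =ᵐ[P] fun _ => 1 := by
      filter_upwards [tracer_zero_ae_eq hy hX] with ω hω
      simp [hω]
    refine ⟨(integrable_const 1).congr h1.symm, (integrable_zero Ω ℝ P).congr ?_⟩
    have h2 := evolutionAvg_congr (y := y) h1
    have h3 : evolutionAvg P y (fun _ => (1 : ℝ)) = fun _ => 1 :=
      condExp_const hy.measurable.comap_le 1
    rw [h3] at h2
    filter_upwards [h2] with ω hω
    simp [hω]
  · refine ⟨integrable_exp_tracer hρ hσ hy hX ht l, ?_⟩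
    obtain ⟨D, hD⟩ := exists_abs_log_evolutionAvg_le hρ hσ hy hX
      (Real.sqrt_pos.mpr (by exact_mod_cast ht) : 0 < √(t : ℝ)) l
    exact Integrable.of_bound (aestronglyMeasurable_log_evolutionAvg hy.measurable _) _
      (hD t le_rfl)

/-- The quenched cumulant generating function of the tracer at large times. -/
theorem tendsto_quenchedCGF_div (hρ : 0 < ρ) (hσ : 0 < σ) (hy : IsQuenchedUniform P ρ y)
    (hX : IsSingleFile P σ y X) (l : ℝ) :
    Tendsto (fun t : ℝ≥0 => quenchedCGF P y (X 0 t) l / √(t : ℝ)) atTop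
      (𝓝 (limitCGF ρ σ l)) := by
  refine tendsto_of_seq_one_le fun u hu1 hu => ?_
  have hu0 : ∀ n, 0 < u n := fun n => one_pos.trans_le (hu1 n)
  have hsq : ∀ n, 1 ≤ √(u n : ℝ) := fun n => Real.one_le_sqrt.mpr (by exact_mod_cast hu1 n)
  have hr : Tendsto (fun n => √(u n : ℝ)) atTop atTop :=
    Real.tendsto_sqrt_atTop.comp (NNReal.tendsto_coe_atTop.mpr hu)
  obtain ⟨D, hD⟩ := exists_abs_log_evolutionAvg_le hρ hσ hy hX one_pos l
  have hmom : ∀ b : ℕ, ∃ D : ℝ, ∀ n, ∀ᵐ ω ∂P, ∀ c : ℝ, |c| ≤ b →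
      Integrable (fun x => Real.exp (c * √(u n : ℝ) * x)) (tracerLaw P y X (u n) (y ω)) ∧
      ∫ x, Real.exp (c * √(u n : ℝ) * x) ∂(tracerLaw P y X (u n) (y ω)) ≤
        Real.exp (√(u n : ℝ) * D) := by
    intro b
    obtain ⟨D, hD⟩ := exists_uniform_moment_bound hρ hσ hy hX one_pos b
    refine ⟨D, fun n => ?_⟩
    filter_upwards [hD (u n) (hsq n)] with ω hω c hc
    exact ⟨(hω c hc).1, (hω c hc).2.1⟩
  choose E hE using hmom
  -- For almost every fixed configuration this is Varadhan's lemma with the Legendre dual of the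
  -- rate; the average over configurations is dominated convergence with the constant `D`.
  have key : ∀ᵐ ω ∂P, Tendsto (fun n => Real.log (evolutionAvg P y
      (fun ω => Real.exp (l * X 0 (u n) ω)) ω) / √(u n : ℝ)) atTop (𝓝 (limitCGF ρ σ l)) := by
    filter_upwards [ae_hasTailRates hρ hσ hy hX hu0 hu, ae_all_iff.mpr fun n =>
      evolutionAvg_exp_ae_eq hρ hσ hy hX (hu0 n) l,
      ae_all_iff.mpr fun b => ae_all_iff.mpr (hE b)] with ω h1 h2 h3
    simp_rw [h2]
    refine (h1.logAsymp_integral hr (isEvenRate_ldf hρ hσ) (fun b n => ?_) (fun b => ?_)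
      (isGreatest_legendre hρ hσ l)).tendsto hr
    · obtain ⟨m, hm⟩ := exists_nat_ge |b / √(u n : ℝ)|
      have h4 := (h3 m n _ hm).1
      rwa [div_mul_cancel₀ _ (by linarith [hsq n])] at h4
    · obtain ⟨m, hm⟩ := exists_nat_ge |b|
      exact ⟨E m, Eventually.of_forall fun n => (h3 m n b hm).2⟩
  have hlim := tendsto_integral_of_dominated_convergence (μ := P) (fun _ => D)
    (fun n => ((aestronglyMeasurable_log_evolutionAvg hy.measurable
      (fun ω => Real.exp (l * X 0 (u n) ω))).aemeasurable.div_const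
        (√(u n : ℝ))).aestronglyMeasurable)
    (integrable_const D) (fun n => ?_) key
  · rw [integral_const, probReal_univ, one_smul] at hlim
    refine hlim.congr fun n => ?_
    rw [integral_div, quenchedCGF]
  · filter_upwards [hD (u n) (hsq n)] with ω hω
    rw [Real.norm_eq_abs, abs_div, abs_of_nonneg (Real.sqrt_nonneg _), div_le_iff₀
      (by linarith [hsq n]), mul_comm D]
    exact hω

lemma quenchedProb_ae_eq (hy : IsQuenchedUniform P ρ y) (hX : IsSingleFile P σ y X) (t : ℝ≥0)
    {G : Set ℝ} (hG : MeasurableSet G) :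
    quenchedProb P y (fun ω => X 0 t ω / √(t : ℝ)) G =ᵐ[P]
      fun ω => (tracerLaw P y X t (y ω)).real G :=
  (condDistrib_ae_eq_condExp hy.measurable ((hX.measurable 0 t).div_const _) hG).symm

/-- The quenched large deviation principle for the tracer. -/
theorem isQuenchedLDF_ldf (hρ : 0 < ρ) (hσ : 0 < σ) (hy : IsQuenchedUniform P ρ y)
    (hX : IsSingleFile P σ y X) : IsQuenchedLDF P y (X 0) (ldf ρ σ) := by
  refine ⟨continuous_ldf ρ σ, ldf_nonneg hρ hσ, fun G hG hne => ?_⟩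
  -- The uniform lower bound gives positivity and also dominates the logarithm, which is at most `0`
  -- for a probability.
  have hbound : ∀ r₀ : ℝ, 0 < r₀ → ∃ C : ℝ, ∀ t : ℝ≥0, r₀ ≤ √(t : ℝ) → ∀ᵐ ω ∂P,
      0 < quenchedProb P y (fun ω' => X 0 t ω' / √(t : ℝ)) G ω ∧
      |Real.log (quenchedProb P y (fun ω' => X 0 t ω' / √(t : ℝ)) G ω)| ≤ C * √(t : ℝ) := by
    intro r₀ hr₀
    obtain ⟨C, hC⟩ := exists_uniform_open_bound hρ hσ hy hX hG hne hr₀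
    refine ⟨C, fun t ht => ?_⟩
    filter_upwards [quenchedProb_ae_eq hy hX t hG.measurableSet, hC t ht] with ω h1 h2
    rw [h1]
    have h3 := (Real.exp_pos _).trans_le h2
    refine ⟨h3, ?_⟩
    rw [abs_of_nonpos (Real.log_nonpos h3.le measureReal_le_one), neg_le,
      Real.le_log_iff_exp_le h3]
    exact h2
  refine ⟨fun t ht => ?_, ?_⟩
  · obtain ⟨C, hC⟩ := hbound (√(t : ℝ)) (Real.sqrt_pos.mpr (by exact_mod_cast ht))
    exact ⟨(hC t le_rfl).mono fun ω h => h.1,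
      Integrable.of_bound (aestronglyMeasurable_log_evolutionAvg hy.measurable _) _
        ((hC t le_rfl).mono fun ω h => h.2)⟩
  · refine tendsto_of_seq_one_le fun u hu1 hu => ?_
    have hu0 : ∀ n, 0 < u n := fun n => one_pos.trans_le (hu1 n)
    have hsq : ∀ n, 1 ≤ √(u n : ℝ) := fun n => Real.one_le_sqrt.mpr (by exact_mod_cast hu1 n)
    have hr : Tendsto (fun n => √(u n : ℝ)) atTop atTop :=
      Real.tendsto_sqrt_atTop.comp (NNReal.tendsto_coe_atTop.mpr hu)
    obtain ⟨C, hC⟩ := hbound 1 one_pos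
    have key : ∀ᵐ ω ∂P, Tendsto (fun n => Real.log (quenchedProb P y
        (fun ω' => X 0 (u n) ω' / √(u n : ℝ)) G ω) / √(u n : ℝ)) atTop
        (𝓝 (-sInf (ldf ρ σ '' G))) := by
      filter_upwards [ae_hasTailRates hρ hσ hy hX hu0 hu, ae_all_iff.mpr fun n =>
        quenchedProb_ae_eq hy hX (u n) hG.measurableSet] with ω h1 h2
      simp_rw [h2]
      exact (h1.logAsymp_open hr (isEvenRate_ldf hρ hσ) hG hne).tendsto hr
    have hlim := tendsto_integral_of_dominated_convergence (μ := P) (fun _ => C)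
      (fun n => ((aestronglyMeasurable_log_evolutionAvg hy.measurable _).aemeasurable.div_const
        (√(u n : ℝ))).aestronglyMeasurable)
      (integrable_const C) (fun n => ?_) key
    · rw [integral_const, probReal_univ, one_smul] at hlim
      refine hlim.congr fun n => ?_
      rw [integral_div]
      rfl
    · filter_upwards [hC (u n) (hsq n)] with ω hω
      rw [Real.norm_eq_abs, abs_div, abs_of_nonneg (Real.sqrt_nonneg _), div_le_iff₀
        (by linarith [hsq n])]
      exact hω.2

end QuenchedAverages

/-! ### Equally spaced particles: the tracer and the flow through one cell -/

section Lattice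

/-- Shifting the labels by one moves a single particle across the label boundary; the general shift
follows by induction in both directions. -/
lemma hasSum_relabel (m : ℤ) :
    HasSum (fun k : ℤ => (if 1 ≤ k + m then (0 : ℝ) else 1) - if 1 ≤ k then 0 else 1) (-m) := by
  have hstep : ∀ n : ℤ, HasSum (fun k : ℤ => (if 1 ≤ k + (n + 1) then (0 : ℝ) else 1) -
      if 1 ≤ k + n then 0 else 1) (-1) := by
    intro n
    have h := hasSum_ite_eq (-n) (-1 : ℝ)
    refine h.congr_fun fun k => ?_
    split_ifs <;> first | omega | norm_num
  induction m using Int.induction_on with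
  | zero => simp
  | succ n ih =>
    have h := (hstep n).add ih
    simp only [sub_add_sub_cancel] at h
    push_cast
    rwa [show -((n : ℝ) + 1) = -1 + -((n : ℤ) : ℝ) by push_cast; ring]
  | pred n ih =>
    have h := ih.sub (hstep (-(n : ℤ) - 1))
    simp only [sub_add_cancel, sub_sub_sub_cancel_left] at h
    push_cast at h ⊢
    rw [show -(-(n : ℝ) - 1) = - -(n : ℝ) - -1 by ring]
    refine h.congr_fun fun k => ?_
    ring

lemma flow_translate {z : ℤ → ℝ} {x a : ℝ} (m : ℤ)
    (h : {k | crossing z (x + a) k ≠ 0}.Finite) :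
    flow (fun k => z (k + m) - a) x = flow z (x + a) - m := by
  have h1 := (Equiv.addRight m).hasSum_iff.mpr (hasSum_of_finite_support h)
  have h2 := h1.add (hasSum_relabel m)
  refine HasSum.tsum_eq ?_
  rw [sub_eq_add_neg, flow]
  refine h2.congr_fun fun k => ?_
  simp only [crossing_eq_stepCharge, stepCharge, Function.comp_apply, Equiv.coe_addRight,
    sub_le_iff_le_add]
  ring

lemma exists_int_flow {z : ℤ → ℝ} {x : ℝ} (h : {k | crossing z x k ≠ 0}.Finite) :
    ∃ n : ℤ, flow z x = n := by
  have h1 : ∀ k, ∃ n : ℤ, crossing z x k = n := fun k => by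
    unfold crossing
    split_ifs
    exacts [⟨1, by simp⟩, ⟨0, by simp⟩, ⟨-1, by simp⟩, ⟨0, by simp⟩]
  choose n hn using h1
  refine ⟨∑ k ∈ h.toFinset, n k, ?_⟩
  rw [flow, tsum_eq_sum (s := h.toFinset) fun k hk => by simpa using hk]
  push_cast
  exact Finset.sum_congr rfl fun k _ => hn k

lemma isNearUniform_lattice (ρ : ℝ) (hρ : 0 < ρ) : IsNearUniform ρ 0 fun k : ℤ => (k : ℝ) / ρ := by
  intro k
  rw [sub_self, abs_zero]
  positivity

variable {Ω : Type*} [MeasurableSpace Ω] {P : Measure Ω} [IsProbabilityMeasure P] {ρ s : ℝ}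
  {V : ℤ → Ω → ℝ} {X : Ω → ℝ}

/-- The tracer `X` of a system that starts from the lattice of density `ρ`; the free particles have
the displacements `V`. -/
structure IsLatticeTracer (P : Measure Ω) (ρ s : ℝ) (V : ℤ → Ω → ℝ) (X : Ω → ℝ) : Prop where
  measurable : Measurable X
  integrable_exp : ∀ l, Integrable (fun ω => Real.exp (l * X ω)) P
  noise : IsFreeNoise P s V
  law : ∀ k, P.map (V k) = P.map (V 0)
  le_iff : ∀ᵐ ω ∂P, ∀ x, X ω ≤ x ↔ 0 ≤ flow (fun k => k / ρ + V k ω) x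

/-- Translation by `m / ρ` maps the lattice to itself with labels shifted by `m`, and the noise is
identically distributed in the label. So the tracer's threshold `0` at a translated point becomes
the threshold `-m` at the original one: the whole law of the flow is visible in the tracer. -/
lemma IsLatticeTracer.prob_le (hX : IsLatticeTracer P ρ s V X) (hρ : 0 < ρ) (hs : 0 < s)
    (x : ℝ) (m : ℤ) : P {ω | X ω ≤ x + m / ρ} =
      P {ω | -(m : ℝ) ≤ flow (fun k => k / ρ + V k ω) x} := by
  have hV := hX.noise
  have hS := hV.isIndepSummable hρ hs (isNearUniform_lattice ρ hρ) (x + m / ρ)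
  have h1 : P {ω | X ω ≤ x + m / ρ} =
      P {ω | -(m : ℝ) ≤ flow (fun k => k / ρ + V (k + m) ω) x} := by
    refine measure_congr ?_
    filter_upwards [hX.le_iff, hS.ae_finite] with ω h1 h2
    refine propext ((h1 _).trans ?_)
    have h3 := flow_translate m h2
    have h4 : (fun k : ℤ => ((k + m : ℤ) : ℝ) / ρ + V (k + m) ω - m / ρ) =
        fun k : ℤ => (k : ℝ) / ρ + V (k + m) ω := by
      funext k
      push_cast
      ring
    rw [h4] at h3
    change _ ↔ -(m : ℝ) ≤ flow (fun k : ℤ => (k : ℝ) / ρ + V (k + m) ω) x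
    rw [h3]
    constructor <;> intro h <;> linarith
  have hVm : Measurable fun ω k => V k ω := measurable_pi_lambda _ hV.measurable
  have hVm' : Measurable fun ω k => V (k + m) ω := measurable_pi_lambda _ fun k => hV.measurable _
  have hind' : iIndepFun (fun k => V (k + m)) P := hV.indep.precomp (add_left_injective m)
  have h2 : P.map (fun ω k => V (k + m) ω) = P.map fun ω k => V k ω := by
    rw [hV.indep.map_fun_eq_infinitePi_map hV.measurable,
      hind'.map_fun_eq_infinitePi_map fun k => hV.measurable _]
    congr 1
    funext k
    rw [hX.law, ← hX.law k]
  have hA : MeasurableSet {v : ℤ → ℝ | -(m : ℝ) ≤ flow (fun k => k / ρ + v k) x} :=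
    measurableSet_le measurable_const ((measurable_flow x).comp (by fun_prop))
  have h3 := Measure.map_apply (μ := P) hVm' hA
  have h4 := Measure.map_apply (μ := P) hVm hA
  rw [h2, h4] at h3
  rw [h1]
  exact h3.symm

/-- The label of the cell in which the tracer is found has the law of the flow. -/
lemma IsLatticeTracer.map_ceil (hX : IsLatticeTracer P ρ s V X) (hρ : 0 < ρ) (hs : 0 < s) (v : ℝ) :
    P.map (fun ω => (⌈ρ * X ω - v⌉ : ℝ)) =
      P.map fun ω => -flow (fun k => k / ρ + V k ω) (v / ρ) := by
  have hV := hX.noise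
  have hS := hV.isIndepSummable hρ hs (isNearUniform_lattice ρ hρ) (v / ρ)
  have hXm := hX.measurable
  have hm1 : Measurable fun ω => (⌈ρ * X ω - v⌉ : ℝ) :=
    (measurable_of_countable (fun n : ℤ => (n : ℝ))).comp (Int.measurable_ceil.comp (by fun_prop))
  have hm2 : Measurable fun ω => -flow (fun k => k / ρ + V k ω) (v / ρ) :=
    ((measurable_flow _).comp (measurable_pi_lambda _ fun k => by
      have := hV.measurable k
      fun_prop)).neg
  have := Measure.isProbabilityMeasure_map (μ := P) hm1.aemeasurable
  -- Both variables take integer values almost surely, so `a` may be replaced by `⌊a⌋` in the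
  -- comparison.
  refine Measure.ext_of_Iic _ _ fun a => ?_
  rw [Measure.map_apply hm1 measurableSet_Iic, Measure.map_apply hm2 measurableSet_Iic]
  have h1 : (fun ω => (⌈ρ * X ω - v⌉ : ℝ)) ⁻¹' Iic a = {ω | X ω ≤ v / ρ + ⌊a⌋ / ρ} := by
    ext ω
    rw [mem_preimage, mem_Iic, mem_ofPred_eq, ← Int.le_floor, Int.ceil_le, ← add_div,
      le_div_iff₀ hρ]
    constructor <;> intro h <;> linarith
  rw [h1, hX.prob_le hρ hs]
  refine measure_congr ?_
  filter_upwards [hS.ae_finite] with ω hω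
  obtain ⟨n, hn⟩ := exists_int_flow hω
  refine propext ?_
  change -(⌊a⌋ : ℝ) ≤ flow _ _ ↔ -flow _ _ ≤ a
  rw [hn]
  have h2 : -(n : ℝ) = ((-n : ℤ) : ℝ) := by push_cast; ring
  rw [h2, ← Int.le_floor, ← Int.cast_neg, Int.cast_le]
  omega

/-- The function `v + ⌈u - v⌉` has period `1` in `v` and equals `v` for `u < v < u + 1`. Averaging
over the cell offset undoes the rounding exactly, up to an explicit factor. -/
lemma integral_cexp_cell (z : ℂ) (u : ℝ) :
    ∫ v in (0 : ℝ)..1, Complex.exp (z * ((v + ⌈u - v⌉ : ℝ) : ℂ)) =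
      Complex.exp (z * u) * ∫ v in (0 : ℝ)..1, Complex.exp (z * v) := by
  have hper : Function.Periodic (fun v : ℝ => Complex.exp (z * ((v + ⌈u - v⌉ : ℝ) : ℂ))) 1 := by
    intro v
    have : ⌈u - (v + 1)⌉ = ⌈u - v⌉ - 1 := by
      rw [← Int.ceil_sub_one]
      congr 1
      ring
    simp only [this]
    congr 3
    push_cast
    ring
  have h1 := hper.intervalIntegral_add_eq 0 u
  rw [zero_add] at h1
  rw [h1, ← intervalIntegral.integral_const_mul]
  have h2 := intervalIntegral.integral_comp_add_left (a := 0) (b := 1)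
    (fun w : ℝ => Complex.exp (z * w)) u
  rw [add_zero] at h2
  simp_rw [← Complex.exp_add]
  have h3 : ∫ v in (0 : ℝ)..1, Complex.exp (z * u + z * v) =
      ∫ v in (0 : ℝ)..1, Complex.exp (z * ((u + v : ℝ) : ℂ)) := by
    refine intervalIntegral.integral_congr fun v _ => ?_
    simp only [Complex.ofReal_add, mul_add]
  rw [h3, h2]
  refine intervalIntegral.integral_congr_ae ?_
  have h4 : ∀ᵐ v : ℝ, v ≠ u + 1 := compl_mem_ae_iff.mpr (measure_singleton (u + 1))
  filter_upwards [h4] with v hv hmem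
  rw [uIoc_of_le (by linarith)] at hmem
  have : ⌈u - v⌉ = 0 := by
    rw [Int.ceil_eq_zero_iff]
    constructor
    · have := lt_of_le_of_ne hmem.2 hv
      linarith
    · linarith [hmem.1]
  rw [this]
  simp

lemma IsLatticeTracer.integrable_cell (hX : IsLatticeTracer P ρ s V X) (z : ℂ) :
    Integrable (Function.uncurry fun (v : ℝ) (ω : Ω) =>
      Complex.exp (z * ((v + ⌈ρ * X ω - v⌉ : ℝ) : ℂ))) ((volume.restrict (Ioc 0 1)).prod P) := by
  have hXm := hX.measurable
  have hm : Measurable (Function.uncurry fun (v : ℝ) (ω : Ω) =>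
      Complex.exp (z * ((v + ⌈ρ * X ω - v⌉ : ℝ) : ℂ))) := by
    have h1 : Measurable fun p : ℝ × Ω => (⌈ρ * X p.2 - p.1⌉ : ℝ) :=
      (measurable_of_countable (fun n : ℤ => (n : ℝ))).comp (Int.measurable_ceil.comp (by fun_prop))
    have h2 : Measurable fun p : ℝ × Ω => p.1 + (⌈ρ * X p.2 - p.1⌉ : ℝ) := by fun_prop
    exact Complex.measurable_exp.comp ((Complex.measurable_ofReal.comp h2).const_mul z)
  have hint : Integrable (fun ω => Real.exp ‖z‖ *
      (Real.exp (‖z‖ * ρ * X ω) + Real.exp (-(‖z‖ * ρ) * X ω))) P :=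
    ((hX.integrable_exp _).add (hX.integrable_exp _)).const_mul _
  refine Integrable.mono' (hint.comp_snd (volume.restrict (Ioc 0 1))) hm.aestronglyMeasurable
    (ae_of_all _ fun p => ?_)
  obtain ⟨v, ω⟩ := p
  refine (Complex.norm_exp_le_exp_norm _).trans ?_
  rw [norm_mul, Complex.norm_real, Real.norm_eq_abs]
  have h1 : |v + ⌈ρ * X ω - v⌉| ≤ 1 + |ρ * X ω| := by
    have h2 := Int.le_ceil (ρ * X ω - v)
    have h3 := Int.ceil_lt_add_one (ρ * X ω - v)
    have h4 := neg_abs_le (ρ * X ω)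
    have h5 := le_abs_self (ρ * X ω)
    rw [abs_le]
    constructor <;> linarith
  have h6 := mul_le_mul_of_nonneg_left h1 (norm_nonneg z)
  refine (Real.exp_le_exp.mpr h6).trans ?_
  rw [mul_add, mul_one, Real.exp_add]
  refine mul_le_mul_of_nonneg_left ?_ (Real.exp_pos _).le
  rcases abs_choice (ρ * X ω) with h | h
  · rw [h, ← mul_assoc]
    linarith [Real.exp_pos (-(‖z‖ * ρ) * X ω)]
  · rw [h, show ‖z‖ * -(ρ * X ω) = -(‖z‖ * ρ) * X ω by ring]
    linarith [Real.exp_pos (‖z‖ * ρ * X ω)]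

lemma IsLatticeTracer.integral_cexp_ceil (hX : IsLatticeTracer P ρ s V X) (hρ : 0 < ρ)
    (hs : 0 < s) (z : ℂ) (v : ℝ) : ∫ ω, Complex.exp (z * ((v + ⌈ρ * X ω - v⌉ : ℝ) : ℂ)) ∂P =
      Complex.exp (z * v) * ∫ ω, Complex.exp (-z * flow (fun k => k / ρ + V k ω) (v / ρ)) ∂P := by
  have hXm := hX.measurable
  have hm1 : Measurable fun ω => (⌈ρ * X ω - v⌉ : ℝ) :=
    (measurable_of_countable (fun n : ℤ => (n : ℝ))).comp (Int.measurable_ceil.comp (by fun_prop))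
  have hm2 : Measurable fun ω => -flow (fun k => k / ρ + V k ω) (v / ρ) :=
    ((measurable_flow _).comp (measurable_pi_lambda _ fun k => by
      have := hX.noise.measurable k
      fun_prop)).neg
  have h := hX.map_ceil hρ hs v
  have hg : Measurable fun q : ℝ => Complex.exp (z * (v + q)) := by fun_prop
  have h1 := integral_map (μ := P) hm1.aemeasurable hg.aestronglyMeasurable
  rw [h, integral_map hm2.aemeasurable hg.aestronglyMeasurable] at h1
  rw [← integral_const_mul]
  refine Eq.trans ?_ (h1.symm.trans ?_)
  · refine integral_congr_ae (ae_of_all _ fun ω => ?_)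
    simp only
    push_cast
    rfl
  · refine integral_congr_ae (ae_of_all _ fun ω => ?_)
    simp only
    rw [← Complex.exp_add]
    congr 1
    push_cast
    ring

/-- The moment generating function of the tracer in terms of that of the flow. -/
lemma IsLatticeTracer.integral_cexp_mul (hX : IsLatticeTracer P ρ s V X) (hρ : 0 < ρ)
    (hs : 0 < s) (z : ℂ) :
    IntervalIntegrable (fun v : ℝ => Complex.exp (z * v) *
      ∫ ω, Complex.exp (-z * flow (fun k => k / ρ + V k ω) (v / ρ)) ∂P) volume 0 1 ∧
    (∫ ω, Complex.exp (z * (ρ * X ω)) ∂P) * ∫ v in (0 : ℝ)..1, Complex.exp (z * v) =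
      ∫ v in (0 : ℝ)..1, Complex.exp (z * v) *
        ∫ ω, Complex.exp (-z * flow (fun k => k / ρ + V k ω) (v / ρ)) ∂P := by
  have hint := hX.integrable_cell z
  simp_rw [← hX.integral_cexp_ceil hρ hs z]
  constructor
  · rw [intervalIntegrable_iff_integrableOn_Ioc_of_le zero_le_one]
    exact hint.integral_prod_left
  · have h1 := integral_integral_swap hint
    simp only [intervalIntegral.integral_of_le zero_le_one] at h1 ⊢
    rw [h1, ← integral_mul_const]
    refine integral_congr_ae (ae_of_all _ fun ω => ?_)
    have h2 := integral_cexp_cell z (ρ * X ω)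
    simp only [intervalIntegral.integral_of_le zero_le_one] at h2 ⊢
    rw [h2]
    push_cast
    rfl

end Lattice

/-! ### Equally spaced particles: complex exponential moments -/

section LatticeProb

variable {ρ s : ℝ}

/-- The probability that particle `k` of the lattice of density `ρ` crosses the point `v / ρ`. -/
def latticeProb (ρ s v : ℝ) (k : ℤ) : ℝ := crossProb (fun k => k / ρ) s (v / ρ) k

lemma latticeProb_eq (ρ s v : ℝ) (k : ℤ) : latticeProb ρ s v k =
    if 1 ≤ k then tailProb ((k - v) / (ρ * s)) else tailProb ((v - k) / (ρ * s)) := by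
  unfold latticeProb crossProb
  simp only [← sub_div, div_div]

lemma latticeProb_nonneg (ρ s v : ℝ) (k : ℤ) : 0 ≤ latticeProb ρ s v k := (crossProb_pos _ _ _ _).le

lemma latticeProb_eq_tailProb_abs {v : ℝ} (hv : v ∈ Icc (0 : ℝ) 1) (k : ℤ) :
    latticeProb ρ s v k = tailProb (|(k : ℝ) - v| / (ρ * s)) := by
  rw [latticeProb_eq]
  split_ifs with h
  · have : (1 : ℝ) ≤ k := by exact_mod_cast h
    rw [abs_of_nonneg (by linarith [hv.2])]
  · have : (k : ℝ) ≤ 0 := by exact_mod_cast (by omega : k ≤ 0)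
    rw [abs_of_nonpos (by linarith [hv.1]), neg_sub]

/-- For `v` in the unit cell no particle starts on the wrong side of the point. This keeps the
complex factors inside a small disc around `1`, uniformly in time. -/
lemma latticeProb_le_half (hρ : 0 < ρ) (hs : 0 < s) {v : ℝ} (hv : v ∈ Icc (0 : ℝ) 1) (k : ℤ) :
    latticeProb ρ s v k ≤ 1 / 2 := by
  rw [latticeProb_eq_tailProb_abs hv]
  exact tailProb_le_half (by positivity)

lemma summable_latticeProb (hρ : 0 < ρ) (hs : 0 < s) (v : ℝ) : Summable (latticeProb ρ s v) :=
  (isNearUniform_lattice ρ hρ).summable_crossProb hρ hs _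

lemma tsum_latticeProb_le (hρ : 0 < ρ) (hs : 1 ≤ s) {v : ℝ} (hv : v ∈ Icc (0 : ℝ) 1) :
    ∑' k, latticeProb ρ s v k ≤ 4 * ρ * Real.exp (1 / ρ) * s := by
  have hs0 : 0 < s := by linarith
  have hc : 0 < 1 / (ρ * s) := by positivity
  have h1 : ∀ k, latticeProb ρ s v k ≤ 2 * Real.exp (-(1 / (ρ * s) * |(k : ℝ) - v|)) := fun k => by
    rw [latticeProb_eq_tailProb_abs hv]
    refine (tailProb_le_exp _).trans (le_of_eq ?_)
    rw [one_div_mul_eq_div]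
  have h2 := (summable_latticeProb hρ hs0 v).tsum_le_tsum h1 ((summable_exp_neg_abs hc v).mul_left 2)
  rw [tsum_mul_left] at h2
  refine h2.trans ((mul_le_mul_of_nonneg_left (tsum_exp_neg_abs_le hc v) zero_le_two).trans ?_)
  have h3 : Real.exp (1 / (ρ * s)) ≤ Real.exp (1 / ρ) := by
    rw [Real.exp_le_exp]
    exact one_div_le_one_div_of_le hρ (le_mul_of_one_le_right hρ.le hs)
  have h4 : 2 * (Real.exp (1 / (ρ * s)) * (2 / (1 / (ρ * s)))) =
      4 * ρ * Real.exp (1 / (ρ * s)) * s := by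
    field_simp
    ring
  rw [h4]
  gcongr

/-- The probabilities that a particle ends in a given cell sum to one. -/
lemma hasSum_tailProb_sub (hρ : 0 < ρ) (hs : 0 < s) :
    HasSum (fun k : ℤ => tailProb (((k : ℝ) - 1) / (ρ * s)) - tailProb (k / (ρ * s))) 1 := by
  -- `g` is the tail probability minus the step in the label, hence summable. The telescoping sum of
  -- tail probabilities then comes entirely from shifting the step.
  set g : ℤ → ℝ := fun k => if 1 ≤ k then latticeProb ρ s 0 k else -latticeProb ρ s 0 k with hg
  have hgs : Summable g := by
    refine Summable.of_norm ?_
    refine (summable_latticeProb hρ hs 0).congr fun k => ?_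
    rw [hg]
    simp only
    split_ifs
    · rw [Real.norm_of_nonneg (latticeProb_nonneg _ _ _ _)]
    · rw [norm_neg, Real.norm_of_nonneg (latticeProb_nonneg _ _ _ _)]
  have hgk : ∀ k : ℤ, tailProb (k / (ρ * s)) = g k + if 1 ≤ k then 0 else 1 := fun k => by
    rw [hg]
    simp only [latticeProb_eq]
    split_ifs
    · simp
    · rw [zero_sub, neg_div, tailProb_neg]
      ring
  have h1 := (Equiv.subRight (1 : ℤ)).hasSum_iff.mpr hgs.hasSum
  have h2 := (h1.sub hgs.hasSum).add (hasSum_relabel (-1))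
  rw [sub_self, zero_add, Int.cast_neg, Int.cast_one, neg_neg] at h2
  refine h2.congr_fun fun k => ?_
  have h3 := hgk (k - 1)
  push_cast at h3
  rw [h3, hgk k]
  simp only [Function.comp_apply, Equiv.subRight_apply, ← sub_eq_add_neg]
  ring

/-- By monotonicity, moving the observation point within its cell changes a crossing probability by
at most the mass of one cell as seen from that particle. These masses sum to one. -/
lemma abs_latticeProb_sub_le (hρ : 0 < ρ) (hs : 0 < s) {v : ℝ} (hv : v ∈ Icc (0 : ℝ) 1) (k : ℤ) :
    |latticeProb ρ s v k - latticeProb ρ s 0 k| ≤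
      tailProb (((k : ℝ) - 1) / (ρ * s)) - tailProb (k / (ρ * s)) := by
  have hr : 0 < ρ * s := by positivity
  have hmono : ∀ a b : ℝ, a ≤ b → tailProb (b / (ρ * s)) ≤ tailProb (a / (ρ * s)) := fun a b h =>
    strictAnti_tailProb.antitone (div_le_div_of_nonneg_right h hr.le)
  rw [latticeProb_eq, latticeProb_eq]
  split_ifs with h
  · have h1 := hmono (k - v) k (by linarith [hv.1])
    have h2 := hmono (k - 1) (k - v) (by linarith [hv.2])
    rw [sub_zero, abs_of_nonneg (by linarith)]
    linarith
  · have h1 := hmono (0 - k) (v - k) (by linarith [hv.1])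
    have h2 := hmono (v - k) (1 - k) (by linarith [hv.2])
    have h3 := tailProb_neg (((k : ℝ) - 1) / (ρ * s))
    have h4 := tailProb_neg ((k : ℝ) / (ρ * s))
    rw [← neg_div, neg_sub] at h3
    rw [← neg_div, ← zero_sub] at h4
    rw [abs_of_nonpos (by linarith)]
    linarith

end LatticeProb

/-! ### The complex cumulant generating functions of the lattice flow and of the tracer -/

section LatticeCGF

lemma norm_clog_one_add_sub_le {x y : ℂ} (hx : ‖x‖ ≤ 1 / 2) (hy : ‖y‖ ≤ 1 / 2) :
    ‖Complex.log (1 + x) - Complex.log (1 + y)‖ ≤ 2 * ‖x - y‖ := by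
  have hd : ∀ w ∈ Metric.closedBall (0 : ℂ) (1 / 2),
      HasDerivWithinAt (fun w => Complex.log (1 + w)) (1 / (1 + w)) (Metric.closedBall 0 (1 / 2)) w := by
    intro w hw
    rw [mem_closedBall_zero_iff] at hw
    have h := ((hasDerivAt_id w).const_add 1).clog (x := w)
      (Complex.mem_slitPlane_of_norm_lt_one (hw.trans_lt (by norm_num)))
    exact h.hasDerivWithinAt
  refine (convex_closedBall (0 : ℂ) (1 / 2)).norm_image_sub_le_of_norm_hasDerivWithin_le hd ?_
    (mem_closedBall_zero_iff.mpr hy) (mem_closedBall_zero_iff.mpr hx)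
  intro w hw
  rw [mem_closedBall_zero_iff] at hw
  have h1 : 1 / 2 ≤ ‖1 + w‖ := by
    have := norm_sub_le_norm_add (1 : ℂ) w
    rw [norm_one] at this
    linarith
  rw [norm_div, norm_one, div_le_iff₀ (by linarith)]
  linarith

variable {ρ s : ℝ}

/-- The factor of particle `k` in the exponential moments of the flow. -/
def crossFactor (z : ℂ) (k : ℤ) : ℂ := Complex.exp (if 1 ≤ k then -z else z) - 1

lemma norm_crossFactor_le {z : ℂ} (hz : ‖z‖ ≤ 1) (k : ℤ) : ‖crossFactor z k‖ ≤ 2 * ‖z‖ := by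
  unfold crossFactor
  split_ifs
  · simpa using Complex.norm_exp_sub_one_le (x := -z) (by simpa using hz)
  · exact Complex.norm_exp_sub_one_le hz

/-- The complex cumulant generating function of minus the flow through `v / ρ`. -/
def latticeCGF (ρ s v : ℝ) (z : ℂ) : ℂ :=
  ∑' k, Complex.log (1 + latticeProb ρ s v k * crossFactor z k)

lemma norm_latticeProb_mul_le (hρ : 0 < ρ) (hs : 0 < s) {v : ℝ} (hv : v ∈ Icc (0 : ℝ) 1) {z : ℂ}
    (hz : ‖z‖ ≤ 1 / 4) (k : ℤ) : ‖(latticeProb ρ s v k : ℂ) * crossFactor z k‖ ≤ 1 / 4 := by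
  rw [norm_mul, Complex.norm_real, Real.norm_of_nonneg (latticeProb_nonneg _ _ _ _)]
  have h1 := norm_crossFactor_le (hz.trans (by norm_num)) k
  have h2 := latticeProb_le_half hρ hs hv k
  nlinarith [norm_nonneg (crossFactor z k), latticeProb_nonneg ρ s v k]

lemma norm_clog_latticeProb_le (hρ : 0 < ρ) (hs : 0 < s) {v : ℝ} (hv : v ∈ Icc (0 : ℝ) 1) {z : ℂ}
    (hz : ‖z‖ ≤ 1 / 4) (k : ℤ) : ‖Complex.log (1 + latticeProb ρ s v k * crossFactor z k)‖ ≤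
      latticeProb ρ s v k * (3 * ‖z‖) := by
  have h0 := norm_latticeProb_mul_le hρ hs hv hz k
  refine (Complex.norm_log_one_add_half_le_self (h0.trans (by norm_num))).trans ?_
  rw [norm_mul, Complex.norm_real, Real.norm_of_nonneg (latticeProb_nonneg _ _ _ _)]
  have h1 := norm_crossFactor_le (hz.trans (by norm_num)) k
  nlinarith [mul_le_mul_of_nonneg_left h1 (latticeProb_nonneg ρ s v k)]

lemma summable_clog_latticeProb (hρ : 0 < ρ) (hs : 0 < s) {v : ℝ} (hv : v ∈ Icc (0 : ℝ) 1) {z : ℂ}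
    (hz : ‖z‖ ≤ 1 / 4) :
    Summable fun k => Complex.log (1 + latticeProb ρ s v k * crossFactor z k) :=
  Summable.of_norm_bounded ((summable_latticeProb hρ hs v).mul_right _)
    (norm_clog_latticeProb_le hρ hs hv hz)

lemma norm_latticeCGF_le (hρ : 0 < ρ) (hs : 1 ≤ s) {v : ℝ} (hv : v ∈ Icc (0 : ℝ) 1) {z : ℂ}
    (hz : ‖z‖ ≤ 1 / 4) : ‖latticeCGF ρ s v z‖ ≤ 4 * ρ * Real.exp (1 / ρ) * s := by
  have hs0 : 0 < s := by linarith
  have h1 := tsum_of_norm_bounded ((summable_latticeProb hρ hs0 v).mul_right (3 * ‖z‖)).hasSum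
    (norm_clog_latticeProb_le hρ hs0 hv hz)
  rw [tsum_mul_right] at h1
  refine h1.trans ((mul_le_of_le_one_right ?_ (by linarith)).trans (tsum_latticeProb_le hρ hs hv))
  exact tsum_nonneg (latticeProb_nonneg _ _ _)

/-- The logarithm is Lipschitz with constant `2`, each factor is at most `2 ‖z‖`, and the changes of
the crossing probabilities have total at most `1`. The bound does not depend on `s`, although the
generating functions themselves grow like `s`. -/
lemma norm_latticeCGF_sub_le (hρ : 0 < ρ) (hs : 0 < s) {v : ℝ} (hv : v ∈ Icc (0 : ℝ) 1) {z : ℂ}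
    (hz : ‖z‖ ≤ 1 / 4) : ‖latticeCGF ρ s v z - latticeCGF ρ s 0 z‖ ≤ 4 * ‖z‖ := by
  have h0 : (0 : ℝ) ∈ Icc (0 : ℝ) 1 := by simp
  rw [latticeCGF, latticeCGF, ← (summable_clog_latticeProb hρ hs hv hz).tsum_sub
    (summable_clog_latticeProb hρ hs h0 hz)]
  have h1 := (hasSum_tailProb_sub hρ hs).mul_right (4 * ‖z‖)
  rw [one_mul] at h1
  refine tsum_of_norm_bounded h1 fun k => ?_
  refine (norm_clog_one_add_sub_le ((norm_latticeProb_mul_le hρ hs hv hz k).trans (by norm_num))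
    ((norm_latticeProb_mul_le hρ hs h0 hz k).trans (by norm_num))).trans ?_
  rw [← sub_mul, ← Complex.ofReal_sub, norm_mul, Complex.norm_real, Real.norm_eq_abs]
  have h2 := norm_crossFactor_le (hz.trans (by norm_num)) k
  have h3 := mul_le_mul (abs_latticeProb_sub_le hρ hs hv k) h2 (norm_nonneg _)
    ((abs_nonneg _).trans (abs_latticeProb_sub_le hρ hs hv k))
  linarith

lemma differentiableOn_latticeCGF (hρ : 0 < ρ) (hs : 0 < s) :
    DifferentiableOn ℂ (latticeCGF ρ s 0) (Metric.ball 0 (1 / 4)) := by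
  have h0 : (0 : ℝ) ∈ Icc (0 : ℝ) 1 := by simp
  refine Complex.differentiableOn_tsum_of_summable_norm (u := fun k => latticeProb ρ s 0 k * 1)
    ((summable_latticeProb hρ hs 0).mul_right 1) (fun k => ?_) Metric.isOpen_ball fun k z hz => ?_
  · refine DifferentiableOn.clog ?_ fun z hz => ?_
    · unfold crossFactor
      split_ifs <;> fun_prop
    · rw [mem_ball_zero_iff] at hz
      exact Complex.mem_slitPlane_of_norm_lt_one
        ((norm_latticeProb_mul_le hρ hs h0 hz.le k).trans_lt (by norm_num))
  · rw [mem_ball_zero_iff] at hz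
    refine (norm_clog_latticeProb_le hρ hs h0 hz.le k).trans ?_
    exact mul_le_mul_of_nonneg_left (by linarith) (latticeProb_nonneg _ _ _ _)

variable {Ω : Type*} [MeasurableSpace Ω] {P : Measure Ω} [IsProbabilityMeasure P]
  {V : ℤ → Ω → ℝ} {X : Ω → ℝ}

lemma IsFreeNoise.integral_cexp_flow_lattice (hV : IsFreeNoise P s V) (hρ : 0 < ρ) (hs : 0 < s)
    {v : ℝ} (hv : v ∈ Icc (0 : ℝ) 1) {z : ℂ} (hz : ‖z‖ ≤ 1 / 4) :
    ∫ ω, Complex.exp (-z * flow (fun k => k / ρ + V k ω) (v / ρ)) ∂P =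
      Complex.exp (latticeCGF ρ s v z) := by
  have hS := hV.isIndepSummable hρ hs (isNearUniform_lattice ρ hρ) (v / ρ)
  refine hS.integral_cexp_tsum (fun k => ?_) (summable_clog_latticeProb hρ hs hv hz)
  rw [hV.integral_cexp_crossing, neg_neg, Complex.exp_log]
  · rfl
  · refine Complex.slitPlane_ne_zero (Complex.mem_slitPlane_of_norm_lt_one
      ((norm_latticeProb_mul_le hρ hs hv hz k).trans_lt (by norm_num)))

lemma norm_integral_cexp_sub_one_le {f : ℝ → ℂ} {δ : ℝ} (hδ : δ ≤ 1)
    (hf : ∀ v ∈ Ioc (0 : ℝ) 1, ‖f v‖ ≤ δ)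
    (hint : IntervalIntegrable (fun v => Complex.exp (f v)) volume 0 1) :
    ‖(∫ v in (0 : ℝ)..1, Complex.exp (f v)) - 1‖ ≤ 2 * δ := by
  have h1 : (∫ v in (0 : ℝ)..1, Complex.exp (f v)) - 1 =
      ∫ v in (0 : ℝ)..1, (Complex.exp (f v) - 1) := by
    rw [intervalIntegral.integral_sub hint (by simp)]
    simp
  rw [h1]
  refine (intervalIntegral.norm_integral_le_of_norm_le_const (C := 2 * δ) fun v hv => ?_).trans ?_
  · rw [uIoc_of_le zero_le_one] at hv
    have := hf v hv
    exact (Complex.norm_exp_sub_one_le (this.trans hδ)).trans (by linarith)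
  · simp

/-- The moment generating function of the tracer differs from that of the flow by a factor close
to one. -/
lemma IsLatticeTracer.norm_mgf_mul_sub_one_le (hX : IsLatticeTracer P ρ s V X) (hρ : 0 < ρ)
    (hs : 0 < s) {z : ℂ} (hz : ‖z‖ ≤ 1 / 100) :
    ‖(∫ ω, Complex.exp (z * (ρ * X ω)) ∂P) * Complex.exp (-latticeCGF ρ s 0 z) - 1‖ ≤ 1 / 4 := by
  have hz4 : ‖z‖ ≤ 1 / 4 := hz.trans (by norm_num)
  obtain ⟨h1, h2⟩ := hX.integral_cexp_mul hρ hs z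
  set F := ∫ ω, Complex.exp (z * (ρ * X ω)) ∂P with hF
  have hE := norm_integral_cexp_sub_one_le (f := fun v : ℝ => z * v) (δ := 1 / 100) (by norm_num)
    (fun v hv => by
      rw [norm_mul, Complex.norm_real, Real.norm_of_nonneg hv.1.le]
      nlinarith [norm_nonneg z, hv.1, hv.2]) (by
      refine Continuous.intervalIntegrable ?_ _ _
      fun_prop)
  set E := ∫ v in (0 : ℝ)..1, Complex.exp (z * v) with hEdef
  have hcongr : ∀ v ∈ Ioc (0 : ℝ) 1, Complex.exp (-latticeCGF ρ s 0 z) * (Complex.exp (z * v) *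
      ∫ ω, Complex.exp (-z * flow (fun k => k / ρ + V k ω) (v / ρ)) ∂P) =
      Complex.exp (z * v + (latticeCGF ρ s v z - latticeCGF ρ s 0 z)) := by
    intro v hv
    rw [hX.noise.integral_cexp_flow_lattice hρ hs ⟨hv.1.le, hv.2⟩ hz4, ← Complex.exp_add,
      ← Complex.exp_add]
    congr 1
    ring
  have hint : IntervalIntegrable (fun v : ℝ =>
      Complex.exp (z * v + (latticeCGF ρ s v z - latticeCGF ρ s 0 z))) volume 0 1 := by
    refine (h1.const_mul (Complex.exp (-latticeCGF ρ s 0 z))).congr ?_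
    rw [uIoc_of_le zero_le_one]
    exact fun v hv => hcongr v hv
  have hJ := norm_integral_cexp_sub_one_le (δ := 1 / 20) (by norm_num)
    (fun v hv => by
      have h3 := norm_latticeCGF_sub_le hρ hs ⟨hv.1.le, hv.2⟩ hz4
      have h4 : ‖z * v‖ ≤ 1 / 100 := by
        rw [norm_mul, Complex.norm_real, Real.norm_of_nonneg hv.1.le]
        nlinarith [norm_nonneg z, hv.1, hv.2]
      exact (norm_add_le _ _).trans (by linarith)) hint
  set J := ∫ v in (0 : ℝ)..1, Complex.exp (z * v + (latticeCGF ρ s v z - latticeCGF ρ s 0 z))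
    with hJdef
  have hFE : F * Complex.exp (-latticeCGF ρ s 0 z) * E = J := by
    rw [mul_right_comm, h2, mul_comm, ← intervalIntegral.integral_const_mul, hJdef,
      intervalIntegral.integral_of_le zero_le_one, intervalIntegral.integral_of_le zero_le_one]
    exact setIntegral_congr_fun measurableSet_Ioc hcongr
  set G := F * Complex.exp (-latticeCGF ρ s 0 z) with hG
  -- The constants: `‖E - 1‖ ≤ 1/50` and `‖J - 1‖ ≤ 1/10`, so `‖G - 1‖ ‖E‖ ≤ 3/25`, and division by
  -- `49/50` leaves less than `1/4`.
  have hE2 : 49 / 50 ≤ ‖E‖ := by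
    have h5 := norm_sub_norm_le (1 : ℂ) E
    rw [norm_one, norm_sub_rev] at h5
    linarith
  have h6 : ‖G - 1‖ * ‖E‖ ≤ 3 / 25 := by
    rw [← norm_mul, sub_mul, hFE, one_mul, show J - E = (J - 1) - (E - 1) by ring]
    exact (norm_sub_le _ _).trans (by linarith)
  nlinarith [norm_nonneg (G - 1)]

/-- The complex cumulant generating function of the tracer is analytic, and of the order of the
displacement of a free particle, in a neighbourhood of the origin. -/
lemma exists_complexCGF (hρ : 0 < ρ) : ∃ R > 0, ∃ C, ∀ (s : ℝ) (V : ℤ → Ω → ℝ) (X : Ω → ℝ), 1 ≤ s →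
    IsLatticeTracer P ρ s V X → ∃ h : ℂ → ℂ, DifferentiableOn ℂ h (Metric.ball 0 R) ∧
      ∀ z ∈ Metric.ball (0 : ℂ) R,
        Complex.exp (h z) = ∫ ω, Complex.exp (z * X ω) ∂P ∧ ‖h z‖ ≤ C * s := by
  refine ⟨ρ / 100, by positivity, 4 * ρ * Real.exp (1 / ρ) + 1, fun s V X hs hX => ?_⟩
  have hs0 : 0 < s := by linarith
  have hρ' : (ρ : ℂ) ≠ 0 := by exact_mod_cast hρ.ne'
  have h00 : (0 : ℝ) ∈ Icc (0 : ℝ) 1 := by simp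
  set F : ℂ → ℂ := fun z => ∫ ω, Complex.exp (z * X ω) ∂P with hF
  have hFd : Differentiable ℂ F := by
    have h1 : integrableExpSet X P = univ := eq_univ_of_forall hX.integrable_exp
    have h2 := differentiableOn_complexMGF (X := X) (μ := P)
    rw [h1] at h2
    simp only [interior_univ, mem_univ] at h2
    intro z
    exact (h2 z (by simp)).differentiableAt (by simp)
  have hscale : ∀ z : ℂ, ∫ ω, Complex.exp (z / ρ * (ρ * X ω)) ∂P = F z := fun z => by
    rw [hF]
    simp only
    congr 1
    funext ω
    congr 1
    field_simp
  have hball : ∀ z ∈ Metric.ball (0 : ℂ) (ρ / 100), ‖z / ρ‖ < 1 / 100 := fun z hz => by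
    rw [mem_ball_zero_iff] at hz
    rw [norm_div, Complex.norm_real, Real.norm_of_nonneg hρ.le, div_lt_iff₀ hρ]
    linarith
  -- The flow's generating function is divided out. The quotient stays within `1/4` of `1`, so its
  -- principal logarithm is holomorphic and bounded; adding back `latticeCGF` gives the required
  -- logarithm.
  set G : ℂ → ℂ := fun z => F z * Complex.exp (-latticeCGF ρ s 0 (z / ρ)) with hG
  have hG1 : ∀ z ∈ Metric.ball (0 : ℂ) (ρ / 100), ‖G z - 1‖ ≤ 1 / 4 := fun z hz => by
    have := hX.norm_mgf_mul_sub_one_le hρ hs0 (hball z hz).le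
    rwa [hscale] at this
  have hKd : DifferentiableOn ℂ (fun z => latticeCGF ρ s 0 (z / ρ)) (Metric.ball 0 (ρ / 100)) := by
    refine (differentiableOn_latticeCGF hρ hs0).comp (by fun_prop) fun z hz => ?_
    rw [mem_ball_zero_iff]
    exact (hball z hz).trans (by norm_num)
  have hslit : ∀ z ∈ Metric.ball (0 : ℂ) (ρ / 100), G z ∈ Complex.slitPlane := fun z hz => by
    have := Complex.mem_slitPlane_of_norm_lt_one ((hG1 z hz).trans_lt (by norm_num))
    rwa [add_sub_cancel] at this
  refine ⟨fun z => latticeCGF ρ s 0 (z / ρ) + Complex.log (G z),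
    hKd.add (DifferentiableOn.clog (hFd.differentiableOn.mul hKd.neg.cexp) hslit),
    fun z hz => ⟨?_, ?_⟩⟩
  · rw [Complex.exp_add, Complex.exp_log (Complex.slitPlane_ne_zero (hslit z hz)), hG]
    simp only
    rw [mul_comm, mul_assoc, ← Complex.exp_add, neg_add_cancel, Complex.exp_zero, mul_one]
  · refine (norm_add_le _ _).trans ?_
    have h1 := norm_latticeCGF_le hρ hs h00 ((hball z hz).le.trans (by norm_num))
    have h2 := Complex.norm_log_one_add_half_le_self ((hG1 z hz).trans (by norm_num))
    rw [add_sub_cancel] at h2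
    have h3 := hG1 z hz
    rw [add_mul, one_mul]
    linarith

end LatticeCGF

/-! ### Convergence of derivatives -/

section Jets

/-- If functions with uniformly Lipschitz derivatives converge, so do the derivatives. -/
lemma tendsto_deriv_of_lipschitz {ι : Type*} {l : Filter ι} {f f' : ι → ℝ → ℝ} {g : ℝ → ℝ}
    {g' R C x : ℝ} (hx : |x| < R)
    (hf : ∀ᶠ i in l, ∀ u, |u| < R → HasDerivAt (f i) (f' i u) u)
    (hC : ∀ᶠ i in l, ∀ u, |u| < R → |f' i u - f' i x| ≤ C * |u - x|)
    (hg : HasDerivAt g g' x) (hlim : ∀ u, |u| < R → Tendsto (fun i => f i u) l (𝓝 (g u))) :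
    Tendsto (fun i => f' i x) l (𝓝 g') := by
  rw [Metric.tendsto_nhds]
  intro ε hε
  have h1 := hasDerivAt_iff_tendsto_slope.mp hg
  have h2 := (Metric.tendsto_nhds.mp h1 (ε / 3) (by positivity))
  have h3 : ∀ᶠ u in 𝓝[≠] x, |u| < R :=
    (continuous_abs.continuousAt.eventually (gt_mem_nhds hx)).filter_mono nhdsWithin_le_nhds
  have h4 : ∀ᶠ u in 𝓝[≠] x, C * |u - x| < ε / 3 := by
    have : Tendsto (fun u => C * |u - x|) (𝓝 x) (𝓝 (C * |x - x|)) := by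
      refine Continuous.tendsto ?_ x
      fun_prop
    rw [sub_self, abs_zero, mul_zero] at this
    exact (this.eventually (gt_mem_nhds (by positivity))).filter_mono nhdsWithin_le_nhds
  -- A secant from `x` to a fixed `u` so close that it is within `ε / 3` of `g'` for the limit, and,
  -- by the Lipschitz bound, within `ε / 3` of the derivative for each `f i`.
  obtain ⟨u, h2u, huR, hCu, hux⟩ := (h2.and (h3.and (h4.and self_mem_nhdsWithin))).exists
  have hux' : u ≠ x := hux
  have hpos : 0 < |u - x| := abs_pos.mpr (sub_ne_zero.mpr hux')
  have hslope : Tendsto (fun i => _root_.slope (f i) x u) l (𝓝 (_root_.slope g x u)) := by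
    simp only [slope_def_field]
    exact ((hlim u huR).sub (hlim x hx)).div_const _
  filter_upwards [hf, hC, Metric.tendsto_nhds.mp hslope (ε / 3) (by positivity)] with i hfi hCi hsi
  have hseg : ∀ w ∈ uIcc x u, |w| < R ∧ |w - x| ≤ |u - x| := fun w hw => by
    refine ⟨?_, abs_sub_left_of_mem_uIcc hw⟩
    rw [abs_lt] at hx huR ⊢
    rcases le_total x u with h | h
    · rw [uIcc_of_le h] at hw
      exact ⟨by linarith [hw.1], by linarith [hw.2]⟩
    · rw [uIcc_of_ge h] at hw
      exact ⟨by linarith [hw.1], by linarith [hw.2]⟩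
  have hCnn : 0 ≤ C := by
    have := (abs_nonneg _).trans (hCi u huR)
    exact nonneg_of_mul_nonneg_left this hpos
  have hd : ∀ w ∈ uIcc x u, HasDerivWithinAt (fun w => f i w - f' i x * w) (f' i w - f' i x)
      (uIcc x u) w := fun w hw => by
    have := (hfi w (hseg w hw).1).sub ((hasDerivAt_id w).const_mul (f' i x))
    rw [mul_one] at this
    exact this.hasDerivWithinAt
  have hmv := (convex_uIcc x u).norm_image_sub_le_of_norm_hasDerivWithin_le hd
    (C := C * |u - x|) (fun w hw => (hCi w (hseg w hw).1).trans
      (mul_le_mul_of_nonneg_left (hseg w hw).2 hCnn)) left_mem_uIcc right_mem_uIcc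
  have h5 : |_root_.slope (f i) x u - f' i x| ≤ C * |u - x| := by
    have e : _root_.slope (f i) x u - f' i x = ((f i u - f' i x * u) - (f i x - f' i x * x)) / (u - x) := by
      have : u - x ≠ 0 := sub_ne_zero.mpr hux'
      rw [slope_def_field]
      field_simp
      ring
    rw [e, abs_div, div_le_iff₀ hpos]
    exact hmv
  rw [Real.dist_eq] at h2u hsi ⊢
  rw [abs_lt] at h2u hsi ⊢
  rw [abs_le] at h5
  constructor <;> linarith

/-- If functions with uniformly bounded derivatives of all orders converge, so do the
derivatives. -/
lemma tendsto_jet {ι : Type*} {l : Filter ι} {f : ι → ℕ → ℝ → ℝ} {g : ℕ → ℝ → ℝ} {R : ℝ}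
    {C : ℕ → ℝ} (hf : ∀ᶠ i in l, ∀ n u, |u| < R → HasDerivAt (f i n) (f i (n + 1) u) u)
    (hC : ∀ᶠ i in l, ∀ n u, |u| < R → |f i n u| ≤ C n)
    (hg : ∀ n u, |u| < R → HasDerivAt (g n) (g (n + 1) u) u)
    (hlim : ∀ u, |u| < R → Tendsto (fun i => f i 0 u) l (𝓝 (g 0 u))) (n : ℕ) :
    ∀ u, |u| < R → Tendsto (fun i => f i n u) l (𝓝 (g n u)) := by
  induction n with
  | zero => exact hlim
  | succ n ih =>
    intro x hx
    -- The bound on the derivative of order `n + 2` serves as the Lipschitz constant of the one of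
    -- order `n + 1`.
    refine tendsto_deriv_of_lipschitz (C := C (n + 2)) hx (hf.mono fun i hi => hi n) ?_ (hg n x hx) ih
    filter_upwards [hf, hC] with i hfi hCi u hu
    have hconv : Convex ℝ {w : ℝ | |w| < R} := by
      have : {w : ℝ | |w| < R} = Metric.ball 0 R := by
        ext w
        simp [Real.norm_eq_abs]
      rw [this]
      exact convex_ball 0 R
    exact hconv.norm_image_sub_le_of_norm_hasDerivWithin_le
      (fun w hw => (hfi (n + 1) w hw).hasDerivWithinAt) (fun w hw => hCi (n + 2) w hw) hx hu

lemma iteratedDeriv_eq_jet {F : ℝ → ℝ} {f : ℕ → ℝ → ℝ} {R : ℝ} (h0 : ∀ u, |u| < R → F u = f 0 u)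
    (hf : ∀ n u, |u| < R → HasDerivAt (f n) (f (n + 1) u) u) (n : ℕ) :
    ∀ u, |u| < R → iteratedDeriv n F u = f n u := by
  induction n with
  | zero => simpa using h0
  | succ n ih =>
    intro u hu
    rw [iteratedDeriv_succ, ← (hf n u hu).deriv]
    refine Filter.EventuallyEq.deriv_eq ?_
    filter_upwards [continuous_abs.continuousAt.eventually (gt_mem_nhds hu)] with w hw
    exact ih w hw

lemma hasDerivAt_re_iteratedDeriv {h : ℂ → ℂ} {R : ℝ} (hh : DifferentiableOn ℂ h (Metric.ball 0 R))
    (n : ℕ) {u : ℝ} (hu : |u| < R) :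
    HasDerivAt (fun u : ℝ => (iteratedDeriv n h u).re) (iteratedDeriv (n + 1) h u).re u := by
  refine HasDerivAt.real_of_complex ?_
  rw [iteratedDeriv_succ]
  have hmem : (u : ℂ) ∈ Metric.ball (0 : ℂ) R := by
    rw [mem_ball_zero_iff, Complex.norm_real]
    exact hu
  have h1 : AnalyticAt ℂ h u := hh.analyticAt (Metric.isOpen_ball.mem_nhds hmem)
  rw [iteratedDeriv_eq_iterate]
  exact (h1.iterated_deriv n).differentiableAt.hasDerivAt

/-- Cauchy's estimate on a circle of radius `R / 4` about `u`, which lies inside the disc because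
`|u| < R / 2`. -/
lemma abs_re_iteratedDeriv_le {h : ℂ → ℂ} {R C : ℝ} (hR : 0 < R)
    (hh : DifferentiableOn ℂ h (Metric.ball 0 R)) (hC : ∀ z ∈ Metric.ball (0 : ℂ) R, ‖h z‖ ≤ C)
    (n : ℕ) {u : ℝ} (hu : |u| < R / 2) :
    |(iteratedDeriv n h u).re| ≤ n.factorial * C / (R / 4) ^ n := by
  refine (Complex.abs_re_le_norm _).trans ?_
  have hsub : Metric.closedBall (u : ℂ) (R / 4) ⊆ Metric.ball 0 R := by
    refine Metric.closedBall_subset_ball' ?_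
    rw [dist_zero_right, Complex.norm_real, Real.norm_eq_abs]
    linarith
  refine Complex.norm_iteratedDeriv_le_of_forall_mem_sphere_norm_le n (by positivity) ?_
    fun z hz => hC z (hsub (Metric.sphere_subset_closedBall hz))
  refine DifferentiableOn.diffContOnCl ?_
  rw [closure_ball _ (by positivity)]
  exact hh.mono hsub

end Jets

/-! ### Cumulants at finite time -/

section Cumulants

variable {Ω : Type*} [MeasurableSpace Ω] {P : Measure Ω} [IsProbabilityMeasure P] {ρ σ : ℝ}
  {y : Ω → ℤ → ℝ} {X : ℤ → ℝ≥0 → Ω → ℝ}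

/-- An almost surely constant configuration is independent of everything, so conditioning on it has
no effect. -/
lemma evolutionAvg_of_ae_const (hy : Measurable y) {c : ℤ → ℝ} (hc : ∀ᵐ ω ∂P, y ω = c) {f : Ω → ℝ}
    (hf : Measurable f) : evolutionAvg P y f =ᵐ[P] fun _ => ∫ ω, f ω ∂P := by
  have hind : IndepFun f y P := (indepFun_const_right f c).congr EventuallyEq.rfl
    (hc.mono fun ω hω => hω.symm)
  exact condExp_indep_eq hf.comap_le hy.comap_le (comap_measurable f).stronglyMeasurable
    ((IndepFun_iff_Indep _ _ _).mp hind)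

lemma quenchedCGF_of_ae_const (hy : Measurable y) {c : ℤ → ℝ} (hc : ∀ᵐ ω ∂P, y ω = c) {x : Ω → ℝ}
    (hx : Measurable x) : quenchedCGF P y x = cgf x P := by
  funext l
  have h := evolutionAvg_of_ae_const (P := P) hy hc (f := fun ω => Real.exp (l * x ω)) (by fun_prop)
  rw [quenchedCGF, integral_congr_ae (g := fun _ => cgf x P l) (h.mono fun ω hω => by
    simp only [hω, cgf, mgf])]
  simp

lemma contDiff_cgf_tracer (hρ : 0 < ρ) (hσ : 0 < σ) (hy : IsQuenchedUniform P ρ y)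
    (hX : IsSingleFile P σ y X) (t : ℝ≥0) {n : WithTop ℕ∞} : ContDiff ℝ n (cgf (X 0 t) P) := by
  have h : integrableExpSet (X 0 t) P = univ :=
    eq_univ_of_forall fun l => (integrable_exp_and_log hρ hσ hy hX l t).1
  refine contDiff_iff_contDiffAt.mpr fun x => (analyticAt_cgf ?_).contDiffAt
  rw [h, interior_univ]
  exact mem_univ x

lemma isLatticeTracer (hρ : 0 < ρ) (hσ : 0 < σ) (hy : IsQuenchedUniform P ρ y)
    (hX : IsSingleFile P σ y X) (hlat : ∀ᵐ ω ∂P, ∀ j : ℤ, y ω j = j / ρ) :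
    ∃ W : ℤ → ℝ≥0 → Ω → ℝ, ∀ t : ℝ≥0, 0 < t →
      IsLatticeTracer P ρ (σ * √(t : ℝ)) (fun k ω => σ / √2 * W k t ω) (X 0 t) := by
  obtain ⟨W, hW, hcoll⟩ := hX.collisions
  refine ⟨W, fun t ht => ⟨hX.measurable 0 t, fun l => (integrable_exp_and_log hρ hσ hy hX l t).1,
    hW.isFreeNoise hσ ht, fun k => ?_, ?_⟩⟩
  · have hg : Measurable fun w : ℝ => σ / √2 * w := by fun_prop
    have h : ∀ k, P.map (fun ω => σ / √2 * W k t ω) =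
        (P.map (W k t)).map fun w => σ / √2 * w := fun k =>
      (Measure.map_map hg (hW.measurable k t)).symm
    rw [h k, h 0, ((hW.brownian k).hasLaw_eval t).map_eq, ((hW.brownian 0).hasLaw_eval t).map_eq]
  · filter_upwards [ae_tracer_le_iff hρ hσ hy hX.ordered hX.continuous hX.start hW hcoll, hlat]
      with ω h1 h2 x
    simpa only [h2] using h1 t x

/-- The generating functions converge pointwise on a real interval and, after division by `√t`,
extend holomorphically with a common bound to a common disc; so all derivatives at `0` converge. -/
lemma tendsto_iteratedDeriv_quenchedCGF_div (hρ : 0 < ρ) (hσ : 0 < σ)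
    (hy : IsQuenchedUniform P ρ y) (hX : IsSingleFile P σ y X)
    (hlat : ∀ᵐ ω ∂P, ∀ j : ℤ, y ω j = j / ρ) (n : ℕ) :
    Tendsto (fun t : ℝ≥0 => iteratedDeriv n (quenchedCGF P y (X 0 t)) 0 / √(t : ℝ))
      atTop (𝓝 (iteratedDeriv n (limitCGF ρ σ) 0)) := by
  have hQ : ∀ t, quenchedCGF P y (X 0 t) = cgf (X 0 t) P := fun t =>
    quenchedCGF_of_ae_const hy.measurable (hlat.mono fun ω hω => funext hω) (hX.measurable 0 t)
  obtain ⟨R, hR, C, hC⟩ := exists_complexCGF (P := P) hρ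
  obtain ⟨W, hW⟩ := isLatticeTracer hρ hσ hy hX hlat
  have H : ∀ t : ℝ≥0, 0 < t ∧ 1 ≤ σ * √(t : ℝ) → ∃ h : ℂ → ℂ,
      DifferentiableOn ℂ h (Metric.ball 0 R) ∧ ∀ z ∈ Metric.ball (0 : ℂ) R,
        Complex.exp (h z) = ∫ ω, Complex.exp (z * X 0 t ω) ∂P ∧ ‖h z‖ ≤ C * (σ * √(t : ℝ)) :=
    fun t ht => hC _ _ _ ht.2 (hW t ht.1)
  choose! h hd hh using H
  have hev : ∀ᶠ t : ℝ≥0 in atTop, 0 < t ∧ 1 ≤ σ * √(t : ℝ) := by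
    have h1 : Tendsto (fun t : ℝ≥0 => σ * √(t : ℝ)) atTop atTop :=
      (Real.tendsto_sqrt_atTop.comp (NNReal.tendsto_coe_atTop.mpr tendsto_id)).const_mul_atTop hσ
    exact (eventually_gt_atTop 0).and (h1.eventually_ge_atTop 1)
  -- Taking norms in `e^h = mgf` identifies the real part of `h` whatever branch of the logarithm
  -- `h` represents.
  have hcgf : ∀ t : ℝ≥0, 0 < t ∧ 1 ≤ σ * √(t : ℝ) → ∀ u : ℝ, |u| < R →
      cgf (X 0 t) P u = (h t u).re := by
    intro t ht u hu
    have h1 := (hh t ht u (by rwa [mem_ball_zero_iff, Complex.norm_real])).1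
    have h2 : ∫ ω, Complex.exp (u * X 0 t ω) ∂P = (mgf (X 0 t) P u : ℂ) := by
      rw [mgf, ← integral_complex_ofReal]
      simp
    have h3 := congrArg norm h1
    rw [h2, Complex.norm_exp, Complex.norm_real, Real.norm_of_nonneg mgf_nonneg] at h3
    rw [cgf, ← h3, Real.log_exp]
  set f : ℝ≥0 → ℕ → ℝ → ℝ := fun t n u => (iteratedDeriv n (h t) u).re / √(t : ℝ) with hf
  have hjet : ∀ t : ℝ≥0, 0 < t ∧ 1 ≤ σ * √(t : ℝ) → ∀ n u, |u| < R / 2 →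
      HasDerivAt (f t n) (f t (n + 1) u) u := fun t ht n u hu =>
    (hasDerivAt_re_iteratedDeriv (hd t ht) n (by linarith)).div_const _
  have key := tendsto_jet (l := atTop) (f := f) (g := fun n => iteratedDeriv n (limitCGF ρ σ))
    (R := R / 2) (C := fun n => n.factorial * (C * σ) / (R / 4) ^ n) (hev.mono hjet) ?_ ?_ ?_ n 0
    (by rw [abs_zero]; positivity)
  · refine key.congr' (hev.mono fun t ht => ?_)
    have hpos : √(t : ℝ) ≠ 0 := (Real.sqrt_pos.mpr (by exact_mod_cast ht.1)).ne'
    have h1 := iteratedDeriv_eq_jet (F := cgf (X 0 t) P)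
      (f := fun n u => (iteratedDeriv n (h t) (u : ℝ)).re) (R := R)
      (fun u hu => by rw [hcgf t ht u hu, iteratedDeriv_zero])
      (fun n u hu => hasDerivAt_re_iteratedDeriv (hd t ht) n hu) n 0 (by rwa [abs_zero])
    change f t n 0 = iteratedDeriv n (quenchedCGF P y (X 0 t)) 0 / √(t : ℝ)
    rw [hQ, h1]
  · refine hev.mono fun t ht n u hu => ?_
    have hpos : 0 < √(t : ℝ) := Real.sqrt_pos.mpr (by exact_mod_cast ht.1)
    have h1 := abs_re_iteratedDeriv_le hR (hd t ht) (fun z hz => (hh t ht z hz).2) n hu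
    rw [hf]
    simp only
    rw [abs_div, abs_of_pos hpos, div_le_iff₀ hpos]
    refine h1.trans (le_of_eq ?_)
    ring
  · intro n u _
    have h1 : Differentiable ℝ (iteratedDeriv n (limitCGF ρ σ)) :=
      (contDiff_limitCGF ρ σ (n := ((⊤ : ℕ∞) : WithTop ℕ∞))).differentiable_iteratedDeriv n
        (by exact_mod_cast WithTop.coe_lt_top n)
    rw [iteratedDeriv_succ]
    exact (h1 u).hasDerivAt
  · intro u hu
    rw [iteratedDeriv_zero]
    refine (tendsto_quenchedCGF_div hρ hσ hy hX u).congr' (hev.mono fun t ht => ?_)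
    rw [hQ, hcgf t ht u (by linarith), hf]
    simp only [iteratedDeriv_zero]

end Cumulants

end SingleFile

end

/-! ### The theorem -/

theorem mainTheorem2 {Ω : Type*} [MeasurableSpace Ω] (P : Measure Ω) [IsProbabilityMeasure P]
    (ρ σ : ℝ) (hρ : 0 < ρ) (hσ : 0 < σ)
    (y : Ω → ℤ → ℝ) (hy : SingleFile.IsQuenchedUniform P ρ y)
    (X : ℤ → ℝ≥0 → Ω → ℝ) (hX : SingleFile.IsSingleFile P σ y X) :
    -- the integrals that occur below converge
    (IntegrableOn (fun η => SingleFile.erfc η * SingleFile.erfc (-η)) (Ioi 0) ∧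
      ∀ B, IntegrableOn (SingleFile.logIntegrand B) (Ioi 0)) ∧
    -- the cumulant generating function of the tracer
    (∀ (l : ℝ) (t : ℝ≥0),
      Integrable (fun ω => Real.exp (l * X 0 t ω)) P ∧
      Integrable (fun ω => Real.log
        (SingleFile.evolutionAvg P y (fun ω' => Real.exp (l * X 0 t ω')) ω)) P) ∧
    (∀ l : ℝ, Tendsto (fun t : ℝ≥0 => SingleFile.quenchedCGF P y (X 0 t) l / √(t : ℝ)) atTop
      (𝓝 (SingleFile.limitCGF ρ σ l))) ∧
    -- the large deviation function of the tracer: parametric form, Legendre duality, asymptotics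
    (∃ φ : ℝ → ℝ, SingleFile.IsQuenchedLDF P y (X 0) φ ∧
      Differentiable ℝ SingleFile.logIntegral ∧
      (∀ ξ : ℝ, ∃! B : ℝ, ξ = σ * deriv SingleFile.logIntegral B) ∧
      (∀ ξ B : ℝ, ξ = σ * deriv SingleFile.logIntegral B →
        φ ξ = ρ * B * ξ - ρ * σ * SingleFile.logIntegral B) ∧
      (∀ l : ℝ, IsGreatest (range fun ξ => l * ξ - φ ξ) (SingleFile.limitCGF ρ σ l)) ∧
      Tendsto (fun ξ => φ ξ / (ρ / (3 * σ ^ 2) * |ξ| ^ 3)) (Bornology.cobounded ℝ) (𝓝 1)) ∧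
    -- the cumulants (in units of `√t`)
    ContDiff ℝ ((⊤ : ℕ∞) : WithTop ℕ∞) (SingleFile.limitCGF ρ σ) ∧
    (∀ k : ℕ, iteratedDeriv (2 * k + 1) (SingleFile.limitCGF ρ σ) 0 = 0) ∧
    iteratedDeriv 2 (SingleFile.limitCGF ρ σ) 0 =
      σ / (2 * ρ) * ∫ η in Ioi (0 : ℝ), SingleFile.erfc η * SingleFile.erfc (-η) ∧
    iteratedDeriv 2 (SingleFile.limitCGF ρ σ) 0 = σ / (ρ * √(2 * Real.pi)) ∧
    iteratedDeriv 4 (SingleFile.limitCGF ρ σ) 0 =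
      σ / (2 * ρ ^ 3) * ∫ η in Ioi (0 : ℝ),
        (1 - 3 / 2 * (SingleFile.erfc η * SingleFile.erfc (-η))) *
          (SingleFile.erfc η * SingleFile.erfc (-η)) ∧
    iteratedDeriv 6 (SingleFile.limitCGF ρ σ) 0 =
      σ / (2 * ρ ^ 5) * ∫ η in Ioi (0 : ℝ),
        (1 - 15 / 2 * ((1 - SingleFile.erfc η * SingleFile.erfc (-η)) *
          (SingleFile.erfc η * SingleFile.erfc (-η)))) *
          (SingleFile.erfc η * SingleFile.erfc (-η)) ∧
    -- for equally spaced particles the finite-time cumulants have these limits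
    ((∀ᵐ ω ∂P, ∀ j : ℤ, y ω j = j / ρ) → ∀ n : ℕ,
      (∀ t : ℝ≥0, ContDiff ℝ n (SingleFile.quenchedCGF P y (X 0 t))) ∧
      Tendsto (fun t : ℝ≥0 => iteratedDeriv n (SingleFile.quenchedCGF P y (X 0 t)) 0 / √(t : ℝ))
        atTop (𝓝 (iteratedDeriv n (SingleFile.limitCGF ρ σ) 0))) := by
  refine ⟨⟨SingleFile.integrableOn_erfcProd, SingleFile.integrableOn_logIntegrand⟩,
    SingleFile.integrable_exp_and_log hρ hσ hy hX, SingleFile.tendsto_quenchedCGF_div hρ hσ hy hX,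
    ⟨SingleFile.ldf ρ σ, SingleFile.isQuenchedLDF_ldf hρ hσ hy hX,
      SingleFile.differentiable_logIntegral, fun ξ => ?_, fun ξ B h => ?_,
      SingleFile.isGreatest_legendre hρ hσ, SingleFile.tendsto_ldf_div_cube hρ hσ⟩,
    SingleFile.contDiff_limitCGF ρ σ, SingleFile.iteratedDeriv_odd_limitCGF ρ σ,
    SingleFile.iteratedDeriv_two_limitCGF hρ σ, ?_, SingleFile.iteratedDeriv_four_limitCGF hρ σ,
    SingleFile.iteratedDeriv_six_limitCGF hρ σ, fun hlat n => ⟨fun t => ?_,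
      SingleFile.tendsto_iteratedDeriv_quenchedCGF_div hρ hσ hy hX hlat n⟩⟩
  · simp only [SingleFile.eq_conjVar_iff hσ]
    exact existsUnique_eq
  · rw [(SingleFile.eq_conjVar_iff hσ).mp h, SingleFile.ldf]
  · have h := SingleFile.integral_erfcProd
    simp only [SingleFile.erfcProd] at h
    rw [SingleFile.iteratedDeriv_two_limitCGF hρ σ, h]
    field_simp
  · rw [SingleFile.quenchedCGF_of_ae_const hy.measurable (hlat.mono fun ω hω => funext hω)
      (hX.measurable 0 t)]
    exact SingleFile.contDiff_cgf_tracer hρ hσ hy hX t
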